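/- Setting. Let $(V,\omega)$ be a finite-dimensional complex symplectic vector space with a compatible real structure $\tau$, i.e. an antilinear involution with $\omega(\tau x,\tau y)=\overline{\omega(x,y)}$, and let $\gamma(x,y)=\sqrt{-1}\,\omega(x,\tau y)$ be the associated Hermitian form. A connected complex submanifold $\mathcal C\subset V$ is called *Lagrangian* if $\omega|_{T_u\mathcal C}=0$ and $2\dim_{\mathbb C} T_u\mathcal C=\dim_{\mathbb C} V$ for all $u\in\mathcal C$. It is a *special cone* if it is Lagrangian, invariant under multiplication by $\mathbb C^*$, $\gamma|_{T_u\mathcal C}$ is nondegenerate and $\gamma(u,u)\neq0$ for all $u\in\mathcal C$. The special pseudo-Kähler metric $g$ of $M=P(\mathcal C)\subset P(V)$ is then defined, with $\pi:\mathcal C\to M$ the projection, by $$g_{\pi u}(d\pi\,v,d\pi\,v)=\frac{\gamma(v,v)}{\gamma(u,u)}-\left|\frac{\gamma(v,u)}{\gamma(u,u)}\right|^2,\qquad u\in\mathcal C,\ v\in T_u\mathcal C .$$ All signatures are complex signatures (number of positive, number of negative directions over $\mathbb C$). Statement. Let $G$ be a connected complex semisimple Lie group, realized as a linear group $G\subset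 GL_m(\mathbb C)$, with Lie algebra $\mathfrak g$. Let $(V,\omega)$ be an irreducible symplectic (holomorphic, finite-dimensional) $G$-module having a highest weight vector orbit $\mathcal C\subset V$ that is Lagrangian. Let $G^0\subset G$ be the connected Lie subgroup whose Lie algebra $\mathfrak g^0=\mathfrak g^\sigma$ is the fixed point set of an antilinear involutive automorphism $\sigma$ of $\mathfrak g$ (a real form), and let $\tau$ be a $G^0$-invariant real structure on $V$ compatible with $\omega$. Let $p\in P(\mathcal C)$, and assume that the stabilizer $H^0$ of $p$ in $G^0$ is a compact real form of a maximal reductive subgroup (Levi factor) $H$ of the stabilizer $G_p$; that is, $H^0$ is compact and its Lie algebra $\mathfrak h^0$ spans over $\mathbb C$ a Levi factor $\mathfrak h$ of $\mathrm{Lie}(G_p)$. Let $M=G^0p$ and let $\mathcal C_M=\{u\in V\setminus\{0\}:\mathbb Cu\in M\}$ be the cone over $M$. Then: 1. $M$ is an open subset of $P(\mathcal C)$. 2. $\mathcal C_M$ is a special cone. 3. Let $\mathfrak a^0\subset\mathfrak h^0$ be a Cartan subalgebra of $\mathfrak g^0$ and $\mathfrak a=\mathfrak a^0\otimes\mathbb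 C$. Let $R^+$ be a system of positive roots of $\mathfrak g$, and $R_0^+\subset R^+$ a system of positive roots of $\mathfrak h$, with respect to $\mathfrak a$. Let $k$ (respectively $l$) be the number of compact (respectively noncompact) roots in $R^+\setminus R_0^+$, with respect to any Cartan decomposition $\mathfrak g^0=\mathfrak k^0+\mathfrak m^0$ with $\mathfrak a^0\subset\mathfrak k^0$. Write $p=\mathbb C^*v$. Then either $\gamma(v,v)>0$ and $\gamma$ has signature $(k+1,l)$ on (every tangent space of) $\mathcal C_M$, or $\gamma(v,v)<0$ and $\gamma$ has signature $(l,k+1)$ on $\mathcal C_M$. In both cases the special pseudo-Kähler metric $g$ of $M$ has signature $(k,l)$. 4. If $\gamma$ has signature $(a,b)$ on $\mathcal C_M$, then $g$ has signature $(a-1,b)$ if $\gamma(v,v)>0$ and signature $(b-1,a)$ if $\gamma(v,v)<0$, where $p=\mathbb C^*v$. -/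

import Mathlib

open scoped LinearAlgebra.Projectivization ComplexConjugate Topology

attribute [local instance 100] LieRing.ofAssociativeRing

noncomputable section

/-! ### Hermitian forms, complex submanifolds and cones -/

section Cones

variable {V : Type*} [NormedAddCommGroup V] [NormedSpace ℂ V]

/-- `τ` is a real structure on `V`, i.e. a `ℂ`-antilinear involution, compatible with the
complex symplectic form `ω`. -/
structure IsCompatibleRealStructure (ω : LinearMap.BilinForm ℂ V)
    (τ : V →ₛₗ[starRingEnd ℂ] V) : Prop where
  involutive : ∀ x, τ (τ x) = x
  compatible : ∀ x y, ω (τ x) (τ y) = conj (ω x y)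

/-- The form `γ (x, y) = √-1 ω (x, τ y)`, linear in `x` and antilinear in `y`. -/
def gammaForm (ω : LinearMap.BilinForm ℂ V) (τ : V →ₛₗ[starRingEnd ℂ] V) :
    V →ₗ[ℂ] V →ₛₗ[starRingEnd ℂ] ℂ :=
  LinearMap.mk₂'ₛₗ (RingHom.id ℂ) (starRingEnd ℂ) (fun x y => Complex.I * ω x (τ y))
    (fun x x' y => by simp [mul_add])
    (fun c x y => by simp [mul_left_comm])
    (fun x y y' => by simp [mul_add])
    (fun c x y => by simp [mul_left_comm])

/-- The restriction of the Hermitian form `h` to the subspace `T` is nondegenerate of (complex)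
signature `(a, b)`: `T` is the `h`-orthogonal direct sum of an `a`-dimensional subspace on which
`h` is positive definite and a `b`-dimensional one on which it is negative definite. -/
def HasSignature {E : Type*} [AddCommGroup E] [Module ℂ E]
    (h : E →ₗ[ℂ] E →ₛₗ[starRingEnd ℂ] ℂ) (T : Submodule ℂ E) (a b : ℕ) : Prop :=
  ∃ P N : Submodule ℂ E, P ⊔ N = T ∧ Disjoint P N ∧
    Module.finrank ℂ P = a ∧ Module.finrank ℂ N = b ∧
    (∀ x ∈ P, x ≠ 0 → 0 < (h x x).re) ∧ (∀ x ∈ N, x ≠ 0 → (h x x).re < 0) ∧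
    (∀ x ∈ P, ∀ y ∈ N, h x y = 0)

/-- `S ⊆ V` is an (embedded) complex submanifold: near each of its points some biholomorphic
chart of `V` maps `S` onto an open piece of a complex linear subspace. -/
def IsComplexSubmanifold (S : Set V) : Prop :=
  ∀ u ∈ S, ∃ (Φ : OpenPartialHomeomorph V V) (F : Submodule ℂ V),
    u ∈ Φ.source ∧ AnalyticOnNhd ℂ Φ Φ.source ∧ AnalyticOnNhd ℂ Φ.symm Φ.target ∧
    Φ '' (Φ.source ∩ S) = Φ.target ∩ (F : Set V)

/-- The tangent space `T_u S`, as a subspace of `V`. -/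
def tangentSpaceAt (S : Set V) (u : V) : Submodule ℂ V :=
  Submodule.span ℂ (tangentConeAt ℂ S u)

def IsConic (S : Set V) : Prop := ∀ c : ℂ, c ≠ 0 → ∀ u ∈ S, c • u ∈ S

def IsTotallyIsotropic (ω : LinearMap.BilinForm ℂ V) (S : Set V) : Prop :=
  ∀ u ∈ S, ∀ x ∈ tangentSpaceAt S u, ∀ y ∈ tangentSpaceAt S u, ω x y = 0

/-- A Lagrangian submanifold: a connected complex submanifold, totally isotropic and of half the
dimension of `V`. -/
structure IsLagrangian (ω : LinearMap.BilinForm ℂ V) (S : Set V) : Prop where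
  submanifold : IsComplexSubmanifold S
  connected : IsConnected S
  isotropic : IsTotallyIsotropic ω S
  half_dim : ∀ u ∈ S, 2 * Module.finrank ℂ (tangentSpaceAt S u) = Module.finrank ℂ V

/-- The restriction of the form `h` to `S` is nondegenerate. -/
def IsPseudoKahler (h : V →ₗ[ℂ] V →ₛₗ[starRingEnd ℂ] ℂ) (S : Set V) : Prop :=
  ∀ u ∈ S, ∀ x ∈ tangentSpaceAt S u, (∀ y ∈ tangentSpaceAt S u, h x y = 0) → x = 0

/-- A special cone in `(V, ω, τ)`. -/
structure IsSpecialCone (ω : LinearMap.BilinForm ℂ V) (τ : V →ₛₗ[starRingEnd ℂ] V)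
    (S : Set V) : Prop where
  conic : IsConic S
  lagrangian : IsLagrangian ω S
  pseudoKahler : IsPseudoKahler (gammaForm ω τ) S
  ne_zero : ∀ u ∈ S, gammaForm ω τ u u ≠ 0

/-- The Hermitian form
`(v, w) ↦ h (v, w) / h (u, u) - h (v, u) h (u, w) / h (u, u) ^ 2` on `V`. For Hermitian `h` its
quadratic form is `v ↦ h (v, v) / h (u, u) - |h (v, u) / h (u, u)| ^ 2`. -/
def projFormLift (h : V →ₗ[ℂ] V →ₛₗ[starRingEnd ℂ] ℂ) (u : V) :
    V →ₗ[ℂ] V →ₛₗ[starRingEnd ℂ] ℂ :=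
  LinearMap.mk₂'ₛₗ (RingHom.id ℂ) (starRingEnd ℂ)
    (fun v w => h v w / h u u - h v u * h u w / (h u u) ^ 2)
    (fun x x' y => by simp; ring)
    (fun c x y => by simp; ring)
    (fun x y y' => by simp; ring)
    (fun c x y => by simp; ring)

theorem projFormLift_self_left (h : V →ₗ[ℂ] V →ₛₗ[starRingEnd ℂ] ℂ) (u w : V) :
    projFormLift h u u w = 0 := by
  by_cases h0 : h u u = 0
  · simp [projFormLift, h0]
  · simp only [projFormLift, LinearMap.mk₂'ₛₗ_apply]
    field_simp
    ring

theorem projFormLift_self_right (h : V →ₗ[ℂ] V →ₛₗ[starRingEnd ℂ] ℂ) (u v : V) :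
    projFormLift h u v u = 0 := by
  by_cases h0 : h u u = 0
  · simp [projFormLift, h0]
  · simp only [projFormLift, LinearMap.mk₂'ₛₗ_apply]
    field_simp
    ring

/-- The form induced by `projFormLift h u` on `V ⧸ ℂ u`. Through the differential at `u` of the
projection `π : V \ {0} → P(V)`, whose kernel is `ℂ u`, the space `V ⧸ ℂ u` is identified with the
tangent space of `P(V)` at `π u`. -/
def projForm (h : V →ₗ[ℂ] V →ₛₗ[starRingEnd ℂ] ℂ) (u : V) :
    (V ⧸ Submodule.span ℂ {u}) →ₗ[ℂ] (V ⧸ Submodule.span ℂ {u}) →ₛₗ[starRingEnd ℂ] ℂ :=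
  Submodule.liftQ (Submodule.span ℂ {u})
    { toFun := fun v => Submodule.liftQ (Submodule.span ℂ {u}) (projFormLift h u v)
        ((Submodule.span_singleton_le_iff_mem _ _).2 (projFormLift_self_right h u v))
      map_add' := fun v v' => by
        refine LinearMap.ext fun y => ?_
        obtain ⟨w, rfl⟩ := Submodule.mkQ_surjective _ y
        simp
      map_smul' := fun c v => by
        refine LinearMap.ext fun y => ?_
        obtain ⟨w, rfl⟩ := Submodule.mkQ_surjective _ y
        simp }
    ((Submodule.span_singleton_le_iff_mem _ _).2 (by
      refine LinearMap.ext fun y => ?_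
      obtain ⟨w, rfl⟩ := Submodule.mkQ_surjective _ y
      simpa using projFormLift_self_left h u w))

theorem projForm_mk (h : V →ₗ[ℂ] V →ₛₗ[starRingEnd ℂ] ℂ) (u v w : V) :
    projForm h u (Submodule.Quotient.mk v) (Submodule.Quotient.mk w) =
      h v w / h u u - h v u * h u w / (h u u) ^ 2 := rfl

/-- The topology of the projective space, the quotient topology from `V \ {0}`. -/
@[reducible] def projTopology (V : Type*) [NormedAddCommGroup V] [NormedSpace ℂ V] :
    TopologicalSpace (ℙ ℂ V) :=
  TopologicalSpace.coinduced (Projectivization.mk' ℂ : {v : V // v ≠ 0} → ℙ ℂ V) inferInstance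

/-- `P(S)`, the set of lines through the nonzero points of `S ⊆ V`. -/
def projSet (S : Set V) : Set (ℙ ℂ V) :=
  {q | ∃ u, ∃ hu : u ≠ 0, u ∈ S ∧ Projectivization.mk ℂ u hu = q}

/-- The cone in `V` (without its apex) over a subset `M` of the projective space. -/
def coneOver (M : Set (ℙ ℂ V)) : Set V :=
  {u | ∃ hu : u ≠ 0, Projectivization.mk ℂ u hu ∈ M}

end Cones

/-! ### Roots, real forms and Levi factors of complex Lie algebras -/

section LieAlg

variable {L : Type*} [LieRing L] [LieAlgebra ℂ L]

/-- The roots of the subalgebra `H` with respect to `A`. -/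
def rootsOf (A H : LieSubalgebra ℂ L) : Set (Module.Dual ℂ A) :=
  {α | α ≠ 0 ∧ ∃ x ∈ H, x ≠ 0 ∧ ∀ a : A, ⁅(a : L), x⁆ = α a • x}

/-- `P` is a system of positive roots of the (symmetric) root system `R`. -/
structure IsPositiveSystem {E : Type*} [AddCommGroup E] (R P : Set E) : Prop where
  subset : P ⊆ R
  mem_or_neg_mem : ∀ α ∈ R, α ∈ P ∨ -α ∈ P
  neg_notMem : ∀ α ∈ P, -α ∉ P
  add_mem : ∀ α ∈ P, ∀ β ∈ P, α + β ∈ R → α + β ∈ P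

/-- `σ` is an antilinear involutive automorphism of the complex Lie algebra `L`. The corresponding
real form of `L` is its fixed point set. -/
structure IsConjugation (σ : L →ₛₗ[starRingEnd ℂ] L) : Prop where
  involutive : ∀ x, σ (σ x) = x
  map_lie : ∀ x y, σ ⁅x, y⁆ = ⁅σ x, σ y⁆

/-- `θ` is (the complex linear extension to `L` of) a Cartan involution of the real form fixed by
`σ`. -/
structure IsCartanInvolution (σ : L →ₛₗ[starRingEnd ℂ] L) (θ : L ≃ₗ⁅ℂ⁆ L) : Prop where
  involutive : ∀ x, θ (θ x) = x
  comm : ∀ x, θ (σ x) = σ (θ x)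
  neg : ∀ x, σ x = x → x ≠ 0 → (killingForm ℂ L x (θ x)).re < 0

/-- The root space of `α` lies in the complexification of the compact part `k` of the Cartan
decomposition `k + m` of the real form, given by the Cartan involution `θ`. -/
def IsCompactRoot (θ : L ≃ₗ⁅ℂ⁆ L) (A : LieSubalgebra ℂ L) (α : Module.Dual ℂ A) : Prop :=
  ∀ x : L, (∀ a : A, ⁅(a : L), x⁆ = α a • x) → θ x = x

/-- The root space of `α` lies in the complexification of the noncompact part `m` of the Cartan
decomposition `k + m` of the real form, given by the Cartan involution `θ`. -/
def IsNoncompactRoot (θ : L ≃ₗ⁅ℂ⁆ L) (A : LieSubalgebra ℂ L) (α : Module.Dual ℂ A) : Prop :=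
  ∀ x : L, (∀ a : A, ⁅(a : L), x⁆ = α a • x) → θ x = -x

/-- `H` is a maximal reductive subalgebra (Levi factor) of the parabolic subalgebra `P`:
a reductive subalgebra that is complementary to a nilpotent ideal `N` of `P`. -/
structure IsLeviFactor (P H : LieSubalgebra ℂ L) : Prop where
  le : H ≤ P
  reductive : LieAlgebra.HasCentralRadical ℂ H
  compl : ∃ N : LieSubalgebra ℂ L, N ≤ P ∧ (∀ x ∈ P, ∀ y ∈ N, ⁅x, y⁆ ∈ N) ∧
    LieRing.IsNilpotent N ∧ H.toSubmodule ⊔ N.toSubmodule = P.toSubmodule ∧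
    Disjoint H.toSubmodule N.toSubmodule

end LieAlg

/-! ### Connected complex linear groups and their modules -/

section Groups

variable {m : ℕ} (L : LieSubalgebra ℂ (Matrix (Fin m) (Fin m) ℂ))

/-- The connected Lie subgroup `G` of `GL_m(ℂ)` with Lie algebra `L`, i.e. the group generated by
the exponentials of the elements of `L`. -/
def connGroup : Subgroup (Matrix (Fin m) (Fin m) ℂ)ˣ :=
  Subgroup.closure (Set.range fun x : L => (Matrix.isUnit_exp (x : Matrix (Fin m) (Fin m) ℂ)).unit)

/-- The exponential map from `L` to `G`. -/
def groupExp (x : L) : connGroup L :=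
  ⟨(Matrix.isUnit_exp (x : Matrix (Fin m) (Fin m) ℂ)).unit,
    Subgroup.subset_closure ⟨x, rfl⟩⟩

/-- The connected Lie subgroup `G⁰` of `G` whose Lie algebra is the real form of `L` fixed by the
conjugation `σ`. -/
def realFormGroup (σ : L →ₛₗ[starRingEnd ℂ] L) : Subgroup (connGroup L) :=
  Subgroup.closure {g | ∃ x : L, σ x = x ∧ g = groupExp L x}

/-- A `G`-module structure on `V`: a holomorphic representation of `G` together with its
differential. -/
structure HolomorphicRep (V : Type*) [NormedAddCommGroup V] [NormedSpace ℂ V] where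
  /-- the representation -/
  toHom : connGroup L →* (V →L[ℂ] V)ˣ
  /-- its differential at the unit element -/
  diff : L →ₗ⁅ℂ⁆ (V →L[ℂ] V)
  map_exp : ∀ x : L, (toHom (groupExp L x) : V →L[ℂ] V) = NormedSpace.exp (diff x)

namespace HolomorphicRep

variable {L} {V : Type*} [NormedAddCommGroup V] [NormedSpace ℂ V] (ρ : HolomorphicRep L V)

/-- The action of `g` on vectors. -/
def act (g : connGroup L) : V →L[ℂ] V := (ρ.toHom g : V →L[ℂ] V)

/-- The action of `g` on the projective space. -/
def projAct (g : connGroup L) (q : ℙ ℂ V) : ℙ ℂ V := ρ.toHom g • q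

theorem projAct_mk (g : connGroup L) (v : V) (hv : v ≠ 0) (hg : ρ.act g v ≠ 0) :
    ρ.projAct g (Projectivization.mk ℂ v hv) = Projectivization.mk ℂ (ρ.act g v) hg := rfl

/-- The `G`-module `V` is irreducible. -/
def IsIrred : Prop :=
  Nontrivial V ∧ ∀ U : Submodule ℂ V, (∀ g, ∀ u ∈ U, ρ.act g u ∈ U) → U = ⊥ ∨ U = ⊤

/-- `ω` is a `G`-invariant complex symplectic form on `V`. -/
structure IsInvariantSymplectic (ω : LinearMap.BilinForm ℂ V) : Prop where
  alt : ω.IsAlt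
  nondegenerate : ω.Nondegenerate
  invariant : ∀ g x y, ω (ρ.act g x) (ρ.act g y) = ω x y

/-- `v` is a highest weight vector with respect to some Cartan subalgebra `A` and some system of
positive roots. -/
def IsHighestWeightVector (v : V) : Prop :=
  v ≠ 0 ∧ ∃ A : LieSubalgebra ℂ L, A.IsCartanSubalgebra ∧
    ∃ P : Set (Module.Dual ℂ A), IsPositiveSystem (rootsOf A ⊤) P ∧
    (∃ Λ : Module.Dual ℂ A, ∀ a : A, ρ.diff a v = Λ a • v) ∧
    ∀ α ∈ P, ∀ x : L, (∀ a : A, ⁅(a : L), x⁆ = α a • x) → ρ.diff x v = 0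

/-- The Lie algebra of the stabilizer `G_p` of `p`. -/
def stabAlgebra (p : ℙ ℂ V) : LieSubalgebra ℂ L where
  carrier := {x | ∀ w ∈ p.submodule, ρ.diff x w ∈ p.submodule}
  add_mem' := fun {x y} hx hy w hw => by
    simpa using add_mem (hx w hw) (hy w hw)
  zero_mem' := fun w hw => by simp
  smul_mem' := fun c x hx w hw => by
    simpa using Submodule.smul_mem _ c (hx w hw)
  lie_mem' := fun {x y} hx hy w hw => by
    simpa [Ring.lie_def] using sub_mem (hx _ (hy w hw)) (hy _ (hx w hw))

/-- The orbit `G⁰ p` in the projective space. -/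
def realOrbit (σ : L →ₛₗ[starRingEnd ℂ] L) (p : ℙ ℂ V) : Set (ℙ ℂ V) :=
  {q | ∃ g ∈ realFormGroup L σ, q = ρ.projAct g p}

/-- The stabilizer `H⁰` of `p` in `G⁰`, as a subset of `G`. -/
def realStab (σ : L →ₛₗ[starRingEnd ℂ] L) (p : ℙ ℂ V) : Set (connGroup L) :=
  {g | g ∈ realFormGroup L σ ∧ ρ.projAct g p = p}

/-- The Lie algebra of `H⁰`, as a subset of `L`. -/
def realStabAlgebra (σ : L →ₛₗ[starRingEnd ℂ] L) (p : ℙ ℂ V) : Set L :=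
  {x | σ x = x ∧ x ∈ ρ.stabAlgebra p}

/-- The stabilizer `H⁰` of `p` in `G⁰` is a compact real form of the maximal reductive subgroup
of `G_p` with Lie algebra `H`. -/
structure IsCompactFormOfLevi (σ : L →ₛₗ[starRingEnd ℂ] L) (p : ℙ ℂ V)
    (H : LieSubalgebra ℂ L) : Prop where
  levi : IsLeviFactor (ρ.stabAlgebra p) H
  compact : IsCompact (ρ.realStab σ p)
  complexification : Submodule.span ℂ (ρ.realStabAlgebra σ p) = H.toSubmodule

end HolomorphicRep

end Groups

end

/-! ### Signatures of Hermitian forms -/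

/-! Write p = ℂv, P for the stabilizer of p in L, N for the Killing-orthogonal of P, and T = Lv. Two
inputs drive the proof. Since v lies in a highest weight orbit, P contains a Borel subalgebra that
fixes the line, so N kills v (`IsHighestWeightOrbit.apply_eq_zero_of_orthogonal`). Moreover T is the
whole tangent cone of the orbit: the orbit satisfies quadratic equations whose linearization at v
has no solutions outside T (`IsPositiveSystem.tangentConeAt_subset`). Since H⁰ is compact, ad x has
imaginary eigenvalues and no Jordan blocks for x in the real stabilizer, so the Killing form is
negative definite there (`killingForm_re_neg`).

These inputs give L = P ⊕ σN (`stab_sup_stabOrthConj`, `eq_zero_of_mem_stab_stabOrthConj`). The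
adjoint of x for γ is -σ(x), so σN maps V into the γ-orthogonal of v.

Openness: if y is in σN then σy kills v, so yv = (y + σy)v is a real direction. The real group
together with scalars thus moves v in all directions of T, and a submersion argument makes the cone
open in C (`range_mem_nhdsWithin`).

Special cone: if γ(v,v) = 0, the γ-orthogonal of v contains v and is stable under σN, hence is all
of V by irreducibility, a contradiction. For nondegeneracy, let z represent the character of P on v
through the Killing form. Then σz = -z and zv = cv with c real and nonzero. Every r in the radical
of γ on T satisfies zr = cr. As T is Lagrangian, τr is again in the radical, while zτr = -τzr =
-cτr. Hence r = 0 (`gamma_nondegenerate`).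

Signature: of each pair of opposite roots outside H, one root vector e lies in σN. The vectors ev,
together with v, form a γ-orthogonal basis of T, and γ(ev,ev) = -r K(σe,e) γ(v,v) with r > 0 by sl₂
theory (`gamma_apply_self`). The Cartan involution makes K(σe,e) negative for compact and positive
for noncompact roots. The metric on the quotient by ℂu is γ/γ(u,u) on the orthogonal complement of u
(`HasSignature.projForm_of_pos`), and homogeneity spreads everything over the cone. -/

section Signature

variable {E : Type*} [AddCommGroup E] [Module ℂ E]

/-- The form `h` is Hermitian. -/
def IsHermForm (h : E →ₗ[ℂ] E →ₛₗ[starRingEnd ℂ] ℂ) : Prop := ∀ x y, conj (h x y) = h y x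

variable {h : E →ₗ[ℂ] E →ₛₗ[starRingEnd ℂ] ℂ}

theorem IsHermForm.apply_self (hh : IsHermForm h) (x : E) : h x x = ((h x x).re : ℂ) :=
  (Complex.conj_eq_iff_re.1 (hh x x)).symm

theorem IsHermForm.re_ne_zero (hh : IsHermForm h) {x : E} (hx : h x x ≠ 0) : (h x x).re ≠ 0 := by
  intro h0
  apply hx
  rw [hh.apply_self, h0, Complex.ofReal_zero]

theorem IsHermForm.symm_zero (hh : IsHermForm h) {x y : E} (hx : h x y = 0) : h y x = 0 := by
  rw [← hh, hx, map_zero]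

theorem IsHermForm.neg (hh : IsHermForm h) : IsHermForm (-h) := fun x y => by
  simp [← hh x y]

theorem HasSignature.neg {T : Submodule ℂ E} {a b : ℕ} (H : HasSignature h T a b)
    (hh : IsHermForm h) : HasSignature (-h) T b a := by
  obtain ⟨P, N, h1, h2, h3, h4, h5, h6, h7⟩ := H
  refine ⟨N, P, by rw [sup_comm, h1], h2.symm, h4, h3, fun x hx h0 => ?_, fun x hx h0 => ?_,
    fun x hx y hy => ?_⟩
  · simpa using h6 x hx h0
  · simpa using h5 x hx h0
  · simpa using hh.symm_zero (h7 y hy x hx)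

theorem HasSignature.bot : HasSignature h ⊥ 0 0 :=
  ⟨⊥, ⊥, by simp, by simp, by simp, by simp, by simp, by simp, by simp⟩

theorem HasSignature.add_pos [FiniteDimensional ℂ E] {T : Submodule ℂ E} {a b : ℕ}
    (H : HasSignature h T a b) (hh : IsHermForm h) {x : E} (hx : 0 < (h x x).re)
    (hxT : ∀ y ∈ T, h x y = 0) : HasSignature h (Submodule.span ℂ {x} ⊔ T) (a + 1) b := by
  obtain ⟨P, N, h1, h2, h3, h4, h5, h6, h7⟩ := H
  have hPT : P ≤ T := h1 ▸ le_sup_left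
  have hNT : N ≤ T := h1 ▸ le_sup_right
  have hxT' : ∀ y ∈ T, h y x = 0 := fun y hy => hh.symm_zero (hxT y hy)
  have hx0 : x ≠ 0 := by rintro rfl; simp at hx
  have key : ∀ c : ℂ, ∀ y ∈ T, c • x + y = 0 → c = 0 := by
    intro c y hy hc
    have : h (c • x + y) x = 0 := by rw [hc]; simp
    simp only [map_add, map_smul, LinearMap.add_apply, LinearMap.smul_apply, smul_eq_mul,
      hxT' y hy, add_zero, mul_eq_zero] at this
    rcases this with h' | h'
    · exact h'
    · rw [h'] at hx; simp at hx
  refine ⟨Submodule.span ℂ {x} ⊔ P, N, by rw [sup_assoc, h1], ?_, ?_, h4, ?_, h6, ?_⟩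
  · rw [Submodule.disjoint_def] at h2 ⊢
    intro y hy hyN
    obtain ⟨u, hu, w, hw, rfl⟩ := Submodule.mem_sup.1 hy
    obtain ⟨c, rfl⟩ := Submodule.mem_span_singleton.1 hu
    have hc : c = 0 := key c (w - (c • x + w)) (T.sub_mem (hPT hw) (hNT hyN)) (by abel)
    subst hc
    simp only [zero_smul, zero_add] at hyN ⊢
    exact h2 w hw hyN
  · have hd : Disjoint (Submodule.span ℂ {x}) P := by
      rw [Submodule.disjoint_def]
      intro y hy hyP
      obtain ⟨c, rfl⟩ := Submodule.mem_span_singleton.1 hy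
      have hc : c = 0 := key c (-(c • x)) (T.neg_mem (hPT hyP)) (by abel)
      simp [hc]
    have := Submodule.finrank_sup_add_finrank_inf_eq (Submodule.span ℂ {x}) P
    rw [hd.eq_bot, finrank_bot, finrank_span_singleton hx0, h3] at this
    omega
  · intro y hy hy0
    obtain ⟨u, hu, w, hw, rfl⟩ := Submodule.mem_sup.1 hy
    obtain ⟨c, rfl⟩ := Submodule.mem_span_singleton.1 hu
    have e : (h (c • x + w) (c • x + w)).re = Complex.normSq c * (h x x).re + (h w w).re := by
      simp only [map_add, map_smul, LinearMap.add_apply, LinearMap.smul_apply, smul_eq_mul,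
        LinearMap.map_smulₛₗ, hxT w (hPT hw), hxT' w (hPT hw), mul_zero, add_zero, zero_add]
      rw [hh.apply_self x, Complex.add_re, mul_left_comm, ← mul_assoc,
        Complex.mul_conj, ← Complex.ofReal_mul, Complex.ofReal_re, Complex.ofReal_re]
    rw [e]
    by_cases hc : c = 0
    · subst hc
      simp only [zero_smul, zero_add, ne_eq, Complex.normSq_zero, zero_mul] at hy0 ⊢
      exact h5 w hw hy0
    · have h1 : 0 < Complex.normSq c * (h x x).re := mul_pos (Complex.normSq_pos.2 hc) hx
      by_cases hw0 : w = 0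
      · subst hw0; simpa using h1
      · exact _root_.add_pos h1 (h5 w hw hw0)
  · intro y hy z hz
    obtain ⟨u, hu, w, hw, rfl⟩ := Submodule.mem_sup.1 hy
    obtain ⟨c, rfl⟩ := Submodule.mem_span_singleton.1 hu
    simp [hxT z (hNT hz), h7 w hw z hz]

theorem HasSignature.add_neg [FiniteDimensional ℂ E] {T : Submodule ℂ E} {a b : ℕ}
    (H : HasSignature h T a b) (hh : IsHermForm h) {x : E} (hx : (h x x).re < 0)
    (hxT : ∀ y ∈ T, h x y = 0) : HasSignature h (Submodule.span ℂ {x} ⊔ T) a (b + 1) := by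
  have := ((H.neg hh).add_pos hh.neg (x := x) (by simpa using hx)
    (fun y hy => by simpa using hxT y hy)).neg hh.neg
  rwa [neg_neg] at this

/-- A positive definite subspace meets a negative definite one trivially, so P ⊕ N' fits into T = P'
⊕ N' and dimensions can be compared. -/
theorem HasSignature.le_of [FiniteDimensional ℂ E] {T : Submodule ℂ E} {a b a' b' : ℕ}
    (H : HasSignature h T a b) (H' : HasSignature h T a' b') : a ≤ a' := by
  obtain ⟨P, N, h1, h2, h3, h4, h5, h6, h7⟩ := H
  obtain ⟨P', N', h1', h2', h3', h4', h5', h6', h7'⟩ := H'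
  have hd : P ⊓ N' = ⊥ := by
    rw [Submodule.eq_bot_iff]
    rintro x ⟨hx, hx'⟩
    by_contra h0
    exact lt_asymm (h5 x hx h0) (h6' x hx' h0)
  have e1 := Submodule.finrank_sup_add_finrank_inf_eq P N'
  have e2 := Submodule.finrank_sup_add_finrank_inf_eq P' N'
  have e3 : Module.finrank ℂ ↥(P ⊔ N') ≤ Module.finrank ℂ ↥(P' ⊔ N') := by
    apply Submodule.finrank_mono
    rw [h1']
    exact sup_le (h1 ▸ le_sup_left) (h1' ▸ le_sup_right)
  rw [hd, finrank_bot] at e1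
  rw [h2'.eq_bot, finrank_bot] at e2
  omega

/-- Sylvester's law of inertia. -/
theorem HasSignature.unique [FiniteDimensional ℂ E] {T : Submodule ℂ E} {a b a' b' : ℕ}
    (hh : IsHermForm h) (H : HasSignature h T a b) (H' : HasSignature h T a' b') :
    a = a' ∧ b = b' :=
  ⟨le_antisymm (H.le_of H') (H'.le_of H),
    le_antisymm ((H.neg hh).le_of (H'.neg hh)) ((H'.neg hh).le_of (H.neg hh))⟩

theorem HasSignature.nondegenerate {T : Submodule ℂ E} {a b : ℕ} (H : HasSignature h T a b)
    (hh : IsHermForm h) : ∀ x ∈ T, (∀ y ∈ T, h x y = 0) → x = 0 := by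
  obtain ⟨P, N, rfl, h2, h3, h4, h5, h6, h7⟩ := H
  intro x hx hxT
  obtain ⟨u, hu, w, hw, rfl⟩ := Submodule.mem_sup.1 hx
  have e1 := hxT u (Submodule.mem_sup_left hu)
  have e2 := hxT w (Submodule.mem_sup_right hw)
  simp only [map_add, LinearMap.add_apply, h7 u hu w hw, hh.symm_zero (h7 u hu w hw), zero_add,
    add_zero] at e1 e2
  have hu0 : u = 0 := by
    by_contra h0
    have := h5 u hu h0
    rw [e1] at this; simp at this
  have hw0 : w = 0 := by
    by_contra h0
    have := h6 w hw h0
    rw [e2] at this; simp at this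
  rw [hu0, hw0, add_zero]

/-- The `h`-orthogonal complement of `x` in `T`. -/
def orthIn (h : E →ₗ[ℂ] E →ₛₗ[starRingEnd ℂ] ℂ) (T : Submodule ℂ E) (x : E) : Submodule ℂ E where
  carrier := {y | y ∈ T ∧ h y x = 0}
  add_mem' := fun {y z} hy hz => ⟨T.add_mem hy.1 hz.1, by simp [hy.2, hz.2]⟩
  zero_mem' := ⟨T.zero_mem, by simp⟩
  smul_mem' := fun c y hy => ⟨T.smul_mem c hy.1, by simp [hy.2]⟩

theorem span_sup_orthIn {T : Submodule ℂ E} {x : E} (hxT : x ∈ T) (hx : h x x ≠ 0) :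
    Submodule.span ℂ {x} ⊔ orthIn h T x = T := by
  apply le_antisymm
  · exact sup_le ((Submodule.span_singleton_le_iff_mem _ _).2 hxT) fun y hy => hy.1
  · intro y hy
    refine Submodule.mem_sup.2 ⟨(h y x / h x x) • x, Submodule.smul_mem _ _
      (Submodule.mem_span_singleton_self x), y - (h y x / h x x) • x,
      ⟨T.sub_mem hy (T.smul_mem _ hxT), ?_⟩, by abel⟩
    simp [hx]

/-- Polarization: the values at x + y and x + iy together determine h x y. -/
theorem exists_self_ne_zero {T : Submodule ℂ E}
    (hT : ∃ x ∈ T, ∃ y ∈ T, h x y ≠ 0) : ∃ x ∈ T, h x x ≠ 0 := by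
  by_contra! hc
  obtain ⟨x, hx, y, hy, hxy⟩ := hT
  have h1 := hc (x + y) (T.add_mem hx hy)
  have h2 := hc (x + Complex.I • y) (T.add_mem hx (T.smul_mem _ hy))
  simp only [map_add, LinearMap.add_apply, hc x hx, hc y hy, map_smul, LinearMap.smul_apply,
    LinearMap.map_smulₛₗ, smul_eq_mul, Complex.conj_I, mul_zero, add_zero, zero_add] at h1 h2
  apply hxy
  have h3 : Complex.I * h y x + -Complex.I * h x y = 0 := by linear_combination h2
  have h4 : Complex.I * (h y x - h x y) = 0 := by linear_combination h3
  have h5 : h y x - h x y = 0 := by simpa using h4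
  have h6 : (2 : ℂ) * h x y = 0 := by linear_combination h1 - h5
  simpa using h6

theorem orthIn_nondegenerate {T : Submodule ℂ E}
    (hT : ∀ x ∈ T, (∀ y ∈ T, h x y = 0) → x = 0) {x : E} (hxT : x ∈ T) (hx : h x x ≠ 0) :
    ∀ y ∈ orthIn h T x, (∀ z ∈ orthIn h T x, h y z = 0) → y = 0 := by
  intro y hy hyz
  refine hT y hy.1 fun w hw => ?_
  rw [← span_sup_orthIn hxT hx] at hw
  obtain ⟨u, hu, w, hw', rfl⟩ := Submodule.mem_sup.1 hw
  obtain ⟨c, rfl⟩ := Submodule.mem_span_singleton.1 hu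
  simp [hy.2, hyz w hw']

/-- Orthogonalization: split off a non-isotropic vector and continue in its complement. -/
theorem exists_hasSignature [FiniteDimensional ℂ E] (hh : IsHermForm h) :
    ∀ (n : ℕ) (T : Submodule ℂ E), Module.finrank ℂ T = n →
      (∀ x ∈ T, (∀ y ∈ T, h x y = 0) → x = 0) → ∃ a b, HasSignature h T a b := by
  intro n
  induction n using Nat.strong_induction_on with
  | _ n ih =>
    intro T hn hT
    by_cases hT0 : T = ⊥
    · subst hT0
      exact ⟨0, 0, HasSignature.bot⟩
    obtain ⟨x, hxT, hx0⟩ := T.ne_bot_iff.1 hT0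
    obtain ⟨x, hxT, hx⟩ := exists_self_ne_zero (T := T) (by
      by_contra! hc
      exact hx0 (hT x hxT fun y hy => hc x hxT y hy))
    have hlt : orthIn h T x < T := by
      refine lt_of_le_of_ne (fun y hy => hy.1) fun he => hx ?_
      have : x ∈ orthIn h T x := by rw [he]; exact hxT
      exact this.2
    obtain ⟨a, b, hab⟩ := ih _ (hn ▸ Submodule.finrank_lt_finrank_of_lt hlt) (orthIn h T x) rfl
      (orthIn_nondegenerate hT hxT hx)
    have hor : ∀ y ∈ orthIn h T x, h x y = 0 := fun y hy => hh.symm_zero hy.2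
    rcases lt_or_gt_of_ne (hh.re_ne_zero hx) with h0 | h0
    · exact ⟨a, b + 1, span_sup_orthIn hxT hx ▸ hab.add_neg hh h0 hor⟩
    · exact ⟨a + 1, b, span_sup_orthIn hxT hx ▸ hab.add_pos hh h0 hor⟩

/-- Serves two purposes: translation by group elements with r = 1, and passage to the quotient by ℂu
with r = 1 / h(u,u). -/
theorem HasSignature.map {F : Type*} [AddCommGroup F] [Module ℂ F]
    {k : F →ₗ[ℂ] F →ₛₗ[starRingEnd ℂ] ℂ} {T : Submodule ℂ E} {a b : ℕ}
    (H : HasSignature h T a b) (f : E →ₗ[ℂ] F) (hf : Set.InjOn f T) {r : ℝ} (hr : 0 < r)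
    (hk : ∀ x ∈ T, ∀ y ∈ T, k (f x) (f y) = r * h x y) : HasSignature k (T.map f) a b := by
  obtain ⟨P, N, rfl, h2, h3, h4, h5, h6, h7⟩ := H
  have hP : ∀ x ∈ P, x ∈ P ⊔ N := fun x hx => Submodule.mem_sup_left hx
  have hN : ∀ x ∈ N, x ∈ P ⊔ N := fun x hx => Submodule.mem_sup_right hx
  have hfr : ∀ S : Submodule ℂ E, (∀ x ∈ S, x ∈ P ⊔ N) →
      Module.finrank ℂ (S.map f) = Module.finrank ℂ S := by
    intro S hS
    have hinj : Function.Injective (f.submoduleMap S) := by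
      intro x y hxy
      exact Subtype.ext (hf (hS x x.2) (hS y y.2) (congrArg Subtype.val hxy))
    exact (LinearEquiv.ofBijective (f.submoduleMap S)
      ⟨hinj, f.submoduleMap_surjective S⟩).finrank_eq.symm
  refine ⟨P.map f, N.map f, (Submodule.map_sup _ _ _).symm, ?_, by rw [hfr P hP, h3],
    by rw [hfr N hN, h4], ?_, ?_, ?_⟩
  · rw [Submodule.disjoint_def] at h2 ⊢
    rintro _ ⟨x, hx, rfl⟩ ⟨y, hy, hxy⟩
    have := hf (hN y hy) (hP x hx) hxy
    subst this
    rw [h2 y hx hy, map_zero]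
  · rintro _ ⟨x, hx, rfl⟩ h0
    rw [hk x (hP x hx) x (hP x hx), Complex.re_ofReal_mul]
    exact mul_pos hr (h5 x hx fun h => h0 (by rw [h, map_zero]))
  · rintro _ ⟨x, hx, rfl⟩ h0
    rw [hk x (hN x hx) x (hN x hx), Complex.re_ofReal_mul]
    exact mul_neg_of_pos_of_neg hr (h6 x hx fun h => h0 (by rw [h, map_zero]))
  · rintro _ ⟨x, hx, rfl⟩ _ ⟨y, hy, rfl⟩
    rw [hk x (hP x hx) y (hN y hy), h7 x hx y hy, mul_zero]

end Signature

/-! ### Signature of the induced form on the quotient by a line -/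

section ProjSignature

variable {V : Type*} [NormedAddCommGroup V] [NormedSpace ℂ V]
variable {h : V →ₗ[ℂ] V →ₛₗ[starRingEnd ℂ] ℂ}

theorem map_mkQ_orthIn {T : Submodule ℂ V} {u : V} (huT : u ∈ T) (hu : h u u ≠ 0) :
    (orthIn h T u).map (Submodule.span ℂ {u}).mkQ = T.map (Submodule.span ℂ {u}).mkQ := by
  conv_rhs => rw [← span_sup_orthIn huT hu, Submodule.map_sup]
  rw [Submodule.mkQ_map_self, bot_sup_eq]

theorem injOn_mkQ_orthIn {T : Submodule ℂ V} {u : V} (hu : h u u ≠ 0) :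
    Set.InjOn (Submodule.span ℂ {u}).mkQ (orthIn h T u) := by
  intro x hx y hy hxy
  have h1 : x - y ∈ Submodule.span ℂ {u} := (Submodule.Quotient.eq _).1 hxy
  obtain ⟨c, hc⟩ := Submodule.mem_span_singleton.1 h1
  have h2 : h (c • u) u = 0 := by rw [hc]; simp [hx.2, hy.2]
  have h3 : c = 0 := by simpa [hu] using h2
  rw [h3, zero_smul] at hc
  exact (sub_eq_zero.1 hc.symm)

/-- On the orthogonal complement of u the correction term vanishes, and this complement maps
isomorphically onto the quotient. Sylvester's law identifies its signature. -/
theorem HasSignature.projForm_of_pos [FiniteDimensional ℂ V] (hh : IsHermForm h)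
    {T : Submodule ℂ V} {a b : ℕ} (H : HasSignature h T a b) {u : V} (huT : u ∈ T)
    (hu : 0 < (h u u).re) : 1 ≤ a ∧
      HasSignature (projForm h u) (T.map (Submodule.span ℂ {u}).mkQ) (a - 1) b := by
  have hu0 : h u u ≠ 0 := fun h0 => by rw [h0] at hu; simp at hu
  obtain ⟨a', b', H'⟩ := exists_hasSignature hh _ (orthIn h T u) rfl
    (orthIn_nondegenerate (H.nondegenerate hh) huT hu0)
  have H2 := H'.add_pos hh hu fun y hy => hh.symm_zero hy.2
  rw [span_sup_orthIn huT hu0] at H2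
  obtain ⟨rfl, rfl⟩ := H.unique hh H2
  refine ⟨by omega, ?_⟩
  rw [← map_mkQ_orthIn huT hu0, Nat.add_sub_cancel]
  refine H'.map _ (injOn_mkQ_orthIn hu0) (r := (h u u).re⁻¹) (inv_pos.2 hu) fun x hx y hy => ?_
  rw [Submodule.mkQ_apply, Submodule.mkQ_apply, projForm_mk, hx.2, Complex.ofReal_inv,
    ← hh.apply_self, zero_mul, zero_div, sub_zero, div_eq_inv_mul]

/-- The quotient form is unchanged when h is replaced by -h, which exchanges the two indices. -/
theorem HasSignature.projForm_of_neg [FiniteDimensional ℂ V] (hh : IsHermForm h)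
    {T : Submodule ℂ V} {a b : ℕ} (H : HasSignature h T a b) {u : V} (huT : u ∈ T)
    (hu : (h u u).re < 0) : 1 ≤ b ∧
      HasSignature (projForm h u) (T.map (Submodule.span ℂ {u}).mkQ) (b - 1) a := by
  have e : projForm (-h) u = projForm h u := by
    refine LinearMap.ext fun x => LinearMap.ext fun y => ?_
    obtain ⟨x, rfl⟩ := Submodule.mkQ_surjective _ x
    obtain ⟨y, rfl⟩ := Submodule.mkQ_surjective _ y
    simp only [Submodule.mkQ_apply, projForm_mk, LinearMap.neg_apply, neg_div_neg_eq, neg_mul_neg,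
      neg_sq]
  rw [← e]
  exact (H.neg hh).projForm_of_pos hh.neg huT (by simpa using hu)

end ProjSignature

/-! ### Root spaces -/

section Roots

variable {L : Type*} [LieRing L] [LieAlgebra ℂ L]

/-- The simultaneous eigenspace of `ad A` with eigenvalue `α`. -/
def rootVec (A : LieSubalgebra ℂ L) (α : Module.Dual ℂ A) : Submodule ℂ L where
  carrier := {x | ∀ a : A, ⁅(a : L), x⁆ = α a • x}
  add_mem' := fun {x y} hx hy a => by rw [lie_add, hx a, hy a, smul_add]
  zero_mem' := fun a => by simp
  smul_mem' := fun c x hx a => by rw [lie_smul, hx a, smul_comm]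

theorem killingForm_lie (x y z : L) :
    killingForm ℂ L ⁅x, y⁆ z = - killingForm ℂ L y ⁅x, z⁆ := by
  rw [← lie_skew, map_neg, LinearMap.neg_apply, LieModule.traceForm_apply_lie_apply]

theorem killingForm_rootVec_eq_zero {A : LieSubalgebra ℂ L} {α β : Module.Dual ℂ A} {x y : L}
    (hx : x ∈ rootVec A α) (hy : y ∈ rootVec A β) (h : α + β ≠ 0) : killingForm ℂ L x y = 0 := by
  obtain ⟨a, ha⟩ : ∃ a, (α + β) a ≠ 0 := by
    by_contra! hc
    exact h (LinearMap.ext hc)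
  have := killingForm_lie (a : L) x y
  rw [hx a, hy a, map_smul, map_smul, LinearMap.smul_apply, smul_eq_mul, smul_eq_mul] at this
  have h2 : (α + β) a * killingForm ℂ L x y = 0 := by
    rw [LinearMap.add_apply]; linear_combination this
  exact (mul_eq_zero.1 h2).resolve_left ha

theorem killing_left_zero [LieAlgebra.IsKilling ℂ L] {x : L}
    (hx : ∀ y, killingForm ℂ L x y = 0) : x = 0 := by
  have : x ∈ LinearMap.ker (killingForm ℂ L) := LinearMap.ext hx
  simpa using this

variable [FiniteDimensional ℂ L] [LieAlgebra.IsKilling ℂ L]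
variable {A : LieSubalgebra ℂ L} [A.IsCartanSubalgebra]

open LieAlgebra LieAlgebra.IsKilling

/-- A Cartan subalgebra of a Killing algebra acts semisimply, so generalized weight spaces are
honest eigenspaces. -/
theorem rootSpace_eq_rootVec (α : Module.Dual ℂ A) :
    (rootSpace A α).toSubmodule = rootVec A α := by
  ext x
  constructor
  · intro hx a
    exact lie_eq_smul_of_mem_rootSpace hx a
  · intro hx
    refine (LieModule.mem_genWeightSpace L (α : A → ℂ) x).mpr fun a => ⟨1, ?_⟩
    have : ⁅a, x⁆ = α a • x := hx a
    simp [this]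

theorem exists_weight {α : Module.Dual ℂ A} {x : L} (hx : x ∈ rootVec A α) (h0 : x ≠ 0) :
    ∃ w : LieModule.Weight ℂ A L, LieModule.Weight.toLinear ℂ A L w = α := by
  refine ⟨⟨α, fun hb => h0 ?_⟩, ?_⟩
  · rw [← rootSpace_eq_rootVec] at hx
    rw [← LieSubmodule.toSubmodule_eq_bot] at hb
    have hx' : x ∈ (rootSpace A α).toSubmodule := hx
    erw [hb] at hx'
    simpa using hx'
  · ext a
    rfl

theorem toLinear_mem_rootsOf {w : LieModule.Weight ℂ A L} (hw : w.IsNonZero) :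
    LieModule.Weight.toLinear ℂ A L w ∈ rootsOf A ⊤ := by
  refine ⟨fun h => hw ?_, ?_⟩
  · exact LieModule.Weight.coe_toLinear_eq_zero_iff.1 h
  · obtain ⟨x, hx, h0⟩ := w.exists_ne_zero
    exact ⟨x, trivial, h0, fun a => lie_eq_smul_of_mem_rootSpace hx a⟩

theorem exists_weight_of_mem_rootsOf {α : Module.Dual ℂ A} (hα : α ∈ rootsOf A ⊤) :
    ∃ w : LieModule.Weight ℂ A L, w.IsNonZero ∧ LieModule.Weight.toLinear ℂ A L w = α := by
  obtain ⟨h0, x, -, hx0, hx⟩ := hα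
  obtain ⟨w, rfl⟩ := exists_weight (A := A) hx hx0
  exact ⟨w, fun h => h0 (LieModule.Weight.coe_toLinear_eq_zero_iff.2 h), rfl⟩

theorem finite_rootsOf : (rootsOf A ⊤).Finite := by
  refine (Set.finite_range (fun w : LieModule.Weight ℂ A L =>
    LieModule.Weight.toLinear ℂ A L w)).subset fun α hα => ?_
  obtain ⟨w, -, hw⟩ := exists_weight_of_mem_rootsOf hα
  exact ⟨w, hw⟩

theorem neg_mem_rootsOf {α : Module.Dual ℂ A} (hα : α ∈ rootsOf A ⊤) : -α ∈ rootsOf A ⊤ := by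
  obtain ⟨w, hw, rfl⟩ := exists_weight_of_mem_rootsOf hα
  rw [← LieModule.Weight.toLinear_neg]
  exact toLinear_mem_rootsOf hw.neg

theorem rootVec_zero : rootVec A 0 = A.toSubmodule := by
  rw [← rootSpace_eq_rootVec]
  have : rootSpace A (0 : A → ℂ) = A.toLieSubmodule := rootSpace_zero_eq ℂ L A
  ext x
  have h2 : x ∈ rootSpace A (0 : A → ℂ) ↔ x ∈ A.toLieSubmodule := by rw [this]
  exact h2

theorem sup_rootVec_eq_top {U : Submodule ℂ L} (hA : A.toSubmodule ≤ U)
    (hU : ∀ α ∈ rootsOf A ⊤, rootVec A α ≤ U) : U = ⊤ := by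
  rw [eq_top_iff, ← LieSubmodule.iSup_toSubmodule_eq_top.mpr
    (LieModule.iSup_genWeightSpace_eq_top' ℂ A L)]
  refine iSup_le fun w => ?_
  by_cases hw : w.IsZero
  · have := rootSpace_eq_rootVec (LieModule.Weight.toLinear ℂ A L w)
    rw [LieModule.Weight.coe_toLinear_eq_zero_iff.2 hw, rootVec_zero] at this
    refine le_trans (le_of_eq ?_) hA
    have h0 : (w : A → ℂ) = ⇑(0 : Module.Dual ℂ A) := hw
    rw [← this]
    change (LieModule.genWeightSpace L (w : A → ℂ)).toSubmodule = _
    rw [h0]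
  · have := rootSpace_eq_rootVec (LieModule.Weight.toLinear ℂ A L w)
    exact le_trans (le_of_eq this) (hU _ (toLinear_mem_rootsOf hw))

variable (A) in
/-- The element of the Cartan subalgebra representing a functional through the Killing form. -/
noncomputable def cartanDual (α : Module.Dual ℂ A) : A := (cartanEquivDual A).symm α

theorem killingForm_cartanDual (α : Module.Dual ℂ A) (a : A) :
    killingForm ℂ L (cartanDual A α : L) (a : L) = α a :=
  LinearMap.BilinForm.apply_toDual_symm_apply (hB := traceForm_cartan_nondegenerate ℂ L A) _ _

theorem eq_zero_of_killingForm_cartan {a : A} (h : ∀ b : A, killingForm ℂ L (a : L) b = 0) :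
    a = 0 := by
  have : cartanEquivDual A a = 0 := LinearMap.ext h
  simpa using this

theorem lie_rootVec_neg {α : Module.Dual ℂ A} {x y : L} (hx : x ∈ rootVec A α)
    (hy : y ∈ rootVec A (-α)) : ⁅x, y⁆ = killingForm ℂ L x y • (cartanDual A α : L) := by
  by_cases h0 : x = 0
  · simp [h0]
  obtain ⟨w, rfl⟩ := exists_weight hx h0
  rw [← rootSpace_eq_rootVec] at hx hy
  exact lie_eq_killingForm_smul_of_mem_rootSpace_of_mem_rootSpace_neg hx hy

theorem exists_smul_of_mem_rootVec {α : Module.Dual ℂ A} (h0 : α ≠ 0) {x y : L}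
    (hx : x ∈ rootVec A α) (hx0 : x ≠ 0) (hy : y ∈ rootVec A α) : ∃ c : ℂ, y = c • x := by
  obtain ⟨w, rfl⟩ := exists_weight hx hx0
  have hw : w.IsNonZero := fun h => h0 (LieModule.Weight.coe_toLinear_eq_zero_iff.2 h)
  rw [← rootSpace_eq_rootVec] at hx hy
  obtain ⟨c, hc⟩ := (finrank_eq_one_iff_of_nonzero' (⟨x, hx⟩ : rootSpace A w)
    (fun h => hx0 (congrArg Subtype.val h))).mp (finrank_rootSpace_eq_one w hw) ⟨y, hy⟩
  exact ⟨c, by simpa using congrArg Subtype.val hc.symm⟩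

/-- The trace is a sum over weights χ of dimension times χ(coroot)², and each χ(coroot) is an
integer. -/
theorem killingForm_coroot_self_nonneg (w : LieModule.Weight ℂ A L) :
    ∃ s : ℝ, 0 ≤ s ∧ killingForm ℂ L (coroot w : L) (coroot w : L) = s := by
  refine ⟨∑ χ : LieModule.Weight ℂ A L, (Module.finrank ℂ (LieModule.genWeightSpace L χ) : ℝ) *
    ((χ (coroot w)).re * (χ (coroot w)).re),
    Finset.sum_nonneg fun χ _ => mul_nonneg (Nat.cast_nonneg _) (mul_self_nonneg _), ?_⟩
  have h1 : killingForm ℂ L (coroot w : L) (coroot w : L) =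
    LieModule.traceForm ℂ A L (coroot w) (coroot w) := rfl
  rw [h1, LieModule.traceForm_eq_sum_finrank_nsmul_mul, Complex.ofReal_sum]
  refine Finset.sum_congr rfl fun χ _ => ?_
  have h2 := apply_coroot_eq_cast w χ
  have h3 : χ (coroot w) = (((χ (coroot w)).re : ℝ) : ℂ) := by
    rw [h2]
    simp
  rw [nsmul_eq_mul, Complex.ofReal_mul, Complex.ofReal_mul, ← h3]
  simp

/-- The coroot h equals K(e,f) times the Killing dual of α, and pairing with h gives K(h,h) =
2K(e,f). So the factor s is positive, which later turns integrality into a sign. -/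
theorem IsKilling.exists_sl2 {α : Module.Dual ℂ A} (hα : α ∈ rootsOf A ⊤) :
    ∃ (e f : L) (s : ℝ), e ∈ rootVec A α ∧ f ∈ rootVec A (-α) ∧ e ≠ 0 ∧ f ≠ 0 ∧ 0 < s ∧
      IsSl2Triple ((s : ℂ) • (cartanDual A α : L)) e f := by
  obtain ⟨w, hw, rfl⟩ := exists_weight_of_mem_rootsOf hα
  obtain ⟨h, e, f, ht, he, hf⟩ := exists_isSl2Triple_of_weight_isNonZero hw
  have hh := ht.h_eq_coroot hw he hf
  have h1 := lie_eq_killingForm_smul_of_mem_rootSpace_of_mem_rootSpace_neg he hf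
  obtain ⟨s, hs, hs'⟩ := killingForm_coroot_self_nonneg w
  rw [ht.lie_e_f] at h1
  have h3 : killingForm ℂ L (coroot w : L) (coroot w : L) = 2 * killingForm ℂ L e f := by
    nth_rewrite 1 [← hh]
    rw [h1, map_smul, LinearMap.smul_apply, smul_eq_mul]
    have h4 := killingForm_cartanDual (LieModule.Weight.toLinear ℂ A L w) (coroot w)
    rw [LieModule.Weight.toLinear_apply, root_apply_coroot hw] at h4
    erw [h4]
    ring
  have h5 : killingForm ℂ L e f = ((s / 2 : ℝ) : ℂ) := by
    rw [hs'] at h3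
    push_cast
    linear_combination -h3 / 2
  have h6 : h = ((s / 2 : ℝ) : ℂ) • (cartanDual A (LieModule.Weight.toLinear ℂ A L w) : L) := by
    rw [← h5]; exact h1
  have h7 : s ≠ 0 := by
    rintro rfl
    apply ht.h_ne_zero
    rw [h6]; simp
  refine ⟨e, f, s / 2, rootSpace_eq_rootVec (LieModule.Weight.toLinear ℂ A L w) ▸ he, ?_,
    ht.e_ne_zero, ht.f_ne_zero, half_pos (lt_of_le_of_ne hs h7.symm), h6 ▸ ht⟩
  rw [← rootSpace_eq_rootVec]
  exact hf

end Roots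

/-! ### Consequences of sl₂ theory for representations -/

section Reps

variable {L : Type*} [LieRing L] [LieAlgebra ℂ L]
variable {V : Type*} [NormedAddCommGroup V] [NormedSpace ℂ V]

theorem rep_lie (f : L →ₗ⁅ℂ⁆ (V →L[ℂ] V)) (x y : L) (w : V) :
    f ⁅x, y⁆ w = f x (f y w) - f y (f x w) := by
  rw [LieHom.map_lie, Ring.lie_def]; rfl

/-- `V` as a Lie module, for a representation `f` on `V`. -/
@[reducible] def repLieRingModule (f : L →ₗ⁅ℂ⁆ (V →L[ℂ] V)) : LieRingModule L V where
  bracket := fun x w => f x w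
  add_lie := fun x y w => by rw [map_add]; rfl
  lie_add := fun x w w' => map_add (f x) w w'
  leibniz_lie := fun x y w => by
    change f x (f y w) = f ⁅x, y⁆ w + f y (f x w)
    rw [rep_lie]; abel

variable [FiniteDimensional ℂ L] [LieAlgebra.IsKilling ℂ L] [FiniteDimensional ℂ V]

/-- The vector v is primitive for the sl₂ of α, so its weight n is a natural number, and n = 0
forces the lowering operator to kill v. Only the single root α has to annihilate v, which is what
`gamma_apply_self` needs. -/
theorem weight_cartanDual_nonneg {A : LieSubalgebra ℂ L} [A.IsCartanSubalgebra]
    (f : L →ₗ⁅ℂ⁆ (V →L[ℂ] V)) {α Λ : Module.Dual ℂ A} (hα : α ∈ rootsOf A ⊤) {v : V}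
    (hv : v ≠ 0) (hΛ : ∀ a : A, f a v = Λ a • v) (he : ∀ e ∈ rootVec A α, f e v = 0) :
    ∃ r : ℝ, 0 ≤ r ∧ Λ (cartanDual A α) = r ∧ (r = 0 → ∀ y ∈ rootVec A (-α), f y v = 0) := by
  let := repLieRingModule f
  let : LieModule ℂ L V :=
    { smul_lie := fun c x w => by change f (c • x) w = _; rw [map_smul]; rfl
      lie_smul := fun c x w => map_smul (f x) c w }
  obtain ⟨e, y, s, he', hy, he0, hy0, hs, ht⟩ := IsKilling.exists_sl2 hα
  have P : ht.HasPrimitiveVectorWith v ((s : ℂ) * Λ (cartanDual A α)) :=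
    { ne_zero := hv
      lie_h := by
        change f ((s : ℂ) • (cartanDual A α : L)) v = _
        rw [map_smul, smul_apply, hΛ, smul_smul]
      lie_e := he e he' }
  obtain ⟨n, hn⟩ := P.exists_nat
  have hs' : (s : ℂ) ≠ 0 := by exact_mod_cast hs.ne'
  refine ⟨n / s, div_nonneg (Nat.cast_nonneg _) hs.le, ?_, fun h0 z hz => ?_⟩
  · push_cast
    rw [eq_div_iff hs', mul_comm, hn]
  · have hn0 : n = 0 := by
      rcases div_eq_zero_iff.1 h0 with h | h
      · exact_mod_cast h
      · exact absurd h hs.ne'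
    subst hn0
    have h1 := P.pow_toEnd_f_eq_zero_of_eq_nat hn
    have h2 : f y v = 0 := by rw [zero_add, pow_one] at h1; exact h1
    obtain ⟨c, rfl⟩ := exists_smul_of_mem_rootVec (neg_ne_zero.2 hα.1) hy hy0 hz
    rw [map_smul, smul_apply, h2, smul_zero]

end Reps

/-! ### Highest weight vectors and the quadrics through their orbits -/

section HighestWeight

variable {L : Type*} [LieRing L] [LieAlgebra ℂ L]
variable {V : Type*} [NormedAddCommGroup V] [NormedSpace ℂ V]
variable (f : L →ₗ⁅ℂ⁆ (V →L[ℂ] V))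

/-- The subspace `L v` of `V`. -/
def orbitTangent (v : V) : Submodule ℂ V where
  carrier := {w | ∃ x, f x v = w}
  add_mem' := by
    rintro _ _ ⟨x, rfl⟩ ⟨y, rfl⟩
    exact ⟨x + y, by rw [map_add]; rfl⟩
  zero_mem' := ⟨0, by rw [map_zero]; rfl⟩
  smul_mem' := by
    rintro c _ ⟨x, rfl⟩
    exact ⟨c • x, by rw [map_smul]; rfl⟩

theorem mem_orbitTangent_self (x : L) (v : V) : f x v ∈ orbitTangent f v := ⟨x, rfl⟩

/-- The elements of `L` that map the subspace `D` into the subspace `D'`. -/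
def transporter (D D' : Submodule ℂ V) : Submodule ℂ L where
  carrier := {x | ∀ w ∈ D, f x w ∈ D'}
  add_mem' := fun {x y} hx hy w hw => by
    rw [map_add]; exact D'.add_mem (hx w hw) (hy w hw)
  zero_mem' := fun w _ => by rw [map_zero]; exact D'.zero_mem
  smul_mem' := fun c x hx w hw => by rw [map_smul]; exact D'.smul_mem c (hx w hw)

/-- The `L`-module `V` is irreducible. -/
def IsIrredRep : Prop :=
  ∀ U : Submodule ℂ V, (∀ x, ∀ u ∈ U, f x u ∈ U) → U = ⊥ ∨ U = ⊤

variable {f}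

/-- A substitute for the Poincaré–Birkhoff–Witt argument: since P preserves the line, V is generated
from v by operators in N alone. -/
theorem IsIrredRep.eq_top_of_stable (hf : IsIrredRep f) {v : V} (hv : v ≠ 0) {P N : Submodule ℂ L}
    (hPN : P ⊔ N = ⊤) (hP : ∀ x ∈ P, f x v ∈ Submodule.span ℂ {v}) {D : Submodule ℂ V}
    (hD : v ∈ D) (hN : N ≤ transporter f D D) : D = ⊤ := by
  let W : Submodule ℂ V := sInf {U | v ∈ U ∧ N ≤ transporter f U U}
  have hvW : v ∈ W := Submodule.mem_sInf.2 fun U hU => hU.1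
  have hNW : ∀ x ∈ N, ∀ w ∈ W, f x w ∈ W := fun x hx w hw =>
    Submodule.mem_sInf.2 fun U hU => hU.2 hx w (Submodule.mem_sInf.1 hw U hU)
  have hWle : ∀ U : Submodule ℂ V, v ∈ U → N ≤ transporter f U U → W ≤ U :=
    fun U h1 h2 => sInf_le ⟨h1, h2⟩
  -- The part of W that P maps back into W. It is N-stable because xy = yx + [x,y] and the bracket
  -- splits along P + N; N need not be a subalgebra.
  let W' : Submodule ℂ V :=
    { carrier := {w | w ∈ W ∧ ∀ x ∈ P, f x w ∈ W}
      add_mem' := fun {a b} ha hb => ⟨W.add_mem ha.1 hb.1, fun x hx => by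
        rw [map_add]; exact W.add_mem (ha.2 x hx) (hb.2 x hx)⟩
      zero_mem' := ⟨W.zero_mem, fun x _ => by rw [map_zero]; exact W.zero_mem⟩
      smul_mem' := fun c a ha => ⟨W.smul_mem c ha.1, fun x hx => by
        rw [map_smul]; exact W.smul_mem c (ha.2 x hx)⟩ }
  have hWW' : W ≤ W' := by
    refine hWle W' ⟨hvW, fun x hx => ?_⟩ fun y hy w hw => ⟨hNW y hy w hw.1, fun x hx => ?_⟩
    · exact (Submodule.span_singleton_le_iff_mem _ _).2 hvW (hP x hx)
    · have h1 : f x (f y w) = f y (f x w) + f ⁅x, y⁆ w := by rw [rep_lie]; abel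
      rw [h1]
      refine W.add_mem (hNW y hy _ (hw.2 x hx)) ?_
      obtain ⟨p, hp, n, hn, h2⟩ := Submodule.mem_sup.1 (hPN ▸ Submodule.mem_top : ⁅x, y⁆ ∈ P ⊔ N)
      rw [← h2, map_add]
      exact W.add_mem (hw.2 p hp) (hNW n hn w hw.1)
  have hW : W = ⊤ := by
    refine (hf W fun x u hu => ?_).resolve_left fun hb => hv ?_
    · obtain ⟨p, hp, n, hn, h2⟩ := Submodule.mem_sup.1 (hPN ▸ Submodule.mem_top : x ∈ P ⊔ N)
      rw [← h2, map_add]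
      exact W.add_mem ((hWW' hu).2 p hp) (hNW n hn u hu)
    · rw [hb] at hvW
      simpa using hvW
  exact top_le_iff.1 (hW ▸ hWle D hD hN)

variable (f) in
/-- The quadratic equations satisfied by the highest weight vectors: `x u = c l(u) u` whenever
`x` represents the functional `y ↦ l (y u)` through the Killing form. -/
def OnQuadrics (c : ℂ) (u : V) : Prop :=
  ∀ (l : V →ₗ[ℂ] ℂ) (x : L), (∀ y, killingForm ℂ L x y = l (f y u)) → f x u = (c * l u) • u

theorem OnQuadrics.map {c : ℂ} {u : V} (h : OnQuadrics f c u) {g : V →L[ℂ] V} {Φ : L ≃ₗ⁅ℂ⁆ L}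
    (hΦ : ∀ y w, g (f y w) = f (Φ y) (g w)) : OnQuadrics f c (g u) := by
  intro l x hx
  have h1 := h (l ∘ₗ (g : V →ₗ[ℂ] V)) (Φ.symm x) fun y => by
    rw [← LieAlgebra.killingForm_of_equiv_apply (R := ℂ) Φ, LieEquiv.apply_symm_apply, hx]
    simp [hΦ]
  have h2 := hΦ (Φ.symm x) u
  rw [LieEquiv.apply_symm_apply] at h2
  rw [← h2, h1, map_smul]
  rfl

variable [FiniteDimensional ℂ L] [LieAlgebra.IsKilling ℂ L]
variable {A : LieSubalgebra ℂ L} [A.IsCartanSubalgebra] {S : Set (Module.Dual ℂ A)}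
  {Λ : Module.Dual ℂ A} {v : V}

theorem IsPositiveSystem.iSup_eq_top (hS : IsPositiveSystem (rootsOf A ⊤) S) :
    (A.toSubmodule ⊔ ⨆ α ∈ S, rootVec A α) ⊔ ⨆ α ∈ S, rootVec A (-α) = ⊤ := by
  refine sup_rootVec_eq_top (A := A) (le_sup_of_le_left le_sup_left) fun α hα => ?_
  rcases hS.mem_or_neg_mem α hα with h | h
  · exact le_sup_of_le_left (le_sup_of_le_right (le_iSup₂_of_le α h le_rfl))
  · refine le_sup_of_le_right (le_iSup₂_of_le (-α) h ?_)
    rw [neg_neg]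

theorem cartan_mem_rootVec_zero (a : A) : (a : L) ∈ rootVec A 0 := by
  rw [rootVec_zero]; exact a.2

omit [FiniteDimensional ℂ L] [LieAlgebra.IsKilling ℂ L] [A.IsCartanSubalgebra] in
theorem iSup_rootVec_apply_eq_zero (hS0 : ∀ α ∈ S, ∀ x ∈ rootVec A α, f x v = 0) :
    ∀ y ∈ ⨆ α ∈ S, rootVec A α, f y v = 0 := by
  have : (⨆ α ∈ S, rootVec A α) ≤ transporter f (Submodule.span ℂ {v}) ⊥ := by
    refine iSup₂_le fun α hα y hy u hu => ?_
    obtain ⟨c, rfl⟩ := Submodule.mem_span_singleton.1 hu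
    rw [map_smul, hS0 α hα y hy, smul_zero]
    exact Submodule.zero_mem _
  exact fun y hy => by simpa using this hy v (Submodule.mem_span_singleton_self v)

theorem killingForm_cartan_iSup_rootVec (hS : IsPositiveSystem (rootsOf A ⊤) S) (a : A) :
    ∀ y ∈ ⨆ α ∈ S, rootVec A α, killingForm ℂ L a y = 0 := by
  have : (⨆ α ∈ S, rootVec A α) ≤ LinearMap.ker (killingForm ℂ L a) :=
    iSup₂_le fun β hβ y hy => killingForm_rootVec_eq_zero (cartan_mem_rootVec_zero a) hy (by
      rw [zero_add]; exact (hS.subset hβ).1)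
  exact fun y hy => this hy

/-- The Killing-orthogonal of a Borel subalgebra is the sum of its positive root spaces: the Cartan
and negative components are detected by pairing with the Cartan and the positive root spaces. -/
theorem IsPositiveSystem.apply_eq_zero_of_orthogonal (hS : IsPositiveSystem (rootsOf A ⊤) S)
    (hS0 : ∀ α ∈ S, ∀ x ∈ rootVec A α, f x v = 0) {x : L}
    (hx : ∀ y ∈ A.toSubmodule ⊔ ⨆ α ∈ S, rootVec A α, killingForm ℂ L x y = 0) :
    f x v = 0 := by
  have hxt : x ∈ (A.toSubmodule ⊔ ⨆ α ∈ S, rootVec A α) ⊔ ⨆ α ∈ S, rootVec A (-α) := by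
    rw [hS.iSup_eq_top]; trivial
  obtain ⟨z, hz, w', hw', rfl⟩ := Submodule.mem_sup.1 hxt
  obtain ⟨a, ha, w, hw, rfl⟩ := Submodule.mem_sup.1 hz
  have hbil : ∀ (s t : Set (Module.Dual ℂ A)), (∀ α ∈ s, ∀ β ∈ t, α + β ≠ 0) →
      ∀ x ∈ ⨆ α ∈ s, rootVec A α, ∀ y ∈ ⨆ α ∈ t, rootVec A α, killingForm ℂ L x y = 0 := by
    intro s t hst x hx y hy
    have h1 : (⨆ α ∈ s, rootVec A α) ≤ LinearMap.ker ((killingForm ℂ L).flip y) := by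
      refine iSup₂_le fun α hα x hx => ?_
      have h2 : (⨆ α ∈ t, rootVec A α) ≤ LinearMap.ker (killingForm ℂ L x) :=
        iSup₂_le fun β hβ y hy => killingForm_rootVec_eq_zero hx hy (hst α hα β hβ)
      exact h2 hy
    exact h1 hx
  have hpos0 : ∀ α ∈ S, α ≠ 0 := fun α hα => (hS.subset hα).1
  have hneg : (⨆ α ∈ S, rootVec A (-α)) = ⨆ α ∈ (-S), rootVec A α := by
    rw [← Set.image_neg_eq_neg, iSup_image]
  rw [hneg] at hw'
  have hA0 : ∀ b : A, (b : L) ∈ ⨆ α ∈ ({0} : Set (Module.Dual ℂ A)), rootVec A α := fun b => by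
    simpa using cartan_mem_rootVec_zero b
  have hpp := hbil S S fun α hα β hβ h => hS.neg_notMem α hα (by
    rwa [← eq_neg_of_add_eq_zero_right h])
  have hnn := hbil (-S) (-S) fun α hα β hβ h => hS.neg_notMem _ hα (by
    rw [neg_neg, eq_neg_of_add_eq_zero_left h]; exact hβ)
  have hp0 := hbil S {0} fun α hα β hβ h => hpos0 α hα (by
    rw [Set.mem_singleton_iff.1 hβ, add_zero] at h; exact h)
  have hn0 := hbil (-S) {0} fun α hα β hβ h => hpos0 _ hα (by
    rw [Set.mem_singleton_iff.1 hβ, add_zero] at h; rw [h, neg_zero])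
  have h0p := hbil {0} S fun α hα β hβ h => hpos0 β hβ (by
    rw [Set.mem_singleton_iff.1 hα, zero_add] at h; exact h)
  have hwv := iSup_rootVec_apply_eq_zero hS0
  have ha0 : a = 0 := by
    have h2 : (⟨a, ha⟩ : A) = 0 := eq_zero_of_killingForm_cartan fun b => by
      have h3 := hx b (Submodule.mem_sup_left b.2)
      rw [map_add, map_add, LinearMap.add_apply, LinearMap.add_apply, hp0 w hw b (hA0 b),
        hn0 w' hw' b (hA0 b), add_zero, add_zero] at h3
      exact h3
    exact congrArg Subtype.val h2
  subst ha0
  have hw'0 : w' = 0 := by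
    refine killing_left_zero fun y => ?_
    have hyt : y ∈ (A.toSubmodule ⊔ ⨆ α ∈ S, rootVec A α) ⊔ ⨆ α ∈ S, rootVec A (-α) := by
      rw [hS.iSup_eq_top]; trivial
    obtain ⟨z, hz, y', hy', rfl⟩ := Submodule.mem_sup.1 hyt
    obtain ⟨b, hb, y, hy, rfl⟩ := Submodule.mem_sup.1 hz
    rw [hneg] at hy'
    have h3 := hx y (Submodule.mem_sup_right hy)
    rw [zero_add, map_add, LinearMap.add_apply, hpp w hw y hy, zero_add] at h3
    rw [map_add, map_add, hn0 w' hw' b (hA0 ⟨b, hb⟩), h3, hnn w' hw' y' hy', add_zero, add_zero]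
  rw [hw'0, add_zero, zero_add, hwv w hw]

/-- The difference of x and l(v) times the Killing dual of Λ is orthogonal to the Borel subalgebra,
hence kills v. The constant is (Λ,Λ). -/
theorem IsPositiveSystem.onQuadrics (hS : IsPositiveSystem (rootsOf A ⊤) S)
    (hΛ : ∀ a : A, f a v = Λ a • v) (hS0 : ∀ α ∈ S, ∀ x ∈ rootVec A α, f x v = 0) :
    OnQuadrics f (Λ (cartanDual A Λ)) v := by
  intro l x hx
  have h1 : f (x - l v • (cartanDual A Λ : L)) v = 0 := by
    refine hS.apply_eq_zero_of_orthogonal hS0 fun y hy => ?_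
    obtain ⟨a, ha, w, hw, rfl⟩ := Submodule.mem_sup.1 hy
    have h2 : f (a + w) v = Λ ⟨a, ha⟩ • v := by
      rw [map_add, ← hΛ ⟨a, ha⟩]
      change f a v + f w v = f a v
      rw [iSup_rootVec_apply_eq_zero hS0 w hw, add_zero]
    rw [map_sub, LinearMap.sub_apply, hx, h2, map_smul, map_smul, LinearMap.smul_apply, map_add,
      killingForm_cartan_iSup_rootVec hS _ w hw, killingForm_cartanDual Λ ⟨a, ha⟩,
      add_zero, smul_eq_mul, smul_eq_mul, mul_comm, sub_self]
  rw [map_sub, map_smul] at h1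
  have h2 : f x v - l v • f (cartanDual A Λ : L) v = 0 := h1
  rw [hΛ, sub_eq_zero] at h2
  rw [h2, smul_smul, mul_comm]

variable (f A Λ) in
/-- The sum of the eigenspaces of the element representing `Λ` whose eigenvalue is smaller than the
one of the highest weight vectors. -/
noncomputable def lowerPart : Submodule ℂ V :=
  ⨆ s : {s : ℝ // 0 < s}, Module.End.eigenspace (f (cartanDual A Λ) : V →ₗ[ℂ] V)
    (Λ (cartanDual A Λ) - (s : ℝ))

theorem disjoint_eigenspace_lowerPart :
    Disjoint (Module.End.eigenspace (f (cartanDual A Λ) : V →ₗ[ℂ] V) (Λ (cartanDual A Λ)))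
      (lowerPart f A Λ) := by
  refine (Module.End.eigenspaces_iSupIndep (f (cartanDual A Λ) : V →ₗ[ℂ] V)
    (Λ (cartanDual A Λ))).mono_right ?_
  refine iSup_le fun s => le_iSup₂_of_le (Λ (cartanDual A Λ) - (s : ℝ)) (fun h => ?_) le_rfl
  have : (s : ℝ) = 0 := by
    have h1 : ((s : ℝ) : ℂ) = 0 := by linear_combination -h
    exact_mod_cast h1
  exact s.2.ne' this

theorem cartanDual_apply_comm (α : Module.Dual ℂ A) :
    α (cartanDual A Λ) = Λ (cartanDual A α) := by
  rw [← killingForm_cartanDual, ← killingForm_cartanDual, LieModule.traceForm_comm]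

variable (f) in
/-- The element `x` of `L` that represents the functional `y ↦ l (y u)`, as a function of `u`. -/
theorem exists_moment (l : V →ₗ[ℂ] ℂ) :
    ∃ X : V →ₗ[ℂ] L, ∀ u y, killingForm ℂ L (X u) y = l (f y u) := by
  let b : V →ₗ[ℂ] Module.Dual ℂ L := LinearMap.mk₂ ℂ (fun u y => l (f y u))
    (fun u u' y => by simp) (fun c u y => by simp) (fun u y y' => by simp) (fun c u y => by simp)
  let e := (killingForm ℂ L).toDual (LieAlgebra.IsKilling.killingForm_nondegenerate ℂ L)
  exact ⟨e.symm.toLinearMap ∘ₗ b, fun u y =>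
    LinearMap.BilinForm.apply_toDual_symm_apply
      (hB := LieAlgebra.IsKilling.killingForm_nondegenerate ℂ L) _ _⟩

variable [FiniteDimensional ℂ V]

/-- A root vector for -α lowers the eigenvalue by (Λ,α) ≥ 0. Starting from v the drop is strict
unless the result is zero, by `weight_cartanDual_nonneg`. -/
theorem IsPositiveSystem.apply_neg_mem_lowerPart (hS : IsPositiveSystem (rootsOf A ⊤) S)
    (hΛ : ∀ a : A, f a v = Λ a • v) (hS0 : ∀ α ∈ S, ∀ x ∈ rootVec A α, f x v = 0) (hv : v ≠ 0) :
    ∀ y ∈ ⨆ α ∈ S, rootVec A (-α), f y v ∈ lowerPart f A Λ ∧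
      ∀ w ∈ lowerPart f A Λ, f y w ∈ lowerPart f A Λ := by
  have h1 : (⨆ α ∈ S, rootVec A (-α)) ≤
      transporter f (Submodule.span ℂ {v}) (lowerPart f A Λ) ⊓
        transporter f (lowerPart f A Λ) (lowerPart f A Λ) := by
    refine iSup₂_le fun α hα y hy => ?_
    obtain ⟨r, hr, hr', hr0⟩ := weight_cartanDual_nonneg f (hS.subset hα) hv hΛ (hS0 α hα)
    have hcomm : ∀ w, f (cartanDual A Λ) (f y w) = f y (f (cartanDual A Λ) w) - (r : ℂ) • f y w := by
      intro w
      have h2 := rep_lie f (cartanDual A Λ : L) y w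
      rw [hy, LinearMap.neg_apply, cartanDual_apply_comm, hr', map_smul, smul_apply] at h2
      rw [neg_smul] at h2
      rw [sub_eq_add_neg, h2]
      abel
    refine ⟨fun w hw => ?_, fun w hw => ?_⟩
    · obtain ⟨c, rfl⟩ := Submodule.mem_span_singleton.1 hw
      rw [map_smul]
      refine Submodule.smul_mem _ _ ?_
      by_cases h0 : r = 0
      · rw [hr0 h0 y hy]; exact Submodule.zero_mem _
      · refine Submodule.mem_iSup_of_mem ⟨r, lt_of_le_of_ne hr (Ne.symm h0)⟩ ?_
        rw [Module.End.mem_eigenspace_iff]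
        change f (cartanDual A Λ) (f y v) = _
        rw [hcomm, hΛ, map_smul, sub_smul]
    · have h3 : lowerPart f A Λ ≤ (lowerPart f A Λ).comap (f y : V →ₗ[ℂ] V) := by
        refine iSup_le fun s w hw => ?_
        refine Submodule.mem_iSup_of_mem ⟨r + s, add_pos_of_nonneg_of_pos hr s.2⟩ ?_
        rw [Module.End.mem_eigenspace_iff] at hw ⊢
        change f (cartanDual A Λ) w = _ at hw
        change f (cartanDual A Λ) (f y w) = _ • f y w
        rw [hcomm, hw, map_smul, ← sub_smul]
        congr 1
        push_cast
        ring
      exact h3 hw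
  exact fun y hy => ⟨(h1 hy).1 v (Submodule.mem_span_singleton_self v), (h1 hy).2⟩

theorem IsPositiveSystem.span_sup_lowerPart (hf : IsIrredRep f)
    (hS : IsPositiveSystem (rootsOf A ⊤) S)
    (hΛ : ∀ a : A, f a v = Λ a • v) (hS0 : ∀ α ∈ S, ∀ x ∈ rootVec A α, f x v = 0) (hv : v ≠ 0) :
    Submodule.span ℂ {v} ⊔ lowerPart f A Λ = ⊤ := by
  refine hf.eq_top_of_stable hv hS.iSup_eq_top (fun x hx => ?_)
    (Submodule.mem_sup_left (Submodule.mem_span_singleton_self v)) fun y hy w hw => ?_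
  · obtain ⟨a, ha, w, hw, rfl⟩ := Submodule.mem_sup.1 hx
    rw [map_add]
    change f a v + f w v ∈ _
    rw [iSup_rootVec_apply_eq_zero hS0 w hw, add_zero]
    have := hΛ ⟨a, ha⟩
    change f a v = _ at this
    rw [this]
    exact Submodule.smul_mem _ _ (Submodule.mem_span_singleton_self v)
  · obtain ⟨u, hu, m, hm, rfl⟩ := Submodule.mem_sup.1 hw
    obtain ⟨c, rfl⟩ := Submodule.mem_span_singleton.1 hu
    obtain ⟨h1, h2⟩ := hS.apply_neg_mem_lowerPart hΛ hS0 hv y hy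
    rw [map_add, map_smul]
    exact Submodule.mem_sup_right (Submodule.add_mem _ (Submodule.smul_mem _ _ h1) (h2 m hm))

/-- If Λ = 0, all root spaces kill v and ℂv is invariant, so V would be a line. Otherwise a Cartan
element scales v by a nonzero number. -/
theorem IsPositiveSystem.self_mem_orbitTangent (hf : IsIrredRep f)
    (hS : IsPositiveSystem (rootsOf A ⊤) S)
    (hΛ : ∀ a : A, f a v = Λ a • v) (hS0 : ∀ α ∈ S, ∀ x ∈ rootVec A α, f x v = 0) (hv : v ≠ 0)
    (hdim : Module.finrank ℂ V ≠ 1) : v ∈ orbitTangent f v := by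
  by_cases h0 : Λ = 0
  · exfalso
    have hall : ∀ x, f x v = 0 := by
      have : transporter f (Submodule.span ℂ {v}) ⊥ = ⊤ := by
        refine sup_rootVec_eq_top (A := A) (fun a ha u hu => ?_) fun α hα y hy u hu => ?_
        · obtain ⟨c, rfl⟩ := Submodule.mem_span_singleton.1 hu
          have := hΛ ⟨a, ha⟩
          change f a v = _ at this
          rw [map_smul, this, h0]
          simp
        · obtain ⟨c, rfl⟩ := Submodule.mem_span_singleton.1 hu
          rw [map_smul]
          rcases hS.mem_or_neg_mem α hα with h | h
          · rw [hS0 α h y hy, smul_zero]; exact Submodule.zero_mem _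
          · obtain ⟨r, hr, hr', hr0⟩ := weight_cartanDual_nonneg f (hS.subset h) hv hΛ (hS0 _ h)
            rw [hr0 (by rw [h0] at hr'; simpa using hr'.symm) y (by rwa [neg_neg]), smul_zero]
            exact Submodule.zero_mem _
      intro x
      have hx : x ∈ transporter f (Submodule.span ℂ {v}) ⊥ := by rw [this]; trivial
      simpa using hx v (Submodule.mem_span_singleton_self v)
    have h1 := hf (Submodule.span ℂ {v}) fun x u hu => by
      obtain ⟨c, rfl⟩ := Submodule.mem_span_singleton.1 hu
      rw [map_smul, hall, smul_zero]
      exact Submodule.zero_mem _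
    rcases h1 with h1 | h1
    · exact hv (by simpa using h1)
    · apply hdim
      rw [← finrank_top, ← h1, finrank_span_singleton hv]
  · obtain ⟨a, ha⟩ : ∃ a, Λ a ≠ 0 := by
      by_contra! hc
      exact h0 (LinearMap.ext hc)
    refine ⟨(Λ a)⁻¹ • (a : L), ?_⟩
    rw [map_smul, smul_apply, hΛ, smul_smul, inv_mul_cancel₀ ha, one_smul]

/-- Differentiating the quadratic equations at v along a tangent vector w gives (t - c)w ∈ Lv, where
t is the Killing dual of Λ and c = (Λ,Λ). Modulo v one may take w in the lower part, where t - c is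
injective, so w itself lies in Lv. -/
theorem IsPositiveSystem.tangentConeAt_subset (hf : IsIrredRep f)
    (hS : IsPositiveSystem (rootsOf A ⊤) S)
    (hΛ : ∀ a : A, f a v = Λ a • v) (hS0 : ∀ α ∈ S, ∀ x ∈ rootVec A α, f x v = 0) (hv : v ≠ 0)
    (hdim : Module.finrank ℂ V ≠ 1) {C : Set V} (hvC : v ∈ C)
    (hC : ∀ u ∈ C, OnQuadrics f (Λ (cartanDual A Λ)) u) :
    tangentConeAt ℂ C v ⊆ orbitTangent f v := by
  set t : L := (cartanDual A Λ : L) with ht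
  set c := Λ (cartanDual A Λ) with hc
  have hvT := hS.self_mem_orbitTangent hf hΛ hS0 hv hdim
  have htv : f t v = c • v := hΛ _
  have hvE : v ∈ Module.End.eigenspace (f t : V →ₗ[ℂ] V) c :=
    Module.End.mem_eigenspace_iff.2 htv
  have hvM : v ∉ lowerPart f A Λ := fun h =>
    hv (Submodule.disjoint_def.1 disjoint_eigenspace_lowerPart v hvE h)
  obtain ⟨l', hl', hlM'⟩ := Submodule.exists_dual_map_eq_bot_of_notMem hvM inferInstance
  obtain ⟨l, hlv, hlM⟩ : ∃ l : V →ₗ[ℂ] ℂ, l v = 1 ∧ ∀ m ∈ lowerPart f A Λ, l m = 0 := by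
    refine ⟨(l' v)⁻¹ • l', by simp [hl'], fun m hm => ?_⟩
    have : l' m = 0 := by
      have h1 : l' m ∈ (lowerPart f A Λ).map l' := Submodule.mem_map_of_mem hm
      rw [hlM'] at h1
      simpa using h1
    simp [this]
  obtain ⟨X, hX⟩ := exists_moment f l
  -- With l = 1 at v and 0 on the lower part, y ↦ l(yv) is Λ on the Cartan subalgebra and 0 on all
  -- root spaces, just as pairing with t.
  have hXv : X v = t := by
    rw [← sub_eq_zero]
    refine killing_left_zero fun y => ?_
    have hyt : y ∈ (A.toSubmodule ⊔ ⨆ α ∈ S, rootVec A α) ⊔ ⨆ α ∈ S, rootVec A (-α) := by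
      rw [hS.iSup_eq_top]; trivial
    obtain ⟨z, hz, y, hy, rfl⟩ := Submodule.mem_sup.1 hyt
    obtain ⟨a, ha, w, hw, rfl⟩ := Submodule.mem_sup.1 hz
    have h1 : killingForm ℂ L t y = 0 := by
      have : (⨆ α ∈ S, rootVec A (-α)) ≤ LinearMap.ker (killingForm ℂ L t) :=
        iSup₂_le fun β hβ y hy => killingForm_rootVec_eq_zero (cartan_mem_rootVec_zero _) hy (by
          rw [zero_add]; exact neg_ne_zero.2 (hS.subset hβ).1)
      exact this hy
    have h2 : f (a + w + y) v = Λ ⟨a, ha⟩ • v + f y v := by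
      rw [map_add, map_add, ← hΛ ⟨a, ha⟩]
      change f a v + f w v + f y v = f a v + f y v
      rw [iSup_rootVec_apply_eq_zero hS0 w hw, add_zero]
    rw [map_sub, LinearMap.sub_apply, hX, h2, map_add, map_smul, hlv,
      hlM _ (hS.apply_neg_mem_lowerPart hΛ hS0 hv y hy).1, map_add, map_add, h1,
      killingForm_cartan_iSup_rootVec hS _ w hw, killingForm_cartanDual Λ ⟨a, ha⟩]
    simp
  let F : V →L[ℂ] (V →L[ℂ] V) := LinearMap.toContinuousLinearMap ((f : L →ₗ[ℂ] V →L[ℂ] V) ∘ₗ X)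
  let lc : V →L[ℂ] ℂ := LinearMap.toContinuousLinearMap l
  have hF : ∀ u, F u = f (X u) := fun u => rfl
  have hlc : ∀ u, lc u = l u := fun u => rfl
  intro w hw
  have h1 := ((F.hasFDerivAt (x := v)).clm_apply (hasFDerivAt_id v)).sub
    (((lc.hasFDerivAt (x := v)).smul (hasFDerivAt_id v)).const_smul c)
  -- The defect u ↦ X(u)u - c l(u)u vanishes on C, so its derivative at v kills the tangent cone.
  have h2 : HasFDerivWithinAt ((fun y => (F y) (id y)) - c • ((lc : V → ℂ) • id))
      (0 : V →L[ℂ] V) C v := by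
    refine (hasFDerivWithinAt_const (0 : V) v C).congr (fun u hu => ?_) ?_
    · have := hC u hu l (X u) (hX u)
      simp [hF, hlc, this, mul_smul]
    · have := hC v hvC l (X v) (hX v)
      simp [hF, hlc, this, mul_smul]
  have h3 := h1.hasFDerivWithinAt.unique_on h2 hw
  simp only [hF, hXv, hlc, hlv, id, ContinuousLinearMap.comp_id, sub_apply, add_apply,
    ContinuousLinearMap.flip_apply, smul_apply, ContinuousLinearMap.smulRight_apply, one_smul,
    zero_apply, ContinuousLinearMap.id_apply] at h3
  have h4 : f t w - c • w ∈ orbitTangent f v := by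
    have : f t w - c • w = c • l w • v - f (X w) v := by
      rw [smul_add, sub_eq_zero] at h3
      rw [sub_eq_sub_iff_add_eq_add, h3, add_comm]
    rw [this]
    exact Submodule.sub_mem _ (Submodule.smul_mem _ _ (Submodule.smul_mem _ _ hvT))
      (mem_orbitTangent_self f _ _)
  -- the operator `t - c` is bijective on the intersection of `L v` with the lower part
  have hM : ∀ m ∈ lowerPart f A Λ, f t m ∈ lowerPart f A Λ := by
    have h3 : lowerPart f A Λ ≤ (lowerPart f A Λ).comap (f t : V →ₗ[ℂ] V) := by
      refine iSup_le fun s w hw => ?_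
      rw [Module.End.mem_eigenspace_iff] at hw
      change f t (w) ∈ lowerPart f A Λ
      change f t w = _ at hw
      rw [hw]
      exact Submodule.smul_mem _ _ (Submodule.mem_iSup_of_mem s (Module.End.mem_eigenspace_iff.2 hw))
    exact fun m hm => h3 hm
  have hT : ∀ m ∈ orbitTangent f v, f t m ∈ orbitTangent f v := by
    rintro _ ⟨y, rfl⟩
    have : f t (f y v) = f ⁅t, y⁆ v + c • f y v := by
      rw [rep_lie, htv, map_smul]; abel
    rw [this]
    exact Submodule.add_mem _ (mem_orbitTangent_self f _ _)
      (Submodule.smul_mem _ _ (mem_orbitTangent_self f _ _))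
  let U : Submodule ℂ V := orbitTangent f v ⊓ lowerPart f A Λ
  let g : U →ₗ[ℂ] U := ((f t : V →ₗ[ℂ] V) - c • LinearMap.id).restrict fun m hm =>
    ⟨Submodule.sub_mem _ (hT m hm.1) (Submodule.smul_mem _ c hm.1),
      Submodule.sub_mem _ (hM m hm.2) (Submodule.smul_mem _ c hm.2)⟩
  have hker : ∀ m ∈ lowerPart f A Λ, f t m - c • m = 0 → m = 0 := fun m hm h =>
    Submodule.disjoint_def.1 disjoint_eigenspace_lowerPart m
      (Module.End.mem_eigenspace_iff.2 (sub_eq_zero.1 h)) hm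
  have hg : Function.Injective g := by
    rw [← LinearMap.ker_eq_bot, LinearMap.ker_eq_bot']
    rintro ⟨m, hm⟩ h
    exact Subtype.ext (hker m hm.2 (congrArg Subtype.val h))
  have hg' := LinearMap.surjective_of_injective hg
  obtain ⟨u, hu, m, hm, rfl⟩ := Submodule.mem_sup.1
    ((hS.span_sup_lowerPart hf hΛ hS0 hv).symm ▸ Submodule.mem_top :
      w ∈ Submodule.span ℂ {v} ⊔ lowerPart f A Λ)
  obtain ⟨k, rfl⟩ := Submodule.mem_span_singleton.1 hu
  have h5 : f t (k • v + m) - c • (k • v + m) = f t m - c • m := by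
    rw [map_add, map_smul, htv, smul_add, smul_comm]; abel
  rw [h5] at h4
  obtain ⟨⟨m', hm'⟩, h6⟩ := hg' ⟨f t m - c • m, h4,
    Submodule.sub_mem _ (hM m hm) (Submodule.smul_mem _ c hm)⟩
  have h7 : f t m' - c • m' = f t m - c • m := congrArg Subtype.val h6
  have h8 : m' - m = 0 := hker _ (Submodule.sub_mem _ hm'.2 hm) (by
    rw [map_sub, smul_sub, sub_sub_sub_comm, h7, sub_self])
  rw [← sub_eq_zero.1 h8]
  exact Submodule.add_mem _ (Submodule.smul_mem _ _ hvT) hm'.1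

end HighestWeight

/-! ### Exponentials and the adjoint action -/

section Exponential

variable {𝔸 : Type*} [NormedRing 𝔸] [NormedAlgebra ℂ 𝔸]

theorem hasSum_unique_of_eq {α : Type*} [AddCommMonoid α] [TopologicalSpace α] [T2Space α]
    {f g : ℕ → α} {a b : α} (hf : HasSum f a) (hg : HasSum g b) (h : ∀ n, f n = g n) : a = b := by
  rw [funext h] at hf
  exact hf.unique hg

theorem hasSum_exp [CompleteSpace 𝔸] (x : 𝔸) :
    HasSum (fun n : ℕ => ((n.factorial : ℂ)⁻¹) • x ^ n) (NormedSpace.exp x) :=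
  NormedSpace.exp_series_hasSum_exp' (𝕂 := ℂ) x

/-- The operator `y ↦ x y - y x`. -/
noncomputable def adOp (x : 𝔸) : 𝔸 →L[ℂ] 𝔸 :=
  ContinuousLinearMap.mul ℂ 𝔸 x + (ContinuousLinearMap.mul ℂ 𝔸).flip (-x)

theorem adOp_apply (x y : 𝔸) : adOp x y = x * y - y * x := by
  simp [adOp, sub_eq_add_neg]

variable [CompleteSpace 𝔸]

/-- Left multiplication by x and right multiplication by -x commute, so the exponential of their sum
factors. -/
theorem exp_adOp_apply (x y : 𝔸) :
    NormedSpace.exp (adOp x) y = NormedSpace.exp x * y * NormedSpace.exp (-x) := by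
  let _ : NormedAlgebra ℚ (𝔸 →L[ℂ] 𝔸) := NormedAlgebra.restrictScalars ℚ ℂ _
  have hc : Commute (ContinuousLinearMap.mul ℂ 𝔸 x) ((ContinuousLinearMap.mul ℂ 𝔸).flip (-x)) := by
    ext z
    simp [mul_assoc]
  have hl : ∀ z : 𝔸, NormedSpace.exp (ContinuousLinearMap.mul ℂ 𝔸 x) z = NormedSpace.exp x * z := by
    intro z
    have h1 := (hasSum_exp (ContinuousLinearMap.mul ℂ 𝔸 x)).mapL (ContinuousLinearMap.apply ℂ 𝔸 z)
    have h2 := (hasSum_exp x).mul_right z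
    have h3 : ∀ n : ℕ, (ContinuousLinearMap.mul ℂ 𝔸 x ^ n) z = x ^ n * z := by
      intro n
      induction n with
      | zero => simp
      | succ n ih => rw [pow_succ', pow_succ', mul_assoc, ← ih]; rfl
    refine hasSum_unique_of_eq h1 h2 fun n => ?_
    rw [ContinuousLinearMap.apply_apply, smul_apply, h3, smul_mul_assoc]
  have hr : ∀ z : 𝔸, NormedSpace.exp ((ContinuousLinearMap.mul ℂ 𝔸).flip (-x)) z =
      z * NormedSpace.exp (-x) := by
    intro z
    have h1 := (hasSum_exp ((ContinuousLinearMap.mul ℂ 𝔸).flip (-x))).mapL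
      (ContinuousLinearMap.apply ℂ 𝔸 z)
    have h2 := (hasSum_exp (-x)).mul_left z
    have h3 : ∀ n : ℕ, ((ContinuousLinearMap.mul ℂ 𝔸).flip (-x) ^ n) z = z * (-x) ^ n := by
      intro n
      induction n with
      | zero => simp
      | succ n ih => rw [pow_succ', pow_succ, ← mul_assoc, ← ih]; rfl
    refine hasSum_unique_of_eq h1 h2 fun n => ?_
    rw [ContinuousLinearMap.apply_apply, smul_apply, h3, mul_smul_comm]
  rw [adOp, NormedSpace.exp_add_of_commute hc]
  change NormedSpace.exp (ContinuousLinearMap.mul ℂ 𝔸 x)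
    (NormedSpace.exp ((ContinuousLinearMap.mul ℂ 𝔸).flip (-x)) y) = _
  rw [hl, hr, mul_assoc]

theorem hasSum_exp_conj (x y : 𝔸) :
    HasSum (fun n : ℕ => ((n.factorial : ℂ)⁻¹) • (adOp x ^ n) y)
      (NormedSpace.exp x * y * NormedSpace.exp (-x)) := by
  rw [← exp_adOp_apply]
  exact (hasSum_exp (adOp x)).mapL (ContinuousLinearMap.apply ℂ 𝔸 y)

/-- The operator T - λ is nilpotent of order two on y, so the series stops after the linear term. -/
theorem exp_smul_apply {E : Type*} [NormedAddCommGroup E] [NormedSpace ℂ E] [CompleteSpace E]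
    {T : E →L[ℂ] E} {lam : ℂ} {y z : E} (hy : T y = lam • y + z) (hz : T z = lam • z) (t : ℂ) :
    NormedSpace.exp (t • T) y = Complex.exp (t * lam) • (y + t • z) := by
  let _ : NormedAlgebra ℚ (E →L[ℂ] E) := NormedAlgebra.restrictScalars ℚ ℂ _
  let S : E →L[ℂ] E := T - lam • 1
  have hS : t • T = algebraMap ℂ (E →L[ℂ] E) (t * lam) + t • S := by
    rw [Algebra.algebraMap_eq_smul_one, smul_sub, smul_smul]; abel
  have hSy : S y = z := by simp [S, hy]
  have hSz : S z = 0 := by simp [S, hz]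
  rw [hS, NormedSpace.exp_add_of_commute (Algebra.commutes _ _),
    ← NormedSpace.algebraMap_exp_comm, ← Complex.exp_eq_exp_ℂ]
  have h1 := (hasSum_exp (t • S)).mapL (ContinuousLinearMap.apply ℂ E y)
  have h2 : NormedSpace.exp (t • S) y = y + t • z := by
    have h3 : HasSum (fun n : ℕ => (ContinuousLinearMap.apply ℂ E y)
        (((n.factorial : ℂ)⁻¹) • (t • S) ^ n)) (∑ n ∈ Finset.range 2,
          (ContinuousLinearMap.apply ℂ E y) (((n.factorial : ℂ)⁻¹) • (t • S) ^ n)) := by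
      refine hasSum_sum_of_ne_finset_zero fun n hn => ?_
      obtain ⟨k, rfl⟩ := Nat.exists_eq_add_of_le (not_lt.1 fun h => hn (Finset.mem_range.2 h))
      have h5 : ((t • S) ^ (2 + k)) y = 0 := by
        rw [add_comm, pow_add]
        change ((t • S) ^ k) (((t • S) ^ 2) y) = 0
        rw [pow_two]
        change ((t • S) ^ k) ((t • S) ((t • S) y)) = 0
        have h6 : (t • S) ((t • S) y) = 0 := by simp [hSy, hSz]
        rw [h6, map_zero]
      rw [ContinuousLinearMap.apply_apply, smul_apply, h5, smul_zero]
    have h4 := h1.unique h3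
    simpa [Finset.sum_range_succ, hSy] using h4
  change (algebraMap ℂ (E →L[ℂ] E) (Complex.exp (t * lam))) (NormedSpace.exp (t • S) y) = _
  rw [h2, Algebra.algebraMap_eq_smul_one]
  simp

end Exponential

/-! ### Conjugation by matrix exponentials -/

section MatrixExp

open scoped Matrix.Norms.Operator

variable {m : ℕ}

theorem Matrix.exp_neg_mul_exp (x : Matrix (Fin m) (Fin m) ℂ) :
    NormedSpace.exp (-x) * NormedSpace.exp x = 1 := by
  rw [Matrix.exp_neg]
  exact Matrix.nonsing_inv_mul _ ((Matrix.isUnit_iff_isUnit_det _).1 (Matrix.isUnit_exp x))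

theorem Matrix.exp_mul_exp_neg (x : Matrix (Fin m) (Fin m) ℂ) :
    NormedSpace.exp x * NormedSpace.exp (-x) = 1 := by
  rw [Matrix.exp_neg]
  exact Matrix.mul_nonsing_inv _ ((Matrix.isUnit_iff_isUnit_det _).1 (Matrix.isUnit_exp x))

theorem Matrix.adOp_pow_mem (L : LieSubalgebra ℂ (Matrix (Fin m) (Fin m) ℂ))
    {x y : Matrix (Fin m) (Fin m) ℂ} (hx : x ∈ L) (hy : y ∈ L) (n : ℕ) : (adOp x ^ n) y ∈ L := by
  induction n with
  | zero => exact hy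
  | succ n ih =>
    rw [pow_succ']
    change adOp x ((adOp x ^ n) y) ∈ L
    rw [adOp_apply, ← Ring.lie_def]
    exact L.lie_mem hx ih

theorem Matrix.exp_conj_mem (L : LieSubalgebra ℂ (Matrix (Fin m) (Fin m) ℂ))
    {x y : Matrix (Fin m) (Fin m) ℂ} (hx : x ∈ L) (hy : y ∈ L) :
    NormedSpace.exp x * y * NormedSpace.exp (-x) ∈ L := by
  have hcl : IsClosed (L.toSubmodule : Set (Matrix (Fin m) (Fin m) ℂ)) :=
    Submodule.closed_of_finiteDimensional _
  exact hcl.mem_of_tendsto (hasSum_exp_conj x y) (Filter.Eventually.of_forall fun s =>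
    Submodule.sum_mem _ fun n _ => Submodule.smul_mem _ _ (adOp_pow_mem L hx hy n))

/-- Both sides are exponential series of inner derivations, which f intertwines term by term. The
linear extension of f to all matrices makes it a continuous map that can be applied to the sum. -/
theorem Matrix.map_exp_conj {V : Type*} [NormedAddCommGroup V] [NormedSpace ℂ V] [CompleteSpace V]
    (L : LieSubalgebra ℂ (Matrix (Fin m) (Fin m) ℂ)) (f : L →ₗ⁅ℂ⁆ (V →L[ℂ] V)) (x y : L)
    (h : NormedSpace.exp (x : Matrix (Fin m) (Fin m) ℂ) * y *
      NormedSpace.exp (-(x : Matrix (Fin m) (Fin m) ℂ)) ∈ L) :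
    f ⟨_, h⟩ = NormedSpace.exp (f x) * f y * NormedSpace.exp (-f x) := by
  obtain ⟨D, hD⟩ := LinearMap.exists_extend (f : L.toSubmodule →ₗ[ℂ] V →L[ℂ] V)
  have hD' : ∀ z : L, D (z : Matrix (Fin m) (Fin m) ℂ) = f z := fun z => LinearMap.congr_fun hD z
  let Dc : Matrix (Fin m) (Fin m) ℂ →L[ℂ] (V →L[ℂ] V) := LinearMap.toContinuousLinearMap D
  have hDc : ∀ z : L, Dc (z : Matrix (Fin m) (Fin m) ℂ) = f z := hD'
  have h1 := (hasSum_exp_conj (x : Matrix (Fin m) (Fin m) ℂ) y).mapL Dc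
  have h2 := hasSum_exp_conj (f x) (f y)
  have h3 : ∀ n : ℕ, Dc ((adOp (x : Matrix (Fin m) (Fin m) ℂ) ^ n) y) = (adOp (f x) ^ n) (f y) := by
    intro n
    induction n with
    | zero => exact hDc y
    | succ n ih =>
      have hm := adOp_pow_mem L x.2 y.2 n
      have e : (adOp (x : Matrix (Fin m) (Fin m) ℂ) ^ (n + 1)) y =
          ((⁅x, ⟨_, hm⟩⁆ : L) : Matrix (Fin m) (Fin m) ℂ) := by
        rw [pow_succ']
        exact adOp_apply _ _
      rw [e, hDc, LieHom.map_lie, ← hDc ⟨_, hm⟩, ih, pow_succ', Ring.lie_def]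
      exact (adOp_apply _ _).symm
  rw [← hDc]
  refine hasSum_unique_of_eq h1 h2 fun n => ?_
  rw [map_smul, h3]

theorem Matrix.exp_smul_conj {x y z : Matrix (Fin m) (Fin m) ℂ} {lam : ℂ}
    (hy : x * y - y * x = lam • y + z) (hz : x * z - z * x = lam • z) (t : ℂ) :
    NormedSpace.exp (t • x) * y * NormedSpace.exp (-(t • x)) =
      Complex.exp (t * lam) • (y + t • z) := by
  refine (exp_adOp_apply (t • x) y).symm.trans ?_
  have : adOp (t • x) = t • adOp x := by
    ext w : 1
    simp [adOp_apply, smul_sub]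
  rw [this]
  exact exp_smul_apply (by rw [adOp_apply, hy]) (by rw [adOp_apply, hz]) t

/-- If the conjugates of all matrices by the one-parameter group of `x` are bounded, then the
eigenvalues of `ad x` are imaginary, and `ad x` is semisimple. -/
theorem Matrix.re_eq_zero_of_bounded {x : Matrix (Fin m) (Fin m) ℂ}
    {K : Set (Matrix (Fin m) (Fin m) ℂ)} (hK : IsCompact K)
    (hx : ∀ t : ℝ, NormedSpace.exp ((t : ℂ) • x) ∈ K)
    {y z : Matrix (Fin m) (Fin m) ℂ} {lam : ℂ} (hy0 : y ≠ 0)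
    (hy : x * y - y * x = lam • y + z) (hz : x * z - z * x = lam • z) : lam.re = 0 ∧ z = 0 := by
  obtain ⟨R, hR⟩ := hK.isBounded.exists_norm_le
  -- The left side is the norm of the conjugate of y' by exp(tx), hence bounded for all real t,
  -- positive or negative.
  have hbd : ∀ (y' z' : Matrix (Fin m) (Fin m) ℂ), x * y' - y' * x = lam • y' + z' →
      x * z' - z' * x = lam • z' → ∀ t : ℝ,
      Real.exp (t * lam.re) * ‖y' + (t : ℂ) • z'‖ ≤ R * ‖y'‖ * R := by
    intro y' z' hy' hz' t
    have h1 := congrArg norm (exp_smul_conj hy' hz' (t : ℂ))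
    rw [norm_smul, Complex.norm_exp] at h1
    have h2 : ((t : ℂ) * lam).re = t * lam.re := by simp
    rw [h2] at h1
    rw [← h1]
    have h3 : NormedSpace.exp (-((t : ℂ) • x)) ∈ K := by
      have := hx (-t)
      rwa [Complex.ofReal_neg, neg_smul] at this
    have hR0 : 0 ≤ R := (norm_nonneg _).trans (hR _ (hx 0))
    calc _ ≤ ‖NormedSpace.exp ((t : ℂ) • x) * y'‖ * ‖NormedSpace.exp (-((t : ℂ) • x))‖ :=
          norm_mul_le _ _
      _ ≤ (‖NormedSpace.exp ((t : ℂ) • x)‖ * ‖y'‖) * ‖NormedSpace.exp (-((t : ℂ) • x))‖ := by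
          gcongr; exact norm_mul_le _ _
      _ ≤ R * ‖y'‖ * R := by gcongr; exacts [hR _ (hx t), hR _ h3]
  have heig : ∀ y' : Matrix (Fin m) (Fin m) ℂ, y' ≠ 0 → x * y' - y' * x = lam • y' →
      lam.re = 0 := by
    intro y' hy0' hy'
    have h1 := hbd y' 0 (by rw [hy', add_zero]) (by simp)
    by_contra h0
    have h2 : ∀ s : ℝ, Real.exp s ≤ R * R := by
      intro s
      have h3 := h1 (s / lam.re)
      rw [div_mul_cancel₀ _ h0, smul_zero, add_zero] at h3
      have h4 : 0 < ‖y'‖ := norm_pos_iff.2 hy0'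
      refine le_of_mul_le_mul_right ?_ h4
      linarith
    -- At s = R² the inequality s + 1 ≤ eˢ already violates the bound.
    have h3 := h2 (R * R)
    have h4 := Real.add_one_le_exp (R * R)
    linarith
  by_cases hz0 : z = 0
  · subst hz0
    exact ⟨heig y hy0 (by rw [hy, add_zero]), rfl⟩
  · exfalso
    have h0 := heig z hz0 hz
    have h1 := hbd y z hy hz
    have h2 : 0 < ‖z‖ := norm_pos_iff.2 hz0
    -- This time makes the norm of tz exceed the bound plus the norm of y by exactly 1.
    have h3 := h1 ((R * ‖y‖ * R + ‖y‖ + 1) / ‖z‖)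
    rw [h0, mul_zero, Real.exp_zero, one_mul] at h3
    have hR0 : 0 ≤ R := (norm_nonneg _).trans (hR _ (hx 0))
    have h4 : ‖(((R * ‖y‖ * R + ‖y‖ + 1) / ‖z‖ : ℝ) : ℂ) • z‖ = R * ‖y‖ * R + ‖y‖ + 1 := by
      rw [norm_smul, Complex.norm_real, Real.norm_of_nonneg (by positivity),
        div_mul_cancel₀ _ h2.ne']
    have h5 := norm_sub_le (y + (((R * ‖y‖ * R + ‖y‖ + 1) / ‖z‖ : ℝ) : ℂ) • z) y
    rw [add_sub_cancel_left, h4] at h5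
    linarith

end MatrixExp

/-! ### Negativity of the trace of a square -/

section NegTrace

open Module

/-- An endomorphism that is semisimple with imaginary eigenvalues. -/
theorem trace_mul_self_of_imaginary {E : Type*} [AddCommGroup E] [Module ℂ E]
    [FiniteDimensional ℂ E] {T : End ℂ E}
    (hT : ∀ (lam : ℂ) (y z : E), y ≠ 0 → T y = lam • y + z → T z = lam • z → lam.re = 0 ∧ z = 0)
    (hT0 : T ≠ 0) : (LinearMap.trace ℂ E (T ∘ₗ T)).re < 0 := by
  -- The hypothesis rules out Jordan chains of length two, hence all longer ones.
  have hgen : ∀ lam, T.maxGenEigenspace lam = T.eigenspace lam := by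
    intro lam
    have hk : ∀ k : ℕ, ∀ y, ((T - lam • 1) ^ (k + 1)) y = 0 → (T - lam • 1) y = 0 := by
      intro k
      induction k with
      | zero => intro y hy; simpa using hy
      | succ k ih =>
        intro y hy
        rw [pow_succ] at hy
        have h1 : (T - lam • 1) ((T - lam • 1) y) = 0 := ih _ hy
        by_cases hy0 : y = 0
        · simp [hy0]
        have := hT lam y ((T - lam • 1) y) hy0 (by simp) (by
          rw [LinearMap.sub_apply, sub_eq_zero] at h1
          simpa using h1)
        exact this.2
    refine le_antisymm (fun y hy => ?_) End.eigenspace_le_maxGenEigenspace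
    obtain ⟨k, hk'⟩ := (End.mem_maxGenEigenspace T lam y).1 hy
    have h1 := hk k y (by rw [pow_succ', Module.End.mul_apply, hk', map_zero])
    rw [End.mem_eigenspace_iff]
    rw [LinearMap.sub_apply, sub_eq_zero] at h1
    simpa using h1
  have htop : ⨆ lam, T.eigenspace lam = ⊤ := by
    rw [← End.iSup_maxGenEigenspace_eq_top T]
    simp only [hgen]
  classical
  have hint := DirectSum.isInternal_submodule_of_iSupIndep_of_iSup_eq_top
    (End.eigenspaces_iSupIndep T) htop
  have hfin : {lam | T.eigenspace lam ≠ ⊥}.Finite :=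
    WellFoundedGT.finite_ne_bot_of_iSupIndep (End.eigenspaces_iSupIndep T)
  have hmaps : ∀ lam, Set.MapsTo (T ∘ₗ T) (T.eigenspace lam) (T.eigenspace lam) := by
    intro lam y hy
    have := End.mem_eigenspace_iff.1 hy
    simp only [LinearMap.comp_apply, this, map_smul]
    exact Submodule.smul_mem _ _ (Submodule.smul_mem _ _ hy)
  rw [LinearMap.trace_eq_sum_trace_restrict' hint hfin hmaps, Complex.re_sum]
  have him : ∀ lam, T.eigenspace lam ≠ ⊥ → lam.re = 0 := by
    intro lam hlam
    obtain ⟨y, hy, hy0⟩ := (Submodule.ne_bot_iff _).1 hlam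
    exact (hT lam y 0 hy0 (by rw [add_zero]; exact End.mem_eigenspace_iff.1 hy) (by simp)).1
  have htr : ∀ lam, T.eigenspace lam ≠ ⊥ →
      (LinearMap.trace ℂ _ ((T ∘ₗ T).restrict (hmaps lam))).re =
      -(lam.im * lam.im) * finrank ℂ (T.eigenspace lam) := by
    intro lam hlam
    have h1 : (T ∘ₗ T).restrict (hmaps lam) = (lam * lam) • LinearMap.id := by
      ext ⟨y, hy⟩
      have := End.mem_eigenspace_iff.1 hy
      change T (T y) = (lam * lam) • y
      rw [this, map_smul, this, smul_smul]
    rw [h1, map_smul, LinearMap.trace_id, smul_eq_mul]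
    simp [him lam hlam]
  obtain ⟨lam, hlam, hlam0⟩ : ∃ lam, T.eigenspace lam ≠ ⊥ ∧ lam ≠ 0 := by
    by_contra! hc
    apply hT0
    have : T.eigenspace 0 = ⊤ := by
      rw [eq_top_iff, ← htop]
      refine iSup_le fun lam => ?_
      by_cases h : T.eigenspace lam = ⊥
      · rw [h]; exact bot_le
      · rw [hc lam h]
    ext y
    have hy : y ∈ T.eigenspace 0 := by rw [this]; trivial
    simpa using hy
  refine Finset.sum_neg' (fun mu hmu => ?_) ⟨lam, hfin.mem_toFinset.2 hlam, ?_⟩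
  · rw [htr mu (hfin.mem_toFinset.1 hmu)]
    have := mul_self_nonneg mu.im
    have h2 : (0 : ℝ) ≤ finrank ℂ (T.eigenspace mu) := Nat.cast_nonneg _
    nlinarith
  · rw [htr lam hlam]
    have h1 : 0 < lam.im * lam.im := by
      refine mul_self_pos.2 fun h => hlam0 (Complex.ext (him lam hlam) h)
    have h2 : (0 : ℝ) < finrank ℂ (T.eigenspace lam) := by
      rw [Nat.cast_pos, Nat.pos_iff_ne_zero]
      exact fun h => hlam (Submodule.finrank_eq_zero.1 h)
    have := mul_pos h1 h2
    linarith

end NegTrace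

/-! ### Orbits of highest weight vectors -/

section Orbit

theorem exp_neg_mul_exp {𝔸 : Type*} [NormedRing 𝔸] [NormedAlgebra ℂ 𝔸] [CompleteSpace 𝔸] (x : 𝔸) :
    NormedSpace.exp (-x) * NormedSpace.exp x = 1 := by
  let _ : NormedAlgebra ℚ 𝔸 := NormedAlgebra.restrictScalars ℚ ℂ 𝔸
  rw [← NormedSpace.exp_add_of_commute (Commute.neg_left (Commute.refl x)), neg_add_cancel,
    NormedSpace.exp_zero]

variable {m : ℕ} {L : LieSubalgebra ℂ (Matrix (Fin m) (Fin m) ℂ)}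

theorem connGroup_induction {p : connGroup L → Prop} (hexp : ∀ x, p (groupExp L x)) (hone : p 1)
    (hmul : ∀ g h, p g → p h → p (g * h)) (hinv : ∀ g, p g → p g⁻¹) (g : connGroup L) : p g := by
  obtain ⟨g, hg⟩ := g
  induction hg using Subgroup.closure_induction with
  | mem g hg =>
    obtain ⟨x, rfl⟩ := hg
    exact hexp x
  | one => exact hone
  | mul g h hg hh ihg ihh => exact hmul _ _ ihg ihh
  | inv g hg ih => exact hinv _ ih

variable (L) in
theorem exists_lieEquiv_exp (x : L) : ∃ Φ : L ≃ₗ⁅ℂ⁆ L, ∀ y, (Φ y : Matrix (Fin m) (Fin m) ℂ) =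
    NormedSpace.exp (x : Matrix (Fin m) (Fin m) ℂ) * y *
      NormedSpace.exp (-(x : Matrix (Fin m) (Fin m) ℂ)) := by
  set U := NormedSpace.exp (x : Matrix (Fin m) (Fin m) ℂ) with hU
  set U' := NormedSpace.exp (-(x : Matrix (Fin m) (Fin m) ℂ)) with hU'
  have h1 : U' * U = 1 := Matrix.exp_neg_mul_exp _
  have h2 : U * U' = 1 := Matrix.exp_mul_exp_neg _
  have hm : ∀ y : L, U * y * U' ∈ L := fun y => Matrix.exp_conj_mem L x.2 y.2
  have hm' : ∀ y : L, U' * y * U ∈ L := fun y => by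
    have := Matrix.exp_conj_mem L (L.neg_mem x.2) y.2
    rwa [neg_neg] at this
  refine ⟨{ toFun := fun y => ⟨_, hm y⟩
            invFun := fun y => ⟨_, hm' y⟩
            map_add' := fun y z => Subtype.ext ?_
            map_smul' := fun c y => Subtype.ext ?_
            map_lie' := fun {y z} => Subtype.ext ?_
            left_inv := fun y => Subtype.ext ?_
            right_inv := fun y => Subtype.ext ?_ }, fun y => rfl⟩
  · change U * ((y : Matrix (Fin m) (Fin m) ℂ) + z) * U' = U * y * U' + U * z * U'
    rw [mul_add, add_mul]
  · change U * (c • (y : Matrix (Fin m) (Fin m) ℂ)) * U' = c • (U * y * U')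
    rw [mul_smul_comm, smul_mul_assoc]
  · change U * ((y : Matrix (Fin m) (Fin m) ℂ) * z - z * y) * U' =
      U * y * U' * (U * z * U') - U * z * U' * (U * y * U')
    rw [mul_sub, sub_mul]
    congr 1
    · calc U * ((y : Matrix (Fin m) (Fin m) ℂ) * z) * U' = U * y * 1 * z * U' := by
            simp only [mul_assoc, one_mul]
        _ = _ := by rw [← h1]; simp only [mul_assoc]
    · calc U * ((z : Matrix (Fin m) (Fin m) ℂ) * y) * U' = U * z * 1 * y * U' := by
            simp only [mul_assoc, one_mul]
        _ = _ := by rw [← h1]; simp only [mul_assoc]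
  · change U' * (U * y * U') * U = y
    calc U' * (U * y * U') * U = (U' * U) * y * (U' * U) := by simp only [mul_assoc]
      _ = y := by rw [h1, one_mul, mul_one]
  · change U * (U' * y * U) * U' = y
    calc U * (U' * y * U) * U' = (U * U') * y * (U * U') := by simp only [mul_assoc]
      _ = y := by rw [h2, one_mul, mul_one]

variable {V : Type*} [NormedAddCommGroup V] [NormedSpace ℂ V] (ρ : HolomorphicRep L V)

namespace HolomorphicRep

theorem act_mul (g h : connGroup L) (w : V) : ρ.act (g * h) w = ρ.act g (ρ.act h w) := by
  simp only [act, map_mul]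
  rfl

theorem act_one (w : V) : ρ.act 1 w = w := by
  simp only [act, map_one]
  rfl

theorem act_inv_act (g : connGroup L) (w : V) : ρ.act g⁻¹ (ρ.act g w) = w := by
  rw [← act_mul, inv_mul_cancel, act_one]

theorem act_act_inv (g : connGroup L) (w : V) : ρ.act g (ρ.act g⁻¹ w) = w := by
  rw [← act_mul, mul_inv_cancel, act_one]

theorem act_ne_zero (g : connGroup L) {w : V} (hw : w ≠ 0) : ρ.act g w ≠ 0 := fun h => hw (by
  rw [← ρ.act_inv_act g w, h, map_zero])

theorem act_groupExp (x : L) (w : V) : ρ.act (groupExp L x) w = NormedSpace.exp (ρ.diff x) w := by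
  rw [act, ρ.map_exp]

variable [FiniteDimensional ℂ V]

/-- The adjoint action. Only exponentials need the series; the property passes to products and
inverses, which exhaust the group. -/
theorem exists_ad (g : connGroup L) :
    ∃ Φ : L ≃ₗ⁅ℂ⁆ L, ∀ y w, ρ.act g (ρ.diff y w) = ρ.diff (Φ y) (ρ.act g w) := by
  have : CompleteSpace V := FiniteDimensional.complete ℂ V
  induction g using connGroup_induction with
  | hexp x =>
    obtain ⟨Φ, hΦ⟩ := exists_lieEquiv_exp L x
    refine ⟨Φ, fun y w => ?_⟩
    have h1 : ρ.diff (Φ y) = NormedSpace.exp (ρ.diff x) * ρ.diff y *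
        NormedSpace.exp (-ρ.diff x) := by
      rw [← Matrix.map_exp_conj L ρ.diff x y (hΦ y ▸ (Φ y).2)]
      congr 1
      exact Subtype.ext (hΦ y)
    have h2 : NormedSpace.exp (-ρ.diff x) * NormedSpace.exp (ρ.diff x) = 1 := exp_neg_mul_exp _
    have h3 : NormedSpace.exp (ρ.diff x) * ρ.diff y =
        ρ.diff (Φ y) * NormedSpace.exp (ρ.diff x) := by
      rw [h1, mul_assoc _ _ (NormedSpace.exp (ρ.diff x)), h2, mul_one]
    rw [act_groupExp, act_groupExp]
    exact congrArg (fun T : V →L[ℂ] V => T w) h3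
  | hone => exact ⟨LieEquiv.refl, fun y w => by rw [act_one, act_one]; rfl⟩
  | hmul g h ihg ihh =>
    obtain ⟨Φ, hΦ⟩ := ihg
    obtain ⟨Ψ, hΨ⟩ := ihh
    exact ⟨Ψ.trans Φ, fun y w => by rw [act_mul, act_mul, hΨ, hΦ]; rfl⟩
  | hinv g ih =>
    obtain ⟨Φ, hΦ⟩ := ih
    refine ⟨Φ.symm, fun y w => ?_⟩
    have h1 := hΦ (Φ.symm y) (ρ.act g⁻¹ w)
    rw [LieEquiv.apply_symm_apply, act_act_inv] at h1
    rw [← h1, act_inv_act]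

theorem exp_mem_of_stable {T : V →L[ℂ] V} {U : Submodule ℂ V} (hT : ∀ u ∈ U, T u ∈ U) {u : V}
    (hu : u ∈ U) : NormedSpace.exp T u ∈ U := by
  have : CompleteSpace V := FiniteDimensional.complete ℂ V
  have h1 := (hasSum_exp T).mapL (ContinuousLinearMap.apply ℂ V u)
  have hcl : IsClosed (U : Set V) := Submodule.closed_of_finiteDimensional _
  have hn : ∀ n : ℕ, (T ^ n) u ∈ U := by
    intro n
    induction n with
    | zero => exact hu
    | succ n ih => rw [pow_succ']; exact hT _ ih
  exact hcl.mem_of_tendsto h1 (Filter.Eventually.of_forall fun s =>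
    Submodule.sum_mem _ fun n _ => Submodule.smul_mem _ _ (hn n))

variable {ρ}

theorem IsIrred.isIrredRep (h : ρ.IsIrred) : IsIrredRep ρ.diff := by
  intro U hU
  refine h.2 U fun g => ?_
  -- Stability under the inverse is carried along because the group is a subgroup closure; for
  -- exponentials it follows from finite dimension.
  have : (∀ u ∈ U, ρ.act g u ∈ U) ∧ (∀ u ∈ U, ρ.act g⁻¹ u ∈ U) := by
    induction g using connGroup_induction with
    | hexp x =>
      have h1 : ∀ u ∈ U, ρ.act (groupExp L x) u ∈ U := fun u hu => by
        rw [act_groupExp]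
        exact exp_mem_of_stable (hU x) hu
      refine ⟨h1, fun u hu => ?_⟩
      let g : U →ₗ[ℂ] U := (ρ.act (groupExp L x) : V →ₗ[ℂ] V).restrict h1
      have hg : Function.Injective g := by
        intro a b hab
        have h2 : ρ.act (groupExp L x) a = ρ.act (groupExp L x) b := congrArg Subtype.val hab
        refine Subtype.ext ?_
        rw [← ρ.act_inv_act (groupExp L x) a, h2, act_inv_act]
      obtain ⟨w, hw⟩ := LinearMap.surjective_of_injective hg ⟨u, hu⟩
      have h2 : ρ.act (groupExp L x) w = u := congrArg Subtype.val hw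
      rw [← h2, act_inv_act]
      exact w.2
    | hone => exact ⟨fun u hu => by rwa [act_one], fun u hu => by rwa [inv_one, act_one]⟩
    | hmul g h ihg ihh =>
      refine ⟨fun u hu => ?_, fun u hu => ?_⟩
      · rw [act_mul]; exact ihg.1 _ (ihh.1 u hu)
      · rw [mul_inv_rev, act_mul]; exact ihh.2 _ (ihg.2 u hu)
    | hinv g ih => exact ⟨ih.2, by rw [inv_inv]; exact ih.1⟩
  exact this.1

theorem act_orbitTangent (g : connGroup L) {u w : V} (hw : w ∈ orbitTangent ρ.diff u) :
    ρ.act g w ∈ orbitTangent ρ.diff (ρ.act g u) := by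
  obtain ⟨x, rfl⟩ := hw
  obtain ⟨Φ, hΦ⟩ := ρ.exists_ad g
  rw [hΦ]
  exact mem_orbitTangent_self _ _ _

end HolomorphicRep

theorem finrank_ne_one_of_symplectic [FiniteDimensional ℂ V] {ω : LinearMap.BilinForm ℂ V}
    (h1 : ω.IsAlt) (h2 : ω.Nondegenerate) : Module.finrank ℂ V ≠ 1 := by
  intro h
  obtain ⟨v, hv, hv'⟩ := finrank_eq_one_iff'.1 h
  refine hv (h2.1 v fun w => ?_)
  obtain ⟨c, rfl⟩ := hv' w
  rw [map_smul, h1.self_eq_zero, smul_zero]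

end Orbit

/-! ### Tangent spaces of the orbit, and compactness of the real stabilizer -/

section OrbitGeometry

variable {m : ℕ} {L : LieSubalgebra ℂ (Matrix (Fin m) (Fin m) ℂ)}
variable {V : Type*} [NormedAddCommGroup V] [NormedSpace ℂ V] [FiniteDimensional ℂ V]
variable (ρ : HolomorphicRep L V)

namespace HolomorphicRep

/-- `C` is an orbit of highest weight vectors. -/
def IsHighestWeightOrbit (C : Set V) : Prop :=
  ∃ v₀ : V, ρ.IsHighestWeightVector v₀ ∧ C = Set.range fun g => ρ.act g v₀

variable {ρ}

theorem act_groupExp_of_eigen {x : L} {w : V} {lam : ℂ} (hx : ρ.diff x w = lam • w) (t : ℂ) :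
    ρ.act (groupExp L (t • x)) w = Complex.exp (t * lam) • w := by
  have : CompleteSpace V := FiniteDimensional.complete ℂ V
  rw [act_groupExp, map_smul]
  have := exp_smul_apply (T := ρ.diff x) (y := w) (z := 0) (by rw [hx, add_zero]) (by simp) t
  rw [this, smul_zero, add_zero]

theorem orbitTangent_subset_tangentConeAt {C : Set V} {u : V} (hC : ∀ x, ρ.act (groupExp L x) u ∈ C) :
    (orbitTangent ρ.diff u : Set V) ⊆ tangentConeAt ℂ C u := by
  have : CompleteSpace V := FiniteDimensional.complete ℂ V
  rintro _ ⟨x, rfl⟩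
  have h1 : HasDerivAt (fun t : ℂ => NormedSpace.exp (t • ρ.diff x) u) (ρ.diff x u) 0 := by
    have h2 := hasDerivAt_exp_smul_const (𝕂 := ℂ) (ρ.diff x) (0 : ℂ)
    have h3 := (ContinuousLinearMap.apply ℂ V u).hasFDerivAt.comp_hasDerivAt (0 : ℂ) h2
    simpa [Function.comp_def] using h3
  have h2 := h1.hasFDerivAt.hasFDerivWithinAt (s := Set.univ)
  have h3 := h2.mapsTo_tangent_cone
  rw [tangentConeAt_univ] at h3
  have h4 := h3 (Set.mem_univ (1 : ℂ))
  have h5 : (fun t : ℂ => NormedSpace.exp (t • ρ.diff x) u) '' Set.univ ⊆ C := by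
    rintro _ ⟨t, -, rfl⟩
    have := hC (t • x)
    rwa [act_groupExp, map_smul] at this
  have h6 := tangentConeAt_mono h5 h4
  simpa using h6

omit [FiniteDimensional ℂ V] in
theorem tangentConeAt_act {C : Set V} (g : connGroup L) (hC : ∀ u ∈ C, ρ.act g u ∈ C) {u w : V}
    (hw : w ∈ tangentConeAt ℂ C u) : ρ.act g w ∈ tangentConeAt ℂ C (ρ.act g u) := by
  have h1 := ((ρ.act g).hasFDerivWithinAt (s := C) (x := u)).mapsTo_tangent_cone hw
  refine tangentConeAt_mono ?_ h1
  rintro _ ⟨u, hu, rfl⟩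
  exact hC u hu

variable {C : Set V}

omit [FiniteDimensional ℂ V] in
theorem IsHighestWeightOrbit.act_mem (hC : ρ.IsHighestWeightOrbit C) (g : connGroup L) {u : V}
    (hu : u ∈ C) : ρ.act g u ∈ C := by
  obtain ⟨v₀, hv₀, rfl⟩ := hC
  obtain ⟨h, rfl⟩ := hu
  exact ⟨g * h, act_mul _ _ _ _⟩

variable [LieAlgebra.IsKilling ℂ L]

theorem IsHighestWeightOrbit.apply_eq_zero_of_orthogonal (hC : ρ.IsHighestWeightOrbit C) {u : V}
    (hu : u ∈ C) {x : L}
    (hx : ∀ y, ρ.diff y u ∈ Submodule.span ℂ {u} → killingForm ℂ L x y = 0) : ρ.diff x u = 0 := by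
  obtain ⟨v₀, ⟨hv0, A, hA, S, hS, ⟨Λ, hΛ⟩, hS0⟩, rfl⟩ := hC
  obtain ⟨g, rfl⟩ := hu
  obtain ⟨Φ, hΦ⟩ := ρ.exists_ad g
  have h1 : ρ.diff (Φ.symm x) v₀ = 0 := by
    refine hS.apply_eq_zero_of_orthogonal hS0 fun y hy => ?_
    rw [← LieAlgebra.killingForm_of_equiv_apply (R := ℂ) Φ, LieEquiv.apply_symm_apply]
    refine hx _ ?_
    rw [← hΦ]
    obtain ⟨a, ha, w, hw, rfl⟩ := Submodule.mem_sup.1 hy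
    have h2 : ρ.diff (a + w) v₀ = Λ ⟨a, ha⟩ • v₀ := by
      rw [map_add, ← hΛ ⟨a, ha⟩]
      change ρ.diff a v₀ + ρ.diff w v₀ = ρ.diff a v₀
      rw [iSup_rootVec_apply_eq_zero hS0 w hw, add_zero]
    rw [h2, map_smul]
    exact Submodule.smul_mem _ _ (Submodule.mem_span_singleton_self _)
  have h2 := hΦ (Φ.symm x) v₀
  rw [h1, map_zero, LieEquiv.apply_symm_apply] at h2
  exact h2.symm

theorem IsHighestWeightOrbit.self_mem_orbitTangent (hC : ρ.IsHighestWeightOrbit C)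
    (hirr : ρ.IsIrred) (hdim : Module.finrank ℂ V ≠ 1) {u : V} (hu : u ∈ C) :
    u ∈ orbitTangent ρ.diff u := by
  obtain ⟨v₀, ⟨hv0, A, hA, S, hS, ⟨Λ, hΛ⟩, hS0⟩, rfl⟩ := hC
  obtain ⟨g, rfl⟩ := hu
  exact act_orbitTangent g (hS.self_mem_orbitTangent hirr.isIrredRep hΛ hS0 hv0 hdim)

/-- One inclusion comes from the curves exp(tx)u. The other is proved at the highest weight vector
and transported by the group. -/
theorem IsHighestWeightOrbit.tangentConeAt_eq (hC : ρ.IsHighestWeightOrbit C)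
    (hirr : ρ.IsIrred) (hdim : Module.finrank ℂ V ≠ 1) {u : V} (hu : u ∈ C) :
    tangentConeAt ℂ C u = orbitTangent ρ.diff u := by
  refine Set.Subset.antisymm ?_ (orbitTangent_subset_tangentConeAt fun x => hC.act_mem _ hu)
  have hact := fun g u hu => hC.act_mem (u := u) g hu
  obtain ⟨v₀, ⟨hv0, A, hA, S, hS, ⟨Λ, hΛ⟩, hS0⟩, rfl⟩ := hC
  have hq := hS.onQuadrics hΛ hS0
  have h0 := hS.tangentConeAt_subset hirr.isIrredRep hΛ hS0 hv0 hdim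
    (C := Set.range fun g => ρ.act g v₀) ⟨1, ρ.act_one v₀⟩ (by
      rintro _ ⟨g, rfl⟩
      obtain ⟨Φ, hΦ⟩ := ρ.exists_ad g
      exact hq.map hΦ)
  obtain ⟨g, rfl⟩ := hu
  intro w hw
  have h1 := tangentConeAt_act g⁻¹ (hact g⁻¹) hw
  dsimp only at h1
  rw [act_inv_act] at h1
  have h2 := act_orbitTangent g (h0 h1)
  rwa [act_act_inv] at h2

theorem IsHighestWeightOrbit.tangentSpaceAt_eq (hC : ρ.IsHighestWeightOrbit C)
    (hirr : ρ.IsIrred) (hdim : Module.finrank ℂ V ≠ 1) {u : V} (hu : u ∈ C) :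
    tangentSpaceAt C u = orbitTangent ρ.diff u := by
  rw [tangentSpaceAt, hC.tangentConeAt_eq hirr hdim hu, Submodule.span_eq]

/-- Some x satisfies xu = u, so exp(log(c) x) scales u by c inside the orbit. -/
theorem IsHighestWeightOrbit.isConic (hC : ρ.IsHighestWeightOrbit C)
    (hirr : ρ.IsIrred) (hdim : Module.finrank ℂ V ≠ 1) : IsConic C := by
  intro c hc u hu
  obtain ⟨x, hx⟩ := hC.self_mem_orbitTangent hirr hdim hu
  have h1 := act_groupExp_of_eigen (ρ := ρ) (x := x) (w := u) (lam := 1) (by rw [hx, one_smul])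
    (Complex.log c)
  rw [mul_one, Complex.exp_log hc] at h1
  rw [← h1]
  exact hC.act_mem _ hu

omit [FiniteDimensional ℂ V] [LieAlgebra.IsKilling ℂ L] in
theorem mem_stabAlgebra_mk {v : V} (hv : v ≠ 0) {x : L} :
    x ∈ ρ.stabAlgebra (Projectivization.mk ℂ v hv) ↔
      ρ.diff x v ∈ Submodule.span ℂ {v} := by
  have h1 : x ∈ ρ.stabAlgebra (Projectivization.mk ℂ v hv) ↔
    ∀ w ∈ (Projectivization.mk ℂ v hv).submodule,
      ρ.diff x w ∈ (Projectivization.mk ℂ v hv).submodule := Iff.rfl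
  rw [h1, Projectivization.submodule_mk]
  refine ⟨fun h => h v (Submodule.mem_span_singleton_self v), fun h w hw => ?_⟩
  obtain ⟨c, rfl⟩ := Submodule.mem_span_singleton.1 hw
  rw [map_smul]
  exact Submodule.smul_mem _ _ h

-- The real one-parameter group of x stays in the compact group H⁰, so its conjugation action is
-- bounded.
omit [LieAlgebra.IsKilling ℂ L] in
theorem re_eq_zero_of_mem_realStabAlgebra {σ : L →ₛₗ[starRingEnd ℂ] L} {p : ℙ ℂ V}
    (hK : IsCompact (ρ.realStab σ p)) {x : L} (hx : x ∈ ρ.realStabAlgebra σ p) {y z : L} {lam : ℂ}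
    (hy0 : y ≠ 0) (hy : ⁅x, y⁆ = lam • y + z) (hz : ⁅x, z⁆ = lam • z) : lam.re = 0 ∧ z = 0 := by
  have hcont : Continuous fun g : connGroup L =>
      ((g : (Matrix (Fin m) (Fin m) ℂ)ˣ) : Matrix (Fin m) (Fin m) ℂ) :=
    Units.continuous_val.comp continuous_subtype_val
  have h1 := Matrix.re_eq_zero_of_bounded (x := (x : Matrix (Fin m) (Fin m) ℂ)) (y := y) (z := z)
    (lam := lam) (hK.image hcont) (fun t => ⟨groupExp L ((t : ℂ) • x), ⟨?_, ?_⟩, rfl⟩)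
    (fun h => hy0 (Subtype.ext h)) (congrArg Subtype.val hy) (congrArg Subtype.val hz)
  · exact ⟨h1.1, Subtype.ext h1.2⟩
  · refine Subgroup.subset_closure ⟨_, ?_, rfl⟩
    rw [LinearMap.map_smulₛₗ, Complex.conj_ofReal, hx.1]
  · induction p using Projectivization.ind with
    | h v hv =>
      obtain ⟨c, hc⟩ := Submodule.mem_span_singleton.1 ((mem_stabAlgebra_mk hv).1 hx.2)
      have h2 := act_groupExp_of_eigen hc.symm (t : ℂ)
      rw [projAct_mk _ _ v hv (by rw [h2]; exact smul_ne_zero (Complex.exp_ne_zero _) hv)]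
      rw [Projectivization.mk_eq_mk_iff']
      exact ⟨_, h2.symm⟩

/-- The trace of (ad x)² is a sum of squares of imaginary numbers, and ad x ≠ 0 because the Killing
form is nondegenerate. -/
theorem killingForm_re_neg {σ : L →ₛₗ[starRingEnd ℂ] L} {p : ℙ ℂ V}
    (hK : IsCompact (ρ.realStab σ p)) {x : L} (hx : x ∈ ρ.realStabAlgebra σ p) (hx0 : x ≠ 0) :
    (killingForm ℂ L x x).re < 0 := by
  refine trace_mul_self_of_imaginary (T := LieAlgebra.ad ℂ L x) (fun lam y z hy0 hy hz =>
    re_eq_zero_of_mem_realStabAlgebra hK hx hy0 hy hz) fun h => hx0 ?_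
  refine killing_left_zero fun y => ?_
  rw [LieModule.traceForm_apply_apply]
  change LinearMap.trace ℂ L (LieAlgebra.ad ℂ L x ∘ₗ _) = 0
  rw [h, LinearMap.zero_comp, map_zero]

end HolomorphicRep

end OrbitGeometry

/-! ### Real forms -/

section RealForm

set_option linter.unusedSectionVars false

variable {L : Type*} [LieRing L] [LieAlgebra ℂ L] [FiniteDimensional ℂ L]

/-- The matrix of T' in the basis σ(bᵢ) is the complex conjugate of the matrix of T in the basis bᵢ.
-/
theorem trace_conj {σ : L →ₛₗ[starRingEnd ℂ] L} (hσ : ∀ x, σ (σ x) = x) {T T' : Module.End ℂ L}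
    (hT : ∀ x, T' (σ x) = σ (T x)) : LinearMap.trace ℂ L T' = conj (LinearMap.trace ℂ L T) := by
  let b := Module.finBasis ℂ L
  let e : L ≃ₗ[ℂ] (Fin (Module.finrank ℂ L) → ℂ) :=
    { toFun := fun x i => conj (b.equivFun (σ x) i)
      invFun := fun c => σ (b.equivFun.symm fun i => conj (c i))
      map_add' := fun x y => by ext i; simp
      map_smul' := fun c x => by ext i; simp
      left_inv := fun x => by
        simp only [Complex.conj_conj]
        change σ (b.equivFun.symm (b.equivFun (σ x))) = x
        rw [LinearEquiv.symm_apply_apply, hσ]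
      right_inv := fun c => by
        ext i
        change conj (b.equivFun (σ (σ (b.equivFun.symm fun i => conj (c i)))) i) = c i
        rw [hσ, LinearEquiv.apply_symm_apply, Complex.conj_conj] }
  let b' := Module.Basis.ofEquivFun e
  have hb' : ∀ i, b' i = σ (b i) := by
    intro i
    rw [Module.Basis.coe_ofEquivFun]
    change σ (b.equivFun.symm fun j => conj ((Pi.single i 1 : Fin _ → ℂ) j)) = _
    congr 1
    rw [LinearEquiv.symm_apply_eq]
    ext j
    rw [Module.Basis.equivFun_self]
    by_cases h : i = j
    · subst h; simp
    · simp [h, Ne.symm h]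
  rw [LinearMap.trace_eq_matrix_trace ℂ b', LinearMap.trace_eq_matrix_trace ℂ b, Matrix.trace,
    Matrix.trace, map_sum]
  refine Finset.sum_congr rfl fun i _ => ?_
  rw [Matrix.diag_apply, Matrix.diag_apply, LinearMap.toMatrix_apply, LinearMap.toMatrix_apply,
    hb', hT]
  change e (σ (T (b i))) i = _
  change conj (b.equivFun (σ (σ (T (b i)))) i) = _
  rw [hσ]
  rfl

theorem IsConjugation.killingForm {σ : L →ₛₗ[starRingEnd ℂ] L} (hσ : IsConjugation σ) (x y : L) :
    killingForm ℂ L (σ x) (σ y) = conj (killingForm ℂ L x y) := by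
  rw [LieModule.traceForm_apply_apply, LieModule.traceForm_apply_apply]
  refine trace_conj hσ.involutive fun z => ?_
  simp [hσ.map_lie]

variable [LieAlgebra.IsKilling ℂ L]

theorem exists_killingForm_eq (φ : L →ₗ[ℂ] ℂ) : ∃ z : L, ∀ x, killingForm ℂ L z x = φ x := by
  let e := (killingForm ℂ L).toDual (LieAlgebra.IsKilling.killingForm_nondegenerate ℂ L)
  exact ⟨e.symm φ, fun y => LinearMap.BilinForm.apply_toDual_symm_apply
      (hB := LieAlgebra.IsKilling.killingForm_nondegenerate ℂ L) _ _⟩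

/-- Double orthogonality: a functional separating y from P is a Killing pairing. -/
theorem mem_of_killingForm_orthogonal {P : Submodule ℂ L} {y : L}
    (hy : ∀ z, (∀ w ∈ P, killingForm ℂ L z w = 0) → killingForm ℂ L z y = 0) : y ∈ P := by
  by_contra h
  obtain ⟨φ, hφ, hφP⟩ := Submodule.exists_dual_map_eq_bot_of_notMem h inferInstance
  obtain ⟨z, hz⟩ := exists_killingForm_eq φ
  refine hφ ((hz y).symm.trans (hy z fun w hw => ?_))
  have h1 : φ w ∈ P.map φ := Submodule.mem_map_of_mem hw
  rw [hφP] at h1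
  rw [hz]
  simpa using h1

variable {V : Type*} [NormedAddCommGroup V] [NormedSpace ℂ V]

/-- The data of an irreducible symplectic representation `f` with an invariant real structure, and
a vector `v` for which the stabilizer of `ℂ v` in the real form is compact and for which the
Killing-orthogonal of the stabilizer of `ℂ v` in `L` kills `v`. -/
structure RealFormData (f : L →ₗ⁅ℂ⁆ (V →L[ℂ] V)) (σ : L →ₛₗ[starRingEnd ℂ] L)
    (ω : LinearMap.BilinForm ℂ V) (τ : V →ₛₗ[starRingEnd ℂ] V) (v : V) : Prop where
  irr : IsIrredRep f
  conjugation : IsConjugation σ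
  real : IsCompatibleRealStructure ω τ
  alt : ω.IsAlt
  nondegenerate : ω.Nondegenerate
  invariant : ∀ x u w, ω (f x u) w = - ω u (f x w)
  comm : ∀ x w, f x (τ w) = τ (f (σ x) w)
  ne_zero : v ≠ 0
  neg : ∀ x, σ x = x → f x v ∈ Submodule.span ℂ {v} → x ≠ 0 → (killingForm ℂ L x x).re < 0
  orth : ∀ x, (∀ y, f y v ∈ Submodule.span ℂ {v} → killingForm ℂ L x y = 0) → f x v = 0

omit [FiniteDimensional ℂ L] [LieAlgebra.IsKilling ℂ L] in
theorem gammaForm_apply (ω : LinearMap.BilinForm ℂ V) (τ : V →ₛₗ[starRingEnd ℂ] V) (x y : V) :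
    gammaForm ω τ x y = Complex.I * ω x (τ y) := rfl

theorem gammaForm_isHermForm {ω : LinearMap.BilinForm ℂ V} {τ : V →ₛₗ[starRingEnd ℂ] V}
    (hω : ω.IsAlt) (hτ : IsCompatibleRealStructure ω τ) : IsHermForm (gammaForm ω τ) := by
  intro x y
  rw [gammaForm_apply, gammaForm_apply, map_mul, ← hτ.compatible, hτ.involutive, Complex.conj_I,
    ← hω.neg_eq y (τ x)]
  ring

namespace RealFormData

variable {f : L →ₗ⁅ℂ⁆ (V →L[ℂ] V)} {σ : L →ₛₗ[starRingEnd ℂ] L}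
  {ω : LinearMap.BilinForm ℂ V} {τ : V →ₛₗ[starRingEnd ℂ] V} {v : V}
  (D : RealFormData f σ ω τ v)

variable (f v) in
/-- The stabilizer of the line `ℂ v`. -/
def stab : Submodule ℂ L where
  carrier := {x | f x v ∈ Submodule.span ℂ {v}}
  add_mem' := fun {x y} hx hy => by
    change f (x + y) v ∈ Submodule.span ℂ {v}
    rw [map_add]; exact Submodule.add_mem _ hx hy
  zero_mem' := by
    change f 0 v ∈ Submodule.span ℂ {v}
    rw [map_zero]; exact Submodule.zero_mem _
  smul_mem' := fun c x hx => by
    change f (c • x) v ∈ Submodule.span ℂ {v}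
    rw [map_smul]; exact Submodule.smul_mem _ c hx

variable (f v) in
/-- The Killing-orthogonal of the stabilizer of the line `ℂ v`. -/
def stabOrth : Submodule ℂ L where
  carrier := {x | ∀ y ∈ stab f v, killingForm ℂ L x y = 0}
  add_mem' := fun {x x'} hx hx' y hy => by
    rw [map_add, LinearMap.add_apply, hx y hy, hx' y hy, add_zero]
  zero_mem' := fun y _ => by simp
  smul_mem' := fun c x hx y hy => by
    rw [map_smul, LinearMap.smul_apply, hx y hy, smul_zero]

variable (f v σ) in
/-- The conjugate of `stabOrth`. -/
def stabOrthConj : Submodule ℂ L := (stabOrth f v).comap σ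

theorem exists_char {x : L} (hx : x ∈ stab f v) : ∃ c : ℂ, f x v = c • v := by
  obtain ⟨c, hc⟩ := Submodule.mem_span_singleton.1 hx
  exact ⟨c, hc.symm⟩

theorem lie_apply_eq_zero {x y : L} (hx : x ∈ stab f v) (hy : y ∈ stab f v) : f ⁅x, y⁆ v = 0 := by
  obtain ⟨c, hc⟩ := exists_char hx
  obtain ⟨d, hd⟩ := exists_char hy
  rw [rep_lie, hc, hd, map_smul, map_smul, hc, hd, smul_comm, sub_self]

theorem lie_mem_stab {x y : L} (hx : x ∈ stab f v) (hy : y ∈ stab f v) : ⁅x, y⁆ ∈ stab f v := by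
  change f ⁅x, y⁆ v ∈ Submodule.span ℂ {v}
  rw [lie_apply_eq_zero hx hy]
  exact Submodule.zero_mem _

theorem lie_mem_stabOrth {x y : L} (hx : x ∈ stab f v) (hy : y ∈ stabOrth f v) :
    ⁅x, y⁆ ∈ stabOrth f v := by
  intro z hz
  rw [killingForm_lie, hy _ (lie_mem_stab hx hz), neg_zero]

include D

theorem apply_eq_zero {x : L} (hx : x ∈ stabOrth f v) : f x v = 0 := D.orth x hx

theorem stabOrth_le : stabOrth f v ≤ stab f v := fun x hx => by
  change f x v ∈ Submodule.span ℂ {v}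
  rw [D.apply_eq_zero hx]
  exact Submodule.zero_mem _

theorem gamma_apply (x : L) (u w : V) :
    gammaForm ω τ (f x u) w = - gammaForm ω τ u (f (σ x) w) := by
  rw [gammaForm_apply, gammaForm_apply, D.invariant, D.comm]
  ring

theorem herm : IsHermForm (gammaForm ω τ) := gammaForm_isHermForm D.alt D.real

/-- Both x + σx and i(x - σx) lie in the real stabilizer and are Killing-null, so negative
definiteness makes them vanish. -/
theorem eq_zero_of_orthogonal {x : L} (h1 : x ∈ stab f v) (h2 : σ x ∈ stab f v)
    (h : ∀ y ∈ stab f v, σ y ∈ stab f v → killingForm ℂ L x y = 0) : x = 0 := by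
  have hs := D.conjugation
  have hreal : ∀ y, y ∈ stab f v → σ y = y → killingForm ℂ L y y = 0 → y = 0 := by
    intro y hy hy' h0
    by_contra hne
    have := D.neg y hy' hy hne
    rw [h0] at this
    simp at this
  have hσx : ∀ y ∈ stab f v, σ y = y → killingForm ℂ L (σ x) y = 0 := by
    intro y hy hy'
    rw [← hy', hs.killingForm, h y hy (hy'.symm ▸ hy), map_zero]
  have ha : x + σ x = 0 := by
    have e1 : σ (x + σ x) = x + σ x := by rw [map_add, hs.involutive, add_comm]
    have e2 : x + σ x ∈ stab f v := Submodule.add_mem _ h1 h2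
    refine hreal _ e2 e1 ?_
    rw [LinearMap.map_add₂, h _ e2 (e1.symm ▸ e2), hσx _ e2 e1, add_zero]
  have hb : Complex.I • (x - σ x) = 0 := by
    have e1 : σ (Complex.I • (x - σ x)) = Complex.I • (x - σ x) := by
      rw [LinearMap.map_smulₛₗ, map_sub, hs.involutive, Complex.conj_I, neg_smul, ← smul_neg,
        neg_sub]
    have e2 : Complex.I • (x - σ x) ∈ stab f v :=
      Submodule.smul_mem _ _ (Submodule.sub_mem _ h1 h2)
    refine hreal _ e2 e1 ?_
    rw [LinearMap.map_smul₂, LinearMap.map_sub₂, h _ e2 (e1.symm ▸ e2), hσx _ e2 e1, sub_zero,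
      smul_zero]
  have hb' : x - σ x = 0 := (smul_eq_zero.1 hb).resolve_left Complex.I_ne_zero
  have h3 : (2 : ℂ) • x = 0 := by
    rw [two_smul]
    calc x + x = (x + σ x) + (x - σ x) := by abel
      _ = 0 := by rw [ha, hb', add_zero]
  exact (smul_eq_zero.1 h3).resolve_left two_ne_zero

/-- If x is orthogonal to both summands, then x ∈ N ⊆ P, and σx is orthogonal to N, so σx ∈ P. Thus
x lies in P ∩ σP and is orthogonal to it. -/
theorem stab_sup_stabOrthConj : stab f v ⊔ stabOrthConj f σ v = ⊤ := by
  rw [eq_top_iff]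
  intro y _
  refine mem_of_killingForm_orthogonal fun x hx => ?_
  have h1 : x ∈ stabOrth f v := fun y hy => hx y (Submodule.mem_sup_left hy)
  have h2 : σ x ∈ stab f v := by
    refine mem_of_killingForm_orthogonal fun z hz => ?_
    have hz' : σ z ∈ stabOrthConj f σ v := by
      change σ (σ z) ∈ stabOrth f v
      rw [D.conjugation.involutive]; exact hz
    rw [← D.conjugation.involutive z, D.conjugation.killingForm, LieModule.traceForm_comm,
      hx _ (Submodule.mem_sup_right hz'), map_zero]
  rw [D.eq_zero_of_orthogonal (D.stabOrth_le h1) h2 fun y hy _ => h1 y hy]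
  simp

theorem exists_decomp (x : L) : ∃ p ∈ stab f v, ∃ y ∈ stabOrthConj f σ v, x = p + y := by
  obtain ⟨p, hp, y, hy, h⟩ := Submodule.mem_sup.1
    (D.stab_sup_stabOrthConj.symm ▸ Submodule.mem_top : x ∈ stab f v ⊔ stabOrthConj f σ v)
  exact ⟨p, hp, y, hy, h.symm⟩

theorem eq_zero_of_mem_stab_stabOrthConj {x : L} (h1 : x ∈ stab f v)
    (h2 : x ∈ stabOrthConj f σ v) : x = 0 := by
  refine D.eq_zero_of_orthogonal h1 (D.stabOrth_le h2) fun y hy hy' => ?_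
  rw [← D.conjugation.involutive x, ← D.conjugation.involutive y, D.conjugation.killingForm,
    h2 _ hy', map_zero]

theorem gamma_apply_stabOrthConj {y : L} (hy : y ∈ stabOrthConj f σ v) (w : V) :
    gammaForm ω τ (f y w) v = 0 := by
  rw [D.gamma_apply, D.apply_eq_zero hy, map_zero, neg_zero]

/-- Otherwise the γ-orthogonal of v contains v and is preserved by σN, so it is V by
`IsIrredRep.eq_top_of_stable`, contradicting nondegeneracy of ω. -/
theorem gamma_self_ne_zero : gammaForm ω τ v v ≠ 0 := by
  intro h0
  let U : Submodule ℂ V :=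
    { carrier := {u | gammaForm ω τ u v = 0}
      add_mem' := fun {a b} ha hb => by
        change gammaForm ω τ (a + b) v = 0
        rw [map_add, LinearMap.add_apply, ha, hb, add_zero]
      zero_mem' := by simp
      smul_mem' := fun c a ha => by
        change gammaForm ω τ (c • a) v = 0
        rw [map_smul, LinearMap.smul_apply, ha, smul_zero] }
  have hU : U = ⊤ := D.irr.eq_top_of_stable D.ne_zero D.stab_sup_stabOrthConj (fun x hx => hx)
    h0 fun y hy w _ => D.gamma_apply_stabOrthConj hy w
  have h1 : ∀ u, ω u (τ v) = 0 := by
    intro u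
    have h2 : gammaForm ω τ u v = 0 := by
      change u ∈ U
      rw [hU]; trivial
    rw [gammaForm_apply] at h2
    exact (mul_eq_zero.1 h2).resolve_left Complex.I_ne_zero
  have h2 : τ v = 0 := D.nondegenerate.2 _ h1
  apply D.ne_zero
  rw [← D.real.involutive v, h2, map_zero]

/-- The central element of the stabilizer representing its character on the line `ℂ v`. -/
theorem exists_central (hv : v ∈ orbitTangent f v) : ∃ z : L,
    (∀ x, killingForm ℂ L z x * gammaForm ω τ v v = gammaForm ω τ (f x v) v) ∧
    z ∈ stab f v ∧ σ z = -z ∧ ∃ c : ℝ, c ≠ 0 ∧ f z v = (c : ℂ) • v := by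
  have hg := D.gamma_self_ne_zero
  let φ : L →ₗ[ℂ] ℂ :=
    { toFun := fun x => gammaForm ω τ (f x v) v / gammaForm ω τ v v
      map_add' := fun x y => by rw [map_add, add_apply, map_add, LinearMap.add_apply, add_div]
      map_smul' := fun c x => by
        rw [map_smul, smul_apply, map_smul, LinearMap.smul_apply, smul_eq_mul, smul_eq_mul,
          mul_div_assoc]; rfl }
  obtain ⟨z, hz⟩ := exists_killingForm_eq φ
  have hz' : ∀ x, killingForm ℂ L z x * gammaForm ω τ v v = gammaForm ω τ (f x v) v := fun x => by
    rw [hz]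
    exact div_mul_cancel₀ _ hg
  have hσz : σ z = -z := by
    rw [← sub_eq_zero, sub_neg_eq_add]
    refine killing_left_zero fun x => ?_
    rw [map_add, LinearMap.add_apply]
    refine (mul_eq_zero.1 (?_ : _ * gammaForm ω τ v v = 0)).resolve_right hg
    rw [add_mul, hz']
    nth_rewrite 1 [← D.conjugation.involutive x]
    rw [D.conjugation.killingForm, ← D.herm v v, ← map_mul, hz', D.herm, D.gamma_apply,
      add_neg_cancel]
  have hzs : z ∈ stab f v := by
    refine mem_of_killingForm_orthogonal fun w hw => ?_
    rw [LieModule.traceForm_comm]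
    refine (mul_eq_zero.1 (?_ : _ * gammaForm ω τ v v = 0)).resolve_right hg
    rw [hz', D.apply_eq_zero hw, map_zero, LinearMap.zero_apply]
  obtain ⟨k, hk⟩ := exists_char hzs
  have hkz : killingForm ℂ L z z = k := by
    have h1 := hz' z
    rw [hk, map_smul, LinearMap.smul_apply, smul_eq_mul] at h1
    exact mul_right_cancel₀ hg h1
  have hreal : conj k = k := by
    rw [← hkz, ← D.conjugation.killingForm, hσz]
    simp
  have hz0 : z ≠ 0 := by
    rintro rfl
    obtain ⟨x, hx⟩ := hv
    have h1 := hz' x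
    rw [map_zero, LinearMap.zero_apply, zero_mul] at h1
    have hx' : f x v = v := hx
    rw [hx'] at h1
    exact hg h1.symm
  -- The element iz is in the real stabilizer and K(iz,iz) = -k, so k cannot vanish.
  have hneg := D.neg (Complex.I • z) (by rw [LinearMap.map_smulₛₗ, hσz, Complex.conj_I]; simp)
    ((stab f v).smul_mem _ hzs) (smul_ne_zero Complex.I_ne_zero hz0)
  have hkr : ((k.re : ℝ) : ℂ) = k := Complex.conj_eq_iff_re.1 hreal
  refine ⟨z, hz', hzs, hσz, k.re, fun h0 => ?_, by rw [hkr, hk]⟩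
  rw [LinearMap.map_smul₂, map_smul, hkz, ← hkr, h0] at hneg
  simp at hneg

/-- Orthogonality to v reduces r to yv with y ∈ σN. Pairing [z,σy] with y' gives, up to sign and the
factor γ(v,v), the number γ(y'v,yv) = 0. So z commutes with σy, hence with y, and zyv = yzv. -/
theorem radical_eigen {z : L}
    (hz : ∀ x, killingForm ℂ L z x * gammaForm ω τ v v = gammaForm ω τ (f x v) v)
    (hσz : σ z = -z) {c : ℂ} (hc : f z v = c • v) {r : V} (hr : r ∈ orbitTangent f v)
    (hr' : ∀ w ∈ orbitTangent f v, gammaForm ω τ r w = 0) (hv : v ∈ orbitTangent f v) :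
    f z r = c • r := by
  have hg := D.gamma_self_ne_zero
  obtain ⟨x, rfl⟩ := hr
  obtain ⟨p, hp, y, hy, rfl⟩ := D.exists_decomp x
  obtain ⟨k, hk⟩ := exists_char hp
  have h1 : f (p + y) v = k • v + f y v := by rw [map_add, ← hk]; rfl
  have hk0 : k = 0 := by
    have h2 := hr' v hv
    rw [h1, map_add, LinearMap.add_apply, D.gamma_apply_stabOrthConj hy, map_smul, add_zero,
      LinearMap.smul_apply, smul_eq_mul] at h2
    exact (mul_eq_zero.1 h2).resolve_right hg
  rw [hk0, zero_smul, zero_add] at h1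
  rw [h1] at hr' ⊢
  have h3 : ⁅z, σ y⁆ = 0 := by
    refine killing_left_zero fun y' => ?_
    rw [← lie_skew, map_neg, LinearMap.neg_apply, killingForm_lie, neg_neg]
    refine (mul_eq_zero.1 (?_ : _ * gammaForm ω τ v v = 0)).resolve_right hg
    rw [hz, rep_lie, D.apply_eq_zero hy, map_zero, sub_zero, D.gamma_apply, D.conjugation.involutive,
      neg_eq_zero]
    exact D.herm.symm_zero (hr' _ ⟨y', rfl⟩)
  have h4 : ⁅z, y⁆ = 0 := by
    have := congrArg σ h3
    rw [D.conjugation.map_lie, hσz, D.conjugation.involutive, map_zero, neg_lie, neg_eq_zero] at this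
    exact this
  have h5 := rep_lie f z y v
  rw [h4, map_zero, hc, map_smul] at h5
  exact (sub_eq_zero.1 h5.symm)

variable [FiniteDimensional ℂ V]

/-- The tangent space is its own ω-orthogonal, so the radical of γ on it is τ-stable. The element z
acts on the radical by c, but σz = -z makes it act on the τ-image by -c. -/
theorem gamma_nondegenerate (hv : v ∈ orbitTangent f v)
    (hiso : ∀ x ∈ orbitTangent f v, ∀ y ∈ orbitTangent f v, ω x y = 0)
    (hdim : 2 * Module.finrank ℂ (orbitTangent f v) = Module.finrank ℂ V) :
    ∀ x ∈ orbitTangent f v, (∀ y ∈ orbitTangent f v, gammaForm ω τ x y = 0) → x = 0 := by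
  obtain ⟨z, hz, -, hσz, c, hc0, hc⟩ := D.exists_central hv
  have hperp : ∀ x, (∀ y ∈ orbitTangent f v, ω x y = 0) → x ∈ orbitTangent f v := by
    have h1 := LinearMap.BilinForm.finrank_orthogonal D.nondegenerate (orbitTangent f v)
    have h2 : orbitTangent f v ≤ LinearMap.BilinForm.orthogonal ω (orbitTangent f v) :=
      fun x hx y hy => hiso y hy x hx
    have h3 := Submodule.eq_of_le_of_finrank_eq h2 (by omega)
    intro x hx
    rw [h3]
    exact fun y hy => D.alt.isRefl _ _ (hx y hy)
  intro r hr hr'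
  have h1 : ∀ y ∈ orbitTangent f v, ω (τ r) y = 0 := by
    intro y hy
    have h2 := hr' y hy
    rw [gammaForm_apply] at h2
    have h3 := (mul_eq_zero.1 h2).resolve_left Complex.I_ne_zero
    rw [← D.real.involutive y, D.real.compatible, h3, map_zero]
  have h2 : τ r ∈ orbitTangent f v := hperp _ h1
  have h3 : ∀ y ∈ orbitTangent f v, gammaForm ω τ (τ r) y = 0 := by
    intro y hy
    rw [gammaForm_apply, D.real.compatible, hiso r hr y hy, map_zero, mul_zero]
  have e1 := D.radical_eigen hz hσz hc hr hr' hv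
  have e2 := D.radical_eigen hz hσz hc h2 h3 hv
  rw [D.comm, hσz, map_neg, neg_apply, e1, map_neg, LinearMap.map_smulₛₗ, Complex.conj_ofReal] at e2
  have e3 : (2 * (c : ℂ)) • τ r = 0 := by
    rw [two_mul, add_smul]
    nth_rewrite 1 [← e2]
    exact neg_add_cancel _
  have e4 : τ r = 0 := (smul_eq_zero.1 e3).resolve_left
    (mul_ne_zero two_ne_zero (Complex.ofReal_ne_zero.2 hc0))
  rw [← D.real.involutive r, e4, map_zero]

end RealFormData

end RealForm

/-! ### The signature in terms of compact and noncompact roots -/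

theorem IsHermForm.hasSignature_span_insert {E : Type*} [AddCommGroup E] [Module ℂ E]
    [FiniteDimensional ℂ E] {h : E →ₗ[ℂ] E →ₛₗ[starRingEnd ℂ] ℂ} (hh : IsHermForm h) {v : E}
    (hv : 0 < (h v v).re) {ι : Type*} [DecidableEq ι] {w : ι → E} (p : ι → Prop) [DecidablePred p]
    (s : Finset ι) (hwv : ∀ i ∈ s, h (w i) v = 0)
    (hww : ∀ i ∈ s, ∀ j ∈ s, i ≠ j → h (w i) (w j) = 0)
    (hpos : ∀ i ∈ s, p i → 0 < (h (w i) (w i)).re)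
    (hneg : ∀ i ∈ s, ¬ p i → (h (w i) (w i)).re < 0) :
    HasSignature h (Submodule.span ℂ (insert v (w '' s)))
      ((s.filter p).card + 1) (s.filter fun i => ¬ p i).card := by
  induction s using Finset.induction_on with
  | empty =>
    have := (HasSignature.bot (h := h)).add_pos hh hv (by simp)
    simpa using this
  | insert i s hi ih =>
    have H := ih (fun j hj => hwv j (Finset.mem_insert_of_mem hj))
      (fun j hj k hk => hww j (Finset.mem_insert_of_mem hj) k (Finset.mem_insert_of_mem hk))
      (fun j hj => hpos j (Finset.mem_insert_of_mem hj))
      (fun j hj => hneg j (Finset.mem_insert_of_mem hj))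
    have hii := Finset.mem_insert_self i s
    have hor : ∀ y ∈ Submodule.span ℂ (insert v (w '' s)), h (w i) y = 0 := by
      intro y hy
      induction hy using Submodule.span_induction with
      | mem y hy =>
        rcases hy with rfl | ⟨j, hj, rfl⟩
        · exact hwv i hii
        · exact hww i hii j (Finset.mem_insert_of_mem hj) fun h => hi (h ▸ hj)
      | zero => exact map_zero _
      | add x y _ _ hx hy => rw [map_add, hx, hy, add_zero]
      | smul c x _ hx => rw [LinearMap.map_smulₛₗ, hx, smul_zero]
    rw [Finset.coe_insert, Set.image_insert_eq, Set.insert_comm, Submodule.span_insert]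
    by_cases hp : p i
    · rw [Finset.filter_insert, if_pos hp, Finset.filter_insert, if_neg (not_not.2 hp),
        Finset.card_insert_of_notMem (fun h => hi (Finset.mem_filter.1 h).1)]
      exact H.add_pos hh (hpos i hii hp) hor
    · rw [Finset.filter_insert, if_neg hp, Finset.filter_insert, if_pos hp,
        Finset.card_insert_of_notMem (fun h => hi (Finset.mem_filter.1 h).1)]
      exact H.add_neg hh (hneg i hii hp) hor

section Cartan

set_option linter.unusedSectionVars false

variable {L : Type*} [LieRing L] [LieAlgebra ℂ L] [FiniteDimensional ℂ L]
  [LieAlgebra.IsKilling ℂ L]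

/-- Writing 2e = a - ib with a, b real gives 4K(σe,θe) = K(a,θa) + K(b,θb). -/
theorem IsCartanInvolution.killingForm_conj_neg {σ : L →ₛₗ[starRingEnd ℂ] L} {θ : L ≃ₗ⁅ℂ⁆ L}
    (hθ : IsCartanInvolution σ θ) (hσ : IsConjugation σ) {e : L} (he : e ≠ 0) :
    (killingForm ℂ L (σ e) (θ e)).re < 0 := by
  let a := e + σ e
  let b := Complex.I • (e - σ e)
  have ha : σ a = a := by simp only [a, map_add, hσ.involutive, add_comm]
  have hb : σ b = b := by
    simp only [b]
    rw [LinearMap.map_smulₛₗ, map_sub, hσ.involutive, Complex.conj_I, neg_smul, ← smul_neg, neg_sub]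
  have hab : (2 : ℂ) • e = a - Complex.I • b := by
    simp only [a, b]
    rw [smul_smul, Complex.I_mul_I, two_smul, neg_one_smul]
    abel
  have hab' : (2 : ℂ) • σ e = a + Complex.I • b := by
    simp only [a, b]
    rw [smul_smul, Complex.I_mul_I, two_smul, neg_one_smul]
    abel
  clear_value a b
  have hsym : killingForm ℂ L b (θ a) = killingForm ℂ L a (θ b) := by
    rw [← LieAlgebra.killingForm_of_equiv_apply (R := ℂ) θ, hθ.involutive,
      LieModule.traceForm_comm]
  have key : 4 * killingForm ℂ L (σ e) (θ e) =
      killingForm ℂ L a (θ a) + killingForm ℂ L b (θ b) := by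
    calc 4 * killingForm ℂ L (σ e) (θ e)
        = killingForm ℂ L ((2 : ℂ) • σ e) (θ ((2 : ℂ) • e)) := by
          rw [map_smul θ, LinearMap.map_smul₂, map_smul, smul_eq_mul, smul_eq_mul]; ring
      _ = _ := by
          rw [hab, hab', LinearMap.map_add₂, LinearMap.map_smul₂, map_sub θ, map_smul θ,
            map_sub, map_sub, map_smul, map_smul, smul_eq_mul, smul_eq_mul, smul_eq_mul, hsym]
          linear_combination (-killingForm ℂ L b (θ b)) * Complex.I_mul_I
  have h1 : ∀ x, σ x = x → (killingForm ℂ L x (θ x)).re ≤ 0 := by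
    intro x hx
    by_cases h0 : x = 0
    · rw [h0]; simp
    · exact (hθ.neg x hx h0).le
  have key' := congrArg Complex.re key
  rw [Complex.add_re, show (4 : ℂ) = ((4 : ℝ) : ℂ) by norm_num, Complex.re_ofReal_mul] at key'
  have hne : a ≠ 0 ∨ b ≠ 0 := by
    by_contra! h
    rw [h.1, h.2, smul_zero, sub_zero] at hab
    exact he ((smul_eq_zero.1 hab).resolve_left two_ne_zero)
  rcases hne with h | h
  · have := hθ.neg a ha h
    have := h1 b hb
    linarith
  · have := hθ.neg b hb h
    have := h1 a ha
    linarith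

variable {V : Type*} [NormedAddCommGroup V] [NormedSpace ℂ V]

/-- A Cartan subalgebra `A` spanned by a real subspace `A₀` of the real form that stabilizes the
line `ℂ v`, the complexification `H` of the stabilizer of this line in the real form, and a Cartan
involution `θ` fixing `A₀`. -/
structure CartanData (f : L →ₗ⁅ℂ⁆ (V →L[ℂ] V)) (σ : L →ₛₗ[starRingEnd ℂ] L)
    (ω : LinearMap.BilinForm ℂ V) (τ : V →ₛₗ[starRingEnd ℂ] V) (v : V)
    (A₀ : Set L) (A H : LieSubalgebra ℂ L) (θ : L ≃ₗ⁅ℂ⁆ L) : Prop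
    extends RealFormData f σ ω τ v where
  fixed : ∀ a ∈ A₀, σ a = a
  cartan_stab : ∀ a ∈ A₀, a ∈ RealFormData.stab f v
  span : Submodule.span ℂ A₀ = A.toSubmodule
  imaginary : ∀ a ∈ A₀, ∀ x : L, x ≠ 0 → ∀ lam : ℂ, ⁅a, x⁆ = lam • x → lam.re = 0
  levi : H.toSubmodule = Submodule.span ℂ {x | σ x = x ∧ x ∈ RealFormData.stab f v}
  involution : IsCartanInvolution σ θ
  involution_fixed : ∀ a ∈ A₀, θ a = a

namespace CartanData

variable {f : L →ₗ⁅ℂ⁆ (V →L[ℂ] V)} {σ : L →ₛₗ[starRingEnd ℂ] L}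
  {ω : LinearMap.BilinForm ℂ V} {τ : V →ₛₗ[starRingEnd ℂ] V} {v : V}
  {A₀ : Set L} {A H : LieSubalgebra ℂ L} {θ : L ≃ₗ⁅ℂ⁆ L}
  (D : CartanData f σ ω τ v A₀ A H θ)

open RealFormData

include D

theorem le_of_subset {U : Submodule ℂ L} (hU : A₀ ⊆ U) {a : L} (ha : a ∈ A) : a ∈ U := by
  have : A.toSubmodule ≤ U := by
    rw [← D.span]
    exact Submodule.span_le.2 hU
  exact this ha

theorem mem_stab {a : L} (ha : a ∈ A) : a ∈ stab f v := D.le_of_subset D.cartan_stab ha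

theorem θ_apply {a : L} (ha : a ∈ A) : θ a = a := by
  have := D.le_of_subset (U := LinearMap.eqLocus (θ : L →ₗ[ℂ] L) LinearMap.id)
    (fun a ha => D.involution_fixed a ha) ha
  exact this

theorem mem_H {x : L} (h1 : x ∈ stab f v) (h2 : σ x ∈ stab f v) : x ∈ H := by
  have h3 : (2 : ℂ) • x ∈ H.toSubmodule := by
    have : (2 : ℂ) • x = (x + σ x) - Complex.I • (Complex.I • (x - σ x)) := by
      rw [smul_smul, Complex.I_mul_I, two_smul, neg_one_smul]; abel
    rw [this, D.levi]
    refine Submodule.sub_mem _ (Submodule.subset_span ⟨?_, Submodule.add_mem _ h1 h2⟩)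
      (Submodule.smul_mem _ _ (Submodule.subset_span
        ⟨?_, Submodule.smul_mem _ _ (Submodule.sub_mem _ h1 h2)⟩))
    · rw [map_add, D.conjugation.involutive, add_comm]
    · rw [LinearMap.map_smulₛₗ, map_sub, D.conjugation.involutive, Complex.conj_I, neg_smul,
        ← smul_neg, neg_sub]
  have h4 := H.toSubmodule.smul_mem (2 : ℂ)⁻¹ h3
  rwa [smul_smul, inv_mul_cancel₀ two_ne_zero, one_smul] at h4

theorem stab_of_mem_H {x : L} (hx : x ∈ H) : x ∈ stab f v ∧ σ x ∈ stab f v := by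
  have : H.toSubmodule ≤ stab f v ⊓ (stab f v).comap σ := by
    rw [D.levi]
    refine Submodule.span_le.2 fun y hy => ⟨hy.2, ?_⟩
    change σ y ∈ stab f v
    rw [hy.1]; exact hy.2
  exact this hx

theorem conj_mem_H {x : L} (hx : x ∈ H) : σ x ∈ H :=
  D.mem_H (D.stab_of_mem_H hx).2 (by
    rw [D.conjugation.involutive]; exact (D.stab_of_mem_H hx).1)

theorem mem_rootVec_of {α : Module.Dual ℂ A} {x : L}
    (hx : ∀ b ∈ A₀, ∀ hb : b ∈ A, ⁅b, x⁆ = α ⟨b, hb⟩ • x) : x ∈ rootVec A α := by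
  intro a
  let U : Submodule ℂ L :=
    { carrier := {b | ∃ hb : b ∈ A, ⁅b, x⁆ = α ⟨b, hb⟩ • x}
      add_mem' := by
        rintro b c ⟨hb, hb'⟩ ⟨hc, hc'⟩
        refine ⟨A.add_mem hb hc, ?_⟩
        rw [add_lie, hb', hc', ← add_smul, ← map_add]; rfl
      zero_mem' := ⟨A.zero_mem, by
        rw [zero_lie, show (⟨0, A.zero_mem⟩ : A) = 0 from rfl, map_zero, zero_smul]⟩
      smul_mem' := by
        rintro c b ⟨hb, hb'⟩
        refine ⟨A.smul_mem c hb, ?_⟩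
        rw [smul_lie, hb', smul_smul, ← smul_eq_mul, ← map_smul α]; rfl }
  have h1 : A₀ ⊆ U := by
    intro b hb
    have hbA : b ∈ A := by
      change b ∈ A.toSubmodule
      rw [← D.span]; exact Submodule.subset_span hb
    exact ⟨hbA, hx b hb hbA⟩
  obtain ⟨_, h⟩ := D.le_of_subset h1 a.2
  exact h

/-- Roots are imaginary on A₀, so conjugation there is the same as a change of sign. -/
theorem conj_mem_rootVec {α : Module.Dual ℂ A} {x : L} (hx : x ∈ rootVec A α) :
    σ x ∈ rootVec A (-α) := by
  by_cases h0 : x = 0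
  · rw [h0, map_zero]; exact Submodule.zero_mem _
  refine D.mem_rootVec_of fun b hb hbA => ?_
  have h2 := D.imaginary b hb x h0 _ (hx ⟨b, hbA⟩)
  have h3 : conj (α ⟨b, hbA⟩) = (-α) ⟨b, hbA⟩ := by
    rw [LinearMap.neg_apply]
    apply Complex.ext <;> simp [h2]
  rw [← h3, ← LinearMap.map_smulₛₗ, ← hx ⟨b, hbA⟩, D.conjugation.map_lie, D.fixed b hb]

theorem conj_mem_rootVec' {α : Module.Dual ℂ A} {x : L} (hx : x ∈ rootVec A (-α)) :
    σ x ∈ rootVec A α := by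
  have := D.conj_mem_rootVec hx
  rwa [neg_neg] at this

theorem conj_ne_zero {x : L} (hx : x ≠ 0) : σ x ≠ 0 := fun h => hx (by
  rw [← D.conjugation.involutive x, h, map_zero])

theorem θ_mem_rootVec {α : Module.Dual ℂ A} {x : L} (hx : x ∈ rootVec A α) :
    θ x ∈ rootVec A α := by
  intro a
  nth_rewrite 1 [← D.θ_apply a.2]
  rw [← LieEquiv.map_lie, hx a, map_smul]

theorem isCompactRoot_of {α : Module.Dual ℂ A} (h : IsCompactRoot θ A α) {x : L}
    (hx : x ∈ rootVec A (-α)) : θ x = x := by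
  have h1 := h _ (D.conj_mem_rootVec' hx)
  rw [D.involution.comm] at h1
  rw [← D.conjugation.involutive (θ x), h1, D.conjugation.involutive]

theorem isNoncompactRoot_of {α : Module.Dual ℂ A} (h : IsNoncompactRoot θ A α) {x : L}
    (hx : x ∈ rootVec A (-α)) : θ x = -x := by
  have h1 := h _ (D.conj_mem_rootVec' hx)
  rw [D.involution.comm] at h1
  rw [← D.conjugation.involutive (θ x), h1, map_neg, D.conjugation.involutive]

variable [A.IsCartanSubalgebra]

/-- The involution θ preserves each one-dimensional root space, so it acts there by 1 or by -1. -/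
theorem isNoncompactRoot_iff {α : Module.Dual ℂ A} (hα : α ∈ rootsOf A ⊤) :
    IsNoncompactRoot θ A α ↔ ¬ IsCompactRoot θ A α := by
  obtain ⟨h0, e, -, he0, he⟩ := hα
  constructor
  · intro h1 h2
    have h3 : e = -e := (h2 e he).symm.trans (h1 e he)
    have h4 : (2 : ℂ) • e = 0 := by
      rw [two_smul]; nth_rewrite 2 [h3]; exact add_neg_cancel e
    exact he0 ((smul_eq_zero.1 h4).resolve_left two_ne_zero)
  · intro h1
    obtain ⟨c, hc⟩ := exists_smul_of_mem_rootVec h0 he he0 (D.θ_mem_rootVec he)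
    have h2 := D.involution.involutive e
    rw [hc, map_smul, hc, smul_smul] at h2
    have h3 : (c * c - 1) • e = 0 := by rw [sub_smul, h2, one_smul, sub_self]
    have h4 : (c - 1) * (c + 1) = 0 := by
      have := (smul_eq_zero.1 h3).resolve_right he0
      linear_combination this
    rcases mul_eq_zero.1 h4 with h5 | h5
    · refine absurd (fun x hx => ?_) h1
      obtain ⟨d, rfl⟩ := exists_smul_of_mem_rootVec h0 he he0 hx
      rw [map_smul, hc, sub_eq_zero.1 h5, one_smul]
    · intro x hx
      obtain ⟨d, rfl⟩ := exists_smul_of_mem_rootVec h0 he he0 hx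
      rw [map_smul, hc, eq_neg_of_add_eq_zero_left h5, neg_one_smul, smul_neg]

/-- The decomposition P ⊕ σN is stable under A₀, so the components of a root vector are again root
vectors, and root spaces are lines. -/
theorem mem_stab_or {α : Module.Dual ℂ A} (h0 : α ≠ 0) {x : L} (hx : x ∈ rootVec A α) :
    x ∈ stab f v ∨ x ∈ stabOrthConj f σ v := by
  obtain ⟨p, hp, y, hy, rfl⟩ := D.exists_decomp x
  have key : ∀ b ∈ A₀, ∀ hb : b ∈ A, ⁅b, p⁆ = α ⟨b, hb⟩ • p := by
    intro b hb hbA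
    have h1 := hx ⟨b, hbA⟩
    rw [lie_add, smul_add] at h1
    have h2 : ⁅b, p⁆ - α ⟨b, hbA⟩ • p = α ⟨b, hbA⟩ • y - ⁅b, y⁆ := by
      rw [sub_eq_sub_iff_add_eq_add, h1, add_comm]
    have h3 : ⁅b, p⁆ - α ⟨b, hbA⟩ • p ∈ stab f v :=
      Submodule.sub_mem _ (lie_mem_stab (D.cartan_stab b hb) hp) (Submodule.smul_mem _ _ hp)
    have h4 : ⁅b, p⁆ - α ⟨b, hbA⟩ • p ∈ stabOrthConj f σ v := by
      rw [h2]
      refine Submodule.sub_mem _ (Submodule.smul_mem _ _ hy) ?_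
      change σ ⁅b, y⁆ ∈ stabOrth f v
      rw [D.conjugation.map_lie, D.fixed b hb]
      exact lie_mem_stabOrth (D.cartan_stab b hb) hy
    exact sub_eq_zero.1 (D.eq_zero_of_mem_stab_stabOrthConj h3 h4)
  have hpr : p ∈ rootVec A α := D.mem_rootVec_of key
  by_cases hp0 : p = 0
  · right; rw [hp0, zero_add]; exact hy
  · left
    obtain ⟨c, hc⟩ := exists_smul_of_mem_rootVec h0 hpr hp0 hx
    rw [hc]
    exact Submodule.smul_mem _ _ hp

theorem gamma_apply_rootVec {α : Module.Dual ℂ A} (h0 : α ≠ 0) {x : L} (hx : x ∈ rootVec A α) :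
    gammaForm ω τ (f x v) v = 0 := by
  rcases D.mem_stab_or h0 hx with h | h
  · obtain ⟨a, ha⟩ : ∃ a, α a ≠ 0 := by
      by_contra! hc
      exact h0 (LinearMap.ext hc)
    have h1 := lie_apply_eq_zero (f := f) (D.mem_stab a.2) h
    rw [hx a, map_smul, smul_apply] at h1
    rw [(smul_eq_zero.1 h1).resolve_left ha, map_zero, LinearMap.zero_apply]
  · exact D.gamma_apply_stabOrthConj h v

/-- If e and σe were both in P, then e would lie in H and α would be a root of H. -/
theorem exists_stabOrthConj {α : Module.Dual ℂ A} (hα : α ∈ rootsOf A ⊤) (hαH : α ∉ rootsOf A H) :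
    ∃ e, e ≠ 0 ∧ (e ∈ rootVec A α ∨ e ∈ rootVec A (-α)) ∧ e ∈ stabOrthConj f σ v := by
  obtain ⟨h0, e, -, he0, he⟩ := hα
  rcases D.mem_stab_or h0 he with h1 | h1
  · rcases D.mem_stab_or (neg_ne_zero.2 h0) (D.conj_mem_rootVec he) with h2 | h2
    · exact absurd ⟨h0, e, D.mem_H h1 h2, he0, he⟩ hαH
    · exact ⟨σ e, D.conj_ne_zero he0, Or.inr (D.conj_mem_rootVec he), h2⟩
  · exact ⟨e, he0, Or.inl he, h1⟩

theorem exists_weight_eq : ∃ Λ : Module.Dual ℂ A, ∀ a : A, f a v = Λ a • v := by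
  have hg := D.gamma_self_ne_zero
  refine ⟨{ toFun := fun a => gammaForm ω τ (f a v) v / gammaForm ω τ v v
            map_add' := fun x y => by
              change gammaForm ω τ (f ((x : L) + (y : L)) v) v / _ = _
              rw [map_add, add_apply, map_add, LinearMap.add_apply, add_div]
            map_smul' := fun c x => by
              change gammaForm ω τ (f (c • (x : L)) v) v / _ = _
              rw [map_smul, smul_apply, map_smul, LinearMap.smul_apply,
                smul_eq_mul, smul_eq_mul, mul_div_assoc]; rfl }, fun a => ?_⟩
  obtain ⟨c, hc⟩ := exists_char (D.mem_stab a.2)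
  rw [hc, LinearMap.coe_mk, AddHom.coe_mk, hc, map_smul, LinearMap.smul_apply, smul_eq_mul,
    mul_div_cancel_right₀ _ hg]

variable [FiniteDimensional ℂ V]

/-- Since σe kills v, γ(ev,ev) = -γ(v,[σe,e]v), and the bracket is K(σe,e) times the Killing dual of
-β. The vector v is primitive for -β, so its weight there is r ≥ 0; r = 0 would put e in P ∩ σN = 0.
-/
theorem gamma_apply_self {β : Module.Dual ℂ A} (h0 : β ∈ rootsOf A ⊤) {e : L}
    (he : e ∈ rootVec A β) (he0 : e ≠ 0) (hor : e ∈ stabOrthConj f σ v) :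
    ∃ r : ℝ, 0 < r ∧ (gammaForm ω τ (f e v) (f e v)).re =
      -(r * (killingForm ℂ L (σ e) e).re * (gammaForm ω τ v v).re) := by
  obtain ⟨Λ, hΛ⟩ := D.exists_weight_eq
  have hσe := D.conj_mem_rootVec he
  have hk : ∀ x ∈ rootVec A (-β), f x v = 0 := by
    intro x hx
    obtain ⟨c, rfl⟩ := exists_smul_of_mem_rootVec (neg_ne_zero.2 h0.1) hσe (D.conj_ne_zero he0) hx
    rw [map_smul, smul_apply, D.apply_eq_zero hor, smul_zero]
  obtain ⟨r, hr, hr', hr0⟩ := weight_cartanDual_nonneg f (neg_mem_rootsOf h0) D.ne_zero hΛ hk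
  have he' : e ∈ rootVec A (- -β) := by rwa [neg_neg]
  have hr1 : r ≠ 0 := by
    intro h
    refine he0 (D.eq_zero_of_mem_stab_stabOrthConj ?_ hor)
    change f e v ∈ Submodule.span ℂ {v}
    rw [hr0 h e he']
    exact Submodule.zero_mem _
  refine ⟨r, lt_of_le_of_ne hr hr1.symm, ?_⟩
  have h1 : f (σ e) (f e v) = (killingForm ℂ L (σ e) e * r) • v := by
    have h2 := rep_lie f (σ e) e v
    rw [D.apply_eq_zero hor, map_zero, sub_zero, lie_rootVec_neg hσe he', map_smul, smul_apply,
      hΛ, hr', smul_smul] at h2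
    exact h2.symm
  have hkr : conj (killingForm ℂ L (σ e) e) = killingForm ℂ L (σ e) e := by
    rw [← D.conjugation.killingForm, D.conjugation.involutive, LieModule.traceForm_comm]
  have hgr : conj (gammaForm ω τ v v) = gammaForm ω τ v v := D.herm v v
  rw [D.gamma_apply, h1, LinearMap.map_smulₛₗ, map_mul, Complex.conj_ofReal, hkr, smul_eq_mul,
    ← Complex.conj_eq_iff_re.1 hkr, ← Complex.conj_eq_iff_re.1 hgr]
  simp only [← Complex.ofReal_mul, ← Complex.ofReal_neg, Complex.ofReal_re]
  ring

/-- The Cartan subalgebra and the roots of H contribute only ℂv. For every other pair of opposite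
roots, one root vector is e and the other, σe, kills v. -/
theorem span_insert_eq_orbitTangent (hv : v ∈ orbitTangent f v) {S : Set (Module.Dual ℂ A)}
    (hS : ∀ β ∈ rootsOf A ⊤, β ∉ rootsOf A H → β ∈ S ∨ -β ∈ S) {e : Module.Dual ℂ A → L}
    (hS0 : ∀ α ∈ S, α ≠ 0) (he0 : ∀ α ∈ S, e α ≠ 0)
    (he : ∀ α ∈ S, e α ∈ rootVec A α ∨ e α ∈ rootVec A (-α))
    (hor : ∀ α ∈ S, e α ∈ stabOrthConj f σ v) :
    Submodule.span ℂ (insert v ((fun α => f (e α) v) '' S)) = orbitTangent f v := by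
  set T := Submodule.span ℂ (insert v ((fun α => f (e α) v) '' S)) with hT
  have hvT : v ∈ T := Submodule.subset_span (Set.mem_insert _ _)
  have hstab : ∀ x ∈ stab f v, f x v ∈ T := by
    intro x hx
    obtain ⟨c, hc⟩ := exists_char hx
    rw [hc]; exact T.smul_mem c hvT
  apply le_antisymm
  · rw [hT, Submodule.span_le]
    rintro _ (rfl | ⟨α, -, rfl⟩)
    · exact hv
    · exact ⟨e α, rfl⟩
  · let U : Submodule ℂ L :=
      { carrier := {x | f x v ∈ T}
        add_mem' := fun {x y} hx hy => by
          change f (x + y) v ∈ T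
          rw [map_add]; exact T.add_mem hx hy
        zero_mem' := by
          change f 0 v ∈ T
          rw [map_zero]; exact T.zero_mem
        smul_mem' := fun c x hx => by
          change f (c • x) v ∈ T
          rw [map_smul]; exact T.smul_mem c hx }
    have hU : U = ⊤ := by
      refine sup_rootVec_eq_top (A := A) (fun a ha => hstab a (D.mem_stab ha)) fun β hβ x hx => ?_
      by_cases hβH : β ∈ rootsOf A H
      · obtain ⟨h0, y, hyH, hy0, hy⟩ := hβH
        obtain ⟨c, rfl⟩ := exists_smul_of_mem_rootVec h0 hy hy0 hx
        exact hstab _ (Submodule.smul_mem _ _ (D.stab_of_mem_H hyH).1)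
      · have key : ∀ α ∈ S, (x ∈ rootVec A α ∨ x ∈ rootVec A (-α)) → x ∈ U := by
          intro α hα hx
          have h1 : f (e α) v ∈ T :=
            Submodule.subset_span (Set.mem_insert_of_mem _ ⟨α, hα, rfl⟩)
          have h2 : f (σ (e α)) v = 0 := D.apply_eq_zero (hor α hα)
          have h3 : e α ∈ U := h1
          have h4 : σ (e α) ∈ U := by
            change f (σ (e α)) v ∈ T
            rw [h2]; exact T.zero_mem
          have h5 : ∀ β : Module.Dual ℂ A, β ≠ 0 → ∀ y ∈ rootVec A β, y ≠ 0 → y ∈ U →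
              x ∈ rootVec A β → x ∈ U := by
            intro β hβ y hy hy0 hyU hx
            obtain ⟨c, rfl⟩ := exists_smul_of_mem_rootVec hβ hy hy0 hx
            exact U.smul_mem c hyU
          have h6 := D.conj_ne_zero (he0 α hα)
          have hα0 := hS0 α hα
          rcases he α hα with h | h
          · rcases hx with hx | hx
            · exact h5 α hα0 _ h (he0 α hα) h3 hx
            · exact h5 (-α) (neg_ne_zero.2 hα0) _ (D.conj_mem_rootVec h) h6 h4 hx
          · rcases hx with hx | hx
            · exact h5 α hα0 _ (D.conj_mem_rootVec' h) h6 h4 hx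
            · exact h5 (-α) (neg_ne_zero.2 hα0) _ h (he0 α hα) h3 hx
        rcases hS β hβ hβH with h | h
        · exact key β h (Or.inl hx)
        · exact key (-β) h (Or.inr (by rwa [neg_neg]))
    rintro _ ⟨x, rfl⟩
    have : x ∈ U := hU ▸ Submodule.mem_top
    exact this

/-- Moving x across γ leaves [σx,y]v paired with v, where the bracket has the nonzero weight β - α.
-/
theorem gamma_apply_apply_eq_zero {α β : Module.Dual ℂ A} {x y : L} (h : α ≠ β)
    (hx : x ∈ rootVec A α) (hy : y ∈ rootVec A β) (hor : x ∈ stabOrthConj f σ v) :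
    gammaForm ω τ (f x v) (f y v) = 0 := by
  have h1 : ⁅σ x, y⁆ ∈ rootVec A (-α + β) := by
    intro a
    rw [leibniz_lie, D.conj_mem_rootVec hx a, hy a, smul_lie, lie_smul, ← add_smul]; rfl
  have h2 := D.gamma_apply_rootVec (fun h0 => h (by rw [neg_add_eq_zero] at h0; exact h0)) h1
  rw [rep_lie, D.apply_eq_zero hor, map_zero, sub_zero] at h2
  rw [D.gamma_apply, D.herm.symm_zero h2, neg_zero]

theorem hasSignature (hv : v ∈ orbitTangent f v) {R R₀ : Set (Module.Dual ℂ A)}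
    (hR : IsPositiveSystem (rootsOf A ⊤) R) (hR₀ : IsPositiveSystem (rootsOf A H) R₀)
    (hRR : R₀ ⊆ R) :
    (0 < (gammaForm ω τ v v).re → HasSignature (gammaForm ω τ) (orbitTangent f v)
      ({α ∈ R \ R₀ | IsCompactRoot θ A α}.ncard + 1)
      {α ∈ R \ R₀ | IsNoncompactRoot θ A α}.ncard) ∧
    ((gammaForm ω τ v v).re < 0 → HasSignature (gammaForm ω τ) (orbitTangent f v)
      {α ∈ R \ R₀ | IsNoncompactRoot θ A α}.ncard
      ({α ∈ R \ R₀ | IsCompactRoot θ A α}.ncard + 1)) := by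
  classical
  set S := R \ R₀ with hSdef
  have hSR : ∀ α ∈ S, α ∈ rootsOf A ⊤ := fun α hα => hR.subset hα.1
  have hSH : ∀ α ∈ S, α ∉ rootsOf A H := by
    intro α hα h
    rcases hR₀.mem_or_neg_mem α h with h | h
    · exact hα.2 h
    · exact hR.neg_notMem α hα.1 (hRR h)
  -- One vector per pair of opposite roots, whichever lies in σN; values outside S are irrelevant.
  have hex : ∀ α, ∃ e, α ∈ S → e ≠ 0 ∧ (e ∈ rootVec A α ∨ e ∈ rootVec A (-α)) ∧
      e ∈ stabOrthConj f σ v := by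
    intro α
    by_cases hα : α ∈ S
    · obtain ⟨e, he⟩ := D.exists_stabOrthConj (hSR α hα) (hSH α hα)
      exact ⟨e, fun _ => he⟩
    · exact ⟨0, fun h => absurd h hα⟩
  choose e he using hex
  have hH : ∀ β, -β ∈ rootsOf A H → β ∈ rootsOf A H := by
    rintro β ⟨h0, x, hxH, hx0, hx⟩
    exact ⟨neg_ne_zero.1 h0, σ x, D.conj_mem_H hxH, D.conj_ne_zero hx0, D.conj_mem_rootVec' hx⟩
  have hS : ∀ β ∈ rootsOf A ⊤, β ∉ rootsOf A H → β ∈ S ∨ -β ∈ S := by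
    intro β hβ hβH
    rcases hR.mem_or_neg_mem β hβ with h | h
    · exact Or.inl ⟨h, fun h0 => hβH (hR₀.subset h0)⟩
    · exact Or.inr ⟨h, fun h0 => hβH (hH β (hR₀.subset h0))⟩
  have hfin : S.Finite := finite_rootsOf.subset hSR
  have hT := D.span_insert_eq_orbitTangent hv hS (fun α hα => (hSR α hα).1)
    (fun α hα => (he α hα).1) (fun α hα => (he α hα).2.1) (fun α hα => (he α hα).2.2)
  have hk : {α ∈ S | IsCompactRoot θ A α}.ncard =
      (hfin.toFinset.filter (IsCompactRoot θ A)).card := by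
    rw [← Set.ncard_coe_finset]
    congr 1; ext α; simp
  have hl : {α ∈ S | IsNoncompactRoot θ A α}.ncard =
      (hfin.toFinset.filter fun α => ¬ IsCompactRoot θ A α).card := by
    rw [← Set.ncard_coe_finset]
    congr 1; ext α
    simp only [Set.mem_ofPred_eq, Finset.coe_filter, Set.Finite.mem_toFinset]
    exact and_congr_right fun hα => D.isNoncompactRoot_iff (hSR α hα)
  have hwv : ∀ α ∈ S, gammaForm ω τ (f (e α) v) v = 0 := fun α hα =>
    D.gamma_apply_stabOrthConj (he α hα).2.2 v
  -- The chosen vectors have weights α or -α. Positivity keeps these signed weights distinct for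
  -- distinct roots.
  have hww : ∀ α ∈ S, ∀ β ∈ S, α ≠ β → gammaForm ω τ (f (e α) v) (f (e β) v) = 0 := by
    intro α hα β hβ hαβ
    have h1 : α ≠ -β := fun h => hR.neg_notMem β hβ.1 (h ▸ hα.1)
    have h2 : -α ≠ β := fun h => hR.neg_notMem α hα.1 (h ▸ hβ.1)
    rcases (he α hα).2.1 with ha | ha <;> rcases (he β hβ).2.1 with hb | hb
    · exact D.gamma_apply_apply_eq_zero hαβ ha hb (he α hα).2.2
    · exact D.gamma_apply_apply_eq_zero h1 ha hb (he α hα).2.2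
    · exact D.gamma_apply_apply_eq_zero h2 ha hb (he α hα).2.2
    · exact D.gamma_apply_apply_eq_zero (fun h => hαβ (neg_injective h)) ha hb (he α hα).2.2
  have hself : ∀ α ∈ S, ∃ r : ℝ, 0 < r ∧ (gammaForm ω τ (f (e α) v) (f (e α) v)).re =
      -(r * (killingForm ℂ L (σ (e α)) (e α)).re * (gammaForm ω τ v v).re) := by
    intro α hα
    rcases (he α hα).2.1 with ha | ha
    · exact D.gamma_apply_self (hSR α hα) ha (he α hα).1 (he α hα).2.2
    · exact D.gamma_apply_self (neg_mem_rootsOf (hSR α hα)) ha (he α hα).1 (he α hα).2.2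
  have hB : ∀ α ∈ S, (killingForm ℂ L (σ (e α)) (θ (e α))).re < 0 := fun α hα =>
    D.involution.killingForm_conj_neg D.conjugation (he α hα).1
  have hcomp : ∀ α ∈ S, IsCompactRoot θ A α → ∃ r : ℝ, 0 < r ∧
      (gammaForm ω τ (f (e α) v) (f (e α) v)).re = r * (gammaForm ω τ v v).re := by
    intro α hα hc
    have h1 : θ (e α) = e α := by
      rcases (he α hα).2.1 with ha | ha
      · exact hc _ ha
      · exact D.isCompactRoot_of hc ha
    have h2 := hB α hα
    rw [h1] at h2
    obtain ⟨r, hr, h3⟩ := hself α hα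
    exact ⟨-(r * (killingForm ℂ L (σ (e α)) (e α)).re),
      neg_pos.2 (mul_neg_of_pos_of_neg hr h2), by rw [h3]; ring⟩
  have hncomp : ∀ α ∈ S, ¬ IsCompactRoot θ A α → ∃ r : ℝ, 0 < r ∧
      (gammaForm ω τ (f (e α) v) (f (e α) v)).re = -(r * (gammaForm ω τ v v).re) := by
    intro α hα hc
    have hn := (D.isNoncompactRoot_iff (hSR α hα)).2 hc
    have h1 : θ (e α) = -e α := by
      rcases (he α hα).2.1 with ha | ha
      · exact hn _ ha
      · exact D.isNoncompactRoot_of hn ha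
    have h2 := hB α hα
    rw [h1, map_neg, Complex.neg_re, neg_lt_zero] at h2
    obtain ⟨r, hr, h3⟩ := hself α hα
    exact ⟨r * (killingForm ℂ L (σ (e α)) (e α)).re, mul_pos hr h2, by rw [h3]⟩
  have hT' : orbitTangent f v =
      Submodule.span ℂ (insert v ((fun α => f (e α) v) '' (hfin.toFinset : Set _))) := by
    rw [hfin.coe_toFinset, hT]
  rw [hk, hl, hT']
  have hm : ∀ {α}, α ∈ hfin.toFinset → α ∈ S := fun h => hfin.mem_toFinset.1 h
  constructor
  · intro hpos
    refine D.herm.hasSignature_span_insert hpos (IsCompactRoot θ A) hfin.toFinset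
      (fun α hα => hwv α (hm hα)) (fun α hα β hβ => hww α (hm hα) β (hm hβ))
      (fun α hα hc => ?_) (fun α hα hc => ?_)
    · obtain ⟨r, hr, h⟩ := hcomp α (hm hα) hc
      rw [h]; exact mul_pos hr hpos
    · obtain ⟨r, hr, h⟩ := hncomp α (hm hα) hc
      rw [h, neg_lt_zero]; exact mul_pos hr hpos
  · intro hneg
    -- The negative case is the positive one for -γ, followed by exchanging the indices.
    have := D.herm.neg.hasSignature_span_insert (v := v) (by simpa using hneg)
      (w := fun α => f (e α) v) (IsCompactRoot θ A) hfin.toFinset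
      (fun α hα => by simpa using hwv α (hm hα))
      (fun α hα β hβ h => by simpa using hww α (hm hα) β (hm hβ) h)
      (fun α hα hc => ?_) (fun α hα hc => ?_)
    · have h1 := this.neg D.herm.neg
      rwa [neg_neg] at h1
    · obtain ⟨r, hr, h⟩ := hcomp α (hm hα) hc
      rw [LinearMap.neg_apply, LinearMap.neg_apply, Complex.neg_re, h, neg_pos]
      exact mul_neg_of_pos_of_neg hr hneg
    · obtain ⟨r, hr, h⟩ := hncomp α (hm hα) hc
      rw [LinearMap.neg_apply, LinearMap.neg_apply, Complex.neg_re, h, neg_neg]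
      exact mul_neg_of_pos_of_neg hr hneg

end CartanData

end Cartan

/-! ### Relatively open subsets of complex submanifolds -/

section Submanifold

open Filter

variable {V : Type*} [NormedAddCommGroup V] [NormedSpace ℂ V]

omit [NormedSpace ℂ V] in
theorem nhdsWithin_eq_of_subset_of_mem {S C : Set V} {u : V} (h1 : S ⊆ C) (h2 : S ∈ 𝓝[C] u) :
    𝓝[S] u = 𝓝[C] u :=
  le_antisymm (nhdsWithin_mono _ h1) (nhdsWithin_le_iff.2 h2)

theorem tangentSpaceAt_eq_of_mem_nhdsWithin {S C : Set V} {u : V} (h1 : S ⊆ C)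
    (h2 : S ∈ 𝓝[C] u) : tangentSpaceAt S u = tangentSpaceAt C u := by
  rw [tangentSpaceAt, tangentSpaceAt,
    tangentConeAt_congr (nhdsWithin_eq_of_subset_of_mem h1 h2)]

theorem IsComplexSubmanifold.of_mem_nhdsWithin {S C : Set V} (hC : IsComplexSubmanifold C)
    (h1 : S ⊆ C) (h2 : ∀ u ∈ S, S ∈ 𝓝[C] u) : IsComplexSubmanifold S := by
  intro u hu
  obtain ⟨Φ, F, hus, ha, ha', hF⟩ := hC u (h1 hu)
  obtain ⟨W, hW, huW, hWC⟩ := mem_nhdsWithin.1 (h2 u hu)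
  refine ⟨Φ.restrOpen W hW, F, ⟨hus, huW⟩, ha.mono fun x hx => hx.1,
    ha'.mono fun x hx => hx.1, ?_⟩
  ext y
  constructor
  · rintro ⟨x, ⟨⟨hx, hxW⟩, hxS⟩, rfl⟩
    have h3 : Φ x ∈ Φ.target ∩ (F : Set V) := hF ▸ ⟨x, ⟨hx, h1 hxS⟩, rfl⟩
    refine ⟨?_, h3.2⟩
    exact (Φ.restrOpen W hW).map_source ⟨hx, hxW⟩
  · rintro ⟨hy, hyF⟩
    have h3 : y ∈ Φ '' (Φ.source ∩ C) := hF ▸ ⟨hy.1, hyF⟩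
    obtain ⟨x, ⟨hx, hxC⟩, rfl⟩ := h3
    have h4 := (Φ.restrOpen W hW).map_target hy
    have h5 : (Φ.restrOpen W hW).symm (Φ x) = x := Φ.left_inv hx
    rw [h5] at h4
    exact ⟨x, ⟨h4, hWC ⟨h4.2, hxC⟩⟩, rfl⟩

variable [FiniteDimensional ℂ V]

omit [FiniteDimensional ℂ V] in
theorem subset_tangentConeAt_of_submodule (F : Submodule ℂ V) {U : Set V} {y : V} (hy : y ∈ F)
    (hU : U ∈ 𝓝 y) : (F : Set V) ⊆ tangentConeAt ℂ (U ∩ F) y := by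
  intro w hw
  rw [Set.inter_comm, tangentConeAt_inter_nhds hU]
  have h1 : HasFDerivWithinAt (fun t : ℂ => y + t • w) (ContinuousLinearMap.toSpanSingleton ℂ w)
      Set.univ 0 :=
    (((ContinuousLinearMap.toSpanSingleton ℂ w).hasFDerivAt (x := 0)).const_add y).hasFDerivWithinAt
  have h2 := h1.mapsTo_tangent_cone
  rw [tangentConeAt_univ] at h2
  have h3 := h2 (Set.mem_univ (1 : ℂ))
  rw [zero_smul, add_zero, ContinuousLinearMap.toSpanSingleton_apply, one_smul] at h3
  refine tangentConeAt_mono ?_ h3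
  rintro _ ⟨t, -, rfl⟩
  exact F.add_mem hy (F.smul_mem t hw)

/-- A map into a complex submanifold whose differential is onto the tangent space is locally
onto. -/
theorem IsComplexSubmanifold.range_mem_nhdsWithin {C : Set V} (hC : IsComplexSubmanifold C)
    {E : Type*} [NormedAddCommGroup E] [NormedSpace ℝ E] [CompleteSpace E] {ψ : E → V}
    {ψ' : E →L[ℝ] V} {e : E} (hψ : HasStrictFDerivAt ψ ψ' e) (hψC : ∀ x, ψ x ∈ C)
    (hsurj : ∀ w ∈ tangentConeAt ℂ C (ψ e), ∃ x, ψ' x = w) : Set.range ψ ∈ 𝓝[C] (ψ e) := by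
  obtain ⟨Φ, F, hus, ha, ha', hF⟩ := hC (ψ e) (hψC e)
  have : CompleteSpace F := FiniteDimensional.complete ℂ F
  have hmem : ∀ x ∈ Φ.source, x ∈ C → Φ x ∈ F := fun x hx hxC => by
    have : Φ x ∈ Φ.target ∩ (F : Set V) := hF ▸ ⟨x, ⟨hx, hxC⟩, rfl⟩
    exact this.2
  obtain ⟨π₀, hπ₀⟩ := F.subtype.exists_leftInverse_of_injective F.ker_subtype
  let π : V →L[ℂ] F := LinearMap.toContinuousLinearMap π₀
  have hπ : ∀ y : F, π y = y := fun y => LinearMap.congr_fun hπ₀ y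
  have hΦ : HasStrictFDerivAt Φ (fderiv ℂ Φ (ψ e)) (ψ e) := (ha _ hus).hasStrictFDerivAt
  have hut : Φ (ψ e) ∈ Φ.target := Φ.map_source hus
  have hΦ' : HasFDerivAt Φ.symm (fderiv ℂ Φ.symm (Φ (ψ e))) (Φ (ψ e)) :=
    (ha' _ hut).differentiableAt.hasFDerivAt
  have hcomp : ∀ w, fderiv ℂ Φ (ψ e) (fderiv ℂ Φ.symm (Φ (ψ e)) w) = w := by
    have h1 : HasFDerivAt (Φ ∘ Φ.symm) ((fderiv ℂ Φ (ψ e)).comp (fderiv ℂ Φ.symm (Φ (ψ e))))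
        (Φ (ψ e)) := by
      refine HasFDerivAt.comp _ ?_ hΦ'
      rw [Φ.left_inv hus]
      exact hΦ.hasFDerivAt
    have h2 : HasFDerivAt (Φ ∘ Φ.symm) (ContinuousLinearMap.id ℂ V) (Φ (ψ e)) := by
      refine (hasFDerivAt_id _).congr_of_eventuallyEq ?_
      filter_upwards [Φ.open_target.mem_nhds hut] with y hy using Φ.right_inv hy
    intro w
    exact congrArg (fun T : V →L[ℂ] V => T w) (h1.unique h2)
  have hq : HasStrictFDerivAt (fun x => π (Φ (ψ x)))
      (((π.comp (fderiv ℂ Φ (ψ e))).restrictScalars ℝ).comp ψ') e :=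
    ((π.hasStrictFDerivAt.comp (ψ e) hΦ).restrictScalars ℝ).comp e hψ
  have honto : (((π.comp (fderiv ℂ Φ (ψ e))).restrictScalars ℝ).comp ψ').range = ⊤ := by
    rw [LinearMap.range_eq_top]
    intro w
    have h1 := subset_tangentConeAt_of_submodule F (hmem _ hus (hψC e))
      (Φ.open_target.mem_nhds hut) w.2
    have h2 := (hΦ'.hasFDerivWithinAt (s := Φ.target ∩ F)).mapsTo_tangent_cone h1
    rw [Φ.left_inv hus] at h2
    have h3 : Φ.symm '' (Φ.target ∩ F) ⊆ C := by
      rw [← hF]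
      rintro _ ⟨_, ⟨x, ⟨hx, hxC⟩, rfl⟩, rfl⟩
      rwa [Φ.left_inv hx]
    obtain ⟨x, hx⟩ := hsurj _ (tangentConeAt_mono h3 h2)
    refine ⟨x, ?_⟩
    change π (fderiv ℂ Φ (ψ e) (ψ' x)) = w
    rw [hx, hcomp, hπ]
  -- In the flattened chart, followed by a projection onto F, the map has surjective strict
  -- derivative and is therefore locally open; injectivity of the chart lifts this back to C.
  have hmap := hq.map_nhds_eq_of_surj honto
  have hN : ∀ᶠ x in 𝓝 e, ψ x ∈ Φ.source :=
    hψ.hasFDerivAt.continuousAt (Φ.open_source.mem_nhds hus)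
  have himg : (fun x => π (Φ (ψ x))) '' {x | ψ x ∈ Φ.source} ∈ 𝓝 (π (Φ (ψ e))) := by
    rw [← hmap]
    exact image_mem_map hN
  have hcont : Tendsto (fun y => π (Φ y)) (𝓝 (ψ e)) (𝓝 (π (Φ (ψ e)))) :=
    (π.continuous.continuousAt).comp (Φ.continuousAt hus)
  rw [mem_nhdsWithin_iff_eventually]
  filter_upwards [hcont himg, Φ.open_source.mem_nhds hus] with y hy hys hyC
  obtain ⟨x, hx, hxy⟩ := hy
  refine ⟨x, ?_⟩
  have h1 : Φ (ψ x) = Φ y := by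
    have h2 := hπ ⟨_, hmem _ hx (hψC x)⟩
    have h3 := hπ ⟨_, hmem _ hys hyC⟩
    have h4 := (h2.symm.trans hxy).trans h3
    exact congrArg Subtype.val h4
  exact Φ.injOn hx hys h1

-- The open set is the projection of a neighbourhood of S in V that meets C only in S. Its preimage
-- is a union of rescaled open sets, and conicity of C lets representatives be compared.
omit [FiniteDimensional ℂ V] in
theorem exists_isOpen_inter_projSet {S C : Set V} (hS : S ⊆ C) (hC : IsConic C)
    (h : ∀ u ∈ S, S ∈ 𝓝[C] u) {M : Set (ℙ ℂ V)} (hM : coneOver M = S) :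
    ∃ U : Set (ℙ ℂ V), IsOpen[projTopology V] U ∧ M = U ∩ projSet C := by
  choose! W hW huW hWC using fun u hu => mem_nhdsWithin.1 (h u hu)
  let W' := ⋃ u ∈ S, W u
  have hW' : IsOpen W' := isOpen_biUnion fun u hu => hW u hu
  have hWS : ∀ x ∈ W', x ∈ C → x ∈ S := by
    intro x hx hxC
    obtain ⟨u, hu, hxu⟩ := Set.mem_iUnion₂.1 hx
    exact hWC u hu ⟨hxu, hxC⟩
  refine ⟨projSet W', ?_, ?_⟩
  · rw [isOpen_coinduced]
    have : Projectivization.mk' ℂ ⁻¹' projSet W' =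
        ⋃ c : ℂˣ, {x : {v : V // v ≠ 0} | (c : ℂ) • (x : V) ∈ W'} := by
      ext x
      simp only [Set.mem_preimage, Set.mem_iUnion]
      constructor
      · rintro ⟨u, hu, huW, hux⟩
        obtain ⟨c, hc⟩ := (Projectivization.mk_eq_mk_iff ℂ _ _ hu x.2).1 hux
        refine ⟨c, ?_⟩
        change (c : ℂ) • (x : V) ∈ W'
        rw [show (c : ℂ) • (x : V) = u from hc]
        exact huW
      · rintro ⟨c, hc⟩
        exact ⟨_, smul_ne_zero c.ne_zero x.2, hc,
          (Projectivization.mk_eq_mk_iff ℂ _ _ _ x.2).2 ⟨c, rfl⟩⟩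
    rw [this]
    exact isOpen_iUnion fun c => hW'.preimage (continuous_subtype_val.const_smul (c : ℂ))
  · ext q
    constructor
    · intro hq
      induction q using Projectivization.ind with
      | h v hv =>
        have hvS : v ∈ S := hM ▸ ⟨hv, hq⟩
        exact ⟨⟨v, hv, Set.mem_iUnion₂.2 ⟨v, hvS, huW v hvS⟩, rfl⟩, ⟨v, hv, hS hvS, rfl⟩⟩
    · rintro ⟨⟨w, hw, hwW, rfl⟩, ⟨x, hx, hxC, hxw⟩⟩
      obtain ⟨c, hc⟩ := (Projectivization.mk_eq_mk_iff ℂ _ _ hw hx).1 hxw.symm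
      have h1 : w ∈ C := by
        rw [← hc]; exact hC c c.ne_zero x hxC
      have h2 : w ∈ coneOver M := hM ▸ hWS w hwW h1
      exact h2.2

end Submanifold

/-! ### Invariance of the forms -/

section Invariance

variable {m : ℕ} {L : LieSubalgebra ℂ (Matrix (Fin m) (Fin m) ℂ)}
variable {V : Type*} [NormedAddCommGroup V] [NormedSpace ℂ V] [FiniteDimensional ℂ V]

theorem hasDerivAt_exp_ofReal_smul (X : V →L[ℂ] V) (w : V) :
    HasDerivAt (fun t : ℝ => NormedSpace.exp ((t : ℂ) • X) w) (X w) 0 := by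
  have : CompleteSpace V := FiniteDimensional.complete ℂ V
  have h2 := hasDerivAt_exp_smul_const (𝕂 := ℂ) X (0 : ℂ)
  have h3 := (ContinuousLinearMap.apply ℂ V w).hasFDerivAt.comp_hasDerivAt (0 : ℂ) h2
  have h4 : HasDerivAt (fun t : ℂ => NormedSpace.exp (t • X) w) (X w) ((0 : ℝ) : ℂ) := by
    simpa [Function.comp_def] using h3
  have h5 := h4.scomp (0 : ℝ) Complex.ofRealCLM.hasDerivAt
  simpa [Function.comp_def] using h5

namespace HolomorphicRep

variable {ρ : HolomorphicRep L V}

theorem hasDerivAt_act (x : L) (w : V) :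
    HasDerivAt (fun t : ℝ => ρ.act (groupExp L ((t : ℂ) • x)) w) (ρ.diff x w) 0 := by
  simpa only [act_groupExp, map_smul] using hasDerivAt_exp_ofReal_smul (ρ.diff x) w

/-- Differentiate ω(exp(tx)u, w) = ω(u, exp(-tx)w) at t = 0. -/
theorem IsInvariantSymplectic.diff_apply {ω : LinearMap.BilinForm ℂ V}
    (hω : ρ.IsInvariantSymplectic ω) (x : L) (u w : V) :
    ω (ρ.diff x u) w = - ω u (ρ.diff x w) := by
  let φ : V →L[ℂ] ℂ := LinearMap.toContinuousLinearMap (ω.flip w)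
  let ψ : V →L[ℂ] ℂ := LinearMap.toContinuousLinearMap (ω u)
  have h1 : HasDerivAt (fun t : ℝ => ω (ρ.act (groupExp L ((t : ℂ) • x)) u) w)
      (ω (ρ.diff x u) w) 0 :=
    (φ.restrictScalars ℝ).hasFDerivAt.comp_hasDerivAt (0 : ℝ) (hasDerivAt_act x u)
  have h2 : HasDerivAt (fun t : ℝ => ω u (ρ.act (groupExp L ((t : ℂ) • -x)) w))
      (ω u (ρ.diff (-x) w)) 0 :=
    (ψ.restrictScalars ℝ).hasFDerivAt.comp_hasDerivAt (0 : ℝ) (hasDerivAt_act (-x) w)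
  have h3 : (fun t : ℝ => ω (ρ.act (groupExp L ((t : ℂ) • x)) u) w) =
      fun t : ℝ => ω u (ρ.act (groupExp L ((t : ℂ) • -x)) w) := by
    funext t
    rw [← hω.invariant (groupExp L ((t : ℂ) • x)) u]
    congr 1
    have : CompleteSpace V := FiniteDimensional.complete ℂ V
    rw [act_groupExp, act_groupExp, smul_neg, map_neg]
    have := exp_neg_mul_exp (-ρ.diff ((t : ℂ) • x))
    rw [neg_neg] at this
    exact (congrArg (fun T : V →L[ℂ] V => T w) this).symm
  rw [h3] at h1
  rw [h1.unique h2, map_neg, neg_apply, map_neg]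

/-- For x fixed by σ, differentiate the group invariance. The general case follows because both
sides are ℂ-linear in x, the antilinearities of σ and τ cancelling. -/
theorem diff_conj_apply {σ : L →ₛₗ[starRingEnd ℂ] L} (hσ : IsConjugation σ)
    {τ : V →ₛₗ[starRingEnd ℂ] V}
    (hτ : ∀ g ∈ realFormGroup L σ, ∀ x, ρ.act g (τ x) = τ (ρ.act g x)) (x : L) (w : V) :
    ρ.diff x (τ w) = τ (ρ.diff (σ x) w) := by
  have : FiniteDimensional ℝ V := FiniteDimensional.complexToReal V
  let τ₀ : V →ₗ[ℝ] V :=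
    { toFun := τ
      map_add' := map_add τ
      map_smul' := fun r y => by
        rw [← Complex.coe_smul, LinearMap.map_smulₛₗ, Complex.conj_ofReal, Complex.coe_smul]; rfl }
  let τ₁ : V →L[ℝ] V := LinearMap.toContinuousLinearMap τ₀
  have hreal : ∀ y : L, σ y = y → ρ.diff y (τ w) = τ (ρ.diff y w) := by
    intro y hy
    have h1 : HasDerivAt (fun t : ℝ => τ (ρ.act (groupExp L ((t : ℂ) • y)) w))
        (τ (ρ.diff y w)) 0 :=
      τ₁.hasFDerivAt.comp_hasDerivAt (0 : ℝ) (hasDerivAt_act y w)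
    have h2 := hasDerivAt_act (ρ := ρ) y (τ w)
    have h3 : (fun t : ℝ => ρ.act (groupExp L ((t : ℂ) • y)) (τ w)) =
        fun t : ℝ => τ (ρ.act (groupExp L ((t : ℂ) • y)) w) := by
      funext t
      refine hτ _ (Subgroup.subset_closure ⟨_, ?_, rfl⟩) w
      rw [LinearMap.map_smulₛₗ, Complex.conj_ofReal, hy]
    rw [h3] at h2
    exact h2.unique h1
  let a := x + σ x
  let b := Complex.I • (x - σ x)
  have ha : σ a = a := by simp only [a, map_add, hσ.involutive, add_comm]
  have hb : σ b = b := by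
    simp only [b]
    rw [LinearMap.map_smulₛₗ, map_sub, hσ.involutive, Complex.conj_I, neg_smul, ← smul_neg, neg_sub]
  have hab : (2 : ℂ) • x = a - Complex.I • b := by
    simp only [a, b]
    rw [smul_smul, Complex.I_mul_I, two_smul, neg_one_smul]
    abel
  have hab' : (2 : ℂ) • σ x = a + Complex.I • b := by
    simp only [a, b]
    rw [smul_smul, Complex.I_mul_I, two_smul, neg_one_smul]
    abel
  clear_value a b
  have key : (2 : ℂ) • ρ.diff x (τ w) = (2 : ℂ) • τ (ρ.diff (σ x) w) := by
    calc (2 : ℂ) • ρ.diff x (τ w) = ρ.diff ((2 : ℂ) • x) (τ w) := by rw [map_smul]; rfl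
      _ = ρ.diff a (τ w) - Complex.I • ρ.diff b (τ w) := by rw [hab, map_sub, map_smul]; rfl
      _ = τ (ρ.diff a w + Complex.I • ρ.diff b w) := by
        rw [hreal a ha, hreal b hb, map_add, LinearMap.map_smulₛₗ, Complex.conj_I, neg_smul,
          sub_eq_add_neg]
      _ = τ (ρ.diff ((2 : ℂ) • σ x) w) := by rw [hab', map_add ρ.diff, map_smul ρ.diff]; rfl
      _ = (2 : ℂ) • τ (ρ.diff (σ x) w) := by
        rw [map_smul, smul_apply, LinearMap.map_smulₛₗ, map_ofNat]
  exact smul_right_injective V (two_ne_zero (α := ℂ)) key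

omit [FiniteDimensional ℂ V] in
theorem gammaForm_act {σ : L →ₛₗ[starRingEnd ℂ] L} {ω : LinearMap.BilinForm ℂ V}
    (hω : ρ.IsInvariantSymplectic ω) {τ : V →ₛₗ[starRingEnd ℂ] V}
    (hτ : ∀ g ∈ realFormGroup L σ, ∀ x, ρ.act g (τ x) = τ (ρ.act g x)) {g : connGroup L}
    (hg : g ∈ realFormGroup L σ) (x y : V) :
    gammaForm ω τ (ρ.act g x) (ρ.act g y) = gammaForm ω τ x y := by
  rw [gammaForm_apply, gammaForm_apply, ← hτ g hg, hω.invariant]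

end HolomorphicRep

end Invariance

/-! ### The cone over the orbit of the real form -/

section RealOrbit

open Filter

variable {m : ℕ} {L : LieSubalgebra ℂ (Matrix (Fin m) (Fin m) ℂ)}
variable {V : Type*} [NormedAddCommGroup V] [NormedSpace ℂ V]

namespace HolomorphicRep

variable {ρ : HolomorphicRep L V} {σ : L →ₛₗ[starRingEnd ℂ] L}

theorem mem_coneOver_realOrbit {v : V} (hv : v ≠ 0) {u : V} :
    u ∈ coneOver (ρ.realOrbit σ (Projectivization.mk ℂ v hv)) ↔
      ∃ c : ℂ, c ≠ 0 ∧ ∃ g ∈ realFormGroup L σ, u = c • ρ.act g v := by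
  constructor
  · rintro ⟨hu, g, hg, h⟩
    rw [projAct_mk _ _ v hv (ρ.act_ne_zero g hv)] at h
    obtain ⟨c, hc⟩ := (Projectivization.mk_eq_mk_iff ℂ _ _ _ _).1 h
    exact ⟨c, c.ne_zero, g, hg, hc.symm⟩
  · rintro ⟨c, hc, g, hg, rfl⟩
    refine ⟨smul_ne_zero hc (ρ.act_ne_zero g hv), g, hg, ?_⟩
    rw [projAct_mk _ _ v hv (ρ.act_ne_zero g hv)]
    exact (Projectivization.mk_eq_mk_iff' ℂ _ _ _ _).2 ⟨c, rfl⟩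

variable {v : V} {S : Set V}

/-- `S` is the cone over the orbit of the line `ℂ v` under the real form. -/
def IsConeOverOrbit (ρ : HolomorphicRep L V) (σ : L →ₛₗ[starRingEnd ℂ] L) (v : V) (S : Set V) :
    Prop :=
  ∀ u, u ∈ S ↔ ∃ c : ℂ, c ≠ 0 ∧ ∃ g ∈ realFormGroup L σ, u = c • ρ.act g v

namespace IsConeOverOrbit

variable (hS : IsConeOverOrbit ρ σ v S)

include hS

theorem self_mem : v ∈ S :=
  (hS v).2 ⟨1, one_ne_zero, 1, one_mem _, by rw [act_one, one_smul]⟩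

theorem isConic : IsConic S := by
  intro c hc u hu
  obtain ⟨d, hd, g, hg, rfl⟩ := (hS u).1 hu
  exact (hS _).2 ⟨c * d, mul_ne_zero hc hd, g, hg, smul_smul _ _ _⟩

theorem act_mem {g : connGroup L} (hg : g ∈ realFormGroup L σ) {u : V} (hu : u ∈ S) :
    ρ.act g u ∈ S := by
  obtain ⟨d, hd, h, hh, rfl⟩ := (hS u).1 hu
  exact (hS _).2 ⟨d, hd, g * h, mul_mem hg hh, by rw [map_smul, act_mul]⟩

/-- Points of the orbit are joined to v by translated one-parameter curves, and scalars by the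
connected image of the complex exponential. -/
theorem isConnected [FiniteDimensional ℂ V] : IsConnected S := by
  have : CompleteSpace V := FiniteDimensional.complete ℂ V
  let _ : NormedAlgebra ℚ (V →L[ℂ] V) := NormedAlgebra.restrictScalars ℚ ℂ _
  refine ⟨⟨v, hS.self_mem⟩, isPreconnected_of_forall v fun u hu => ?_⟩
  have key : ∀ g ∈ realFormGroup L σ,
      ∃ t ⊆ S, v ∈ t ∧ ρ.act g v ∈ t ∧ IsPreconnected t := by
    intro g hg
    refine Subgroup.closure_induction (k := {g | ∃ x : L, σ x = x ∧ g = groupExp L x})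
      (p := fun g _ => ∃ t ⊆ S, v ∈ t ∧ ρ.act g v ∈ t ∧ IsPreconnected t) ?_ ?_ ?_ ?_ hg
    · rintro _ ⟨x, hx, rfl⟩
      refine ⟨Set.range fun t : ℝ => ρ.act (groupExp L ((t : ℂ) • x)) v, ?_, ⟨0, ?_⟩, ⟨1, ?_⟩, ?_⟩
      · rintro _ ⟨t, rfl⟩
        refine hS.act_mem (Subgroup.subset_closure ⟨_, ?_, rfl⟩) hS.self_mem
        rw [LinearMap.map_smulₛₗ, Complex.conj_ofReal, hx]
      · simp [act_groupExp, NormedSpace.exp_zero]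
      · simp
      · refine isPreconnected_range ?_
        simp only [act_groupExp, map_smul]
        exact ((ContinuousLinearMap.apply ℂ V v).continuous).comp
          (NormedSpace.exp_continuous.comp
            (Complex.continuous_ofReal.smul continuous_const))
    · exact ⟨{v}, by simpa using hS.self_mem, rfl, by rw [act_one]; rfl, isPreconnected_singleton⟩
    · rintro g h hg hh ⟨t, ht, hvt, hgt, htc⟩ ⟨s, hs, hvs, hhs, hsc⟩
      refine ⟨t ∪ ρ.act g '' s, Set.union_subset ht ?_, Or.inl hvt, Or.inr ⟨_, hhs, ?_⟩, ?_⟩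
      · rintro _ ⟨w, hw, rfl⟩
        exact hS.act_mem hg (hs hw)
      · rw [act_mul]
      · exact IsPreconnected.union (ρ.act g v) hgt ⟨v, hvs, rfl⟩ htc
          (hsc.image _ (ρ.act g).continuous.continuousOn)
    · rintro g hg ⟨t, ht, hvt, hgt, htc⟩
      refine ⟨ρ.act g⁻¹ '' t, ?_, ⟨_, hgt, act_inv_act _ _ _⟩, ⟨v, hvt, rfl⟩,
        htc.image _ (ρ.act g⁻¹).continuous.continuousOn⟩
      rintro _ ⟨w, hw, rfl⟩
      exact hS.act_mem (inv_mem hg) (ht hw)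
  obtain ⟨c, hc, g, hg, rfl⟩ := (hS u).1 hu
  obtain ⟨t, ht, hvt, hgt, htc⟩ := key g hg
  refine ⟨t ∪ Set.range fun z : ℂ => Complex.exp z • ρ.act g v, Set.union_subset ht ?_,
    Or.inl hvt, Or.inr ⟨Complex.log c, ?_⟩, ?_⟩
  · rintro _ ⟨z, rfl⟩
    exact hS.isConic _ (Complex.exp_ne_zero z) _ (hS.act_mem hg hS.self_mem)
  · simp only [Complex.exp_log hc]
  · exact IsPreconnected.union (ρ.act g v) hgt ⟨0, by simp⟩ htc
      (isPreconnected_range (Complex.continuous_exp.smul continuous_const))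

theorem subset {C : Set V} (hC : IsConic C) (hact : ∀ g, ∀ u ∈ C, ρ.act g u ∈ C) (hv : v ∈ C) :
    S ⊆ C := by
  intro u hu
  obtain ⟨c, hc, g, -, rfl⟩ := (hS u).1 hu
  exact hC c hc _ (hact g v hv)

theorem mem_nhdsWithin {C : Set V} (hC : IsConic C) (hact : ∀ g, ∀ u ∈ C, ρ.act g u ∈ C)
    (h : S ∈ 𝓝[C] v) {u : V} (hu : u ∈ S) : S ∈ 𝓝[C] u := by
  obtain ⟨c, hc, g, hg, rfl⟩ := (hS u).1 hu
  have h1 : ρ.act g⁻¹ (c⁻¹ • c • ρ.act g v) = v := by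
    rw [inv_smul_smul₀ hc, act_inv_act]
  have h2 : Tendsto (fun x => ρ.act g⁻¹ (c⁻¹ • x)) (𝓝[C] (c • ρ.act g v)) (𝓝[C] v) := by
    refine tendsto_nhdsWithin_iff.2 ⟨?_, ?_⟩
    · have h3 : ContinuousAt (fun x => ρ.act g⁻¹ (c⁻¹ • x)) (c • ρ.act g v) :=
        ((ρ.act g⁻¹).continuous.comp (continuous_const_smul c⁻¹)).continuousAt
      have h4 := h3.tendsto
      rw [h1] at h4
      exact h4.mono_left nhdsWithin_le_nhds
    · filter_upwards [self_mem_nhdsWithin] with x hx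
      exact hact _ _ (hC _ (inv_ne_zero hc) _ hx)
  filter_upwards [h2 h] with x hx
  have h3 := hS.isConic c hc _ (hS.act_mem hg hx)
  rwa [act_act_inv, smul_inv_smul₀ hc] at h3

variable [FiniteDimensional ℂ V]

theorem mem_nhdsWithin_self {C : Set V} (hC : IsComplexSubmanifold C) (hSC : S ⊆ C)
    (h : ∀ w ∈ tangentConeAt ℂ C v, ∃ c : ℂ, ∃ x : L, σ x = x ∧ w = c • v + ρ.diff x v) :
    S ∈ 𝓝[C] v := by
  have : CompleteSpace V := FiniteDimensional.complete ℂ V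
  let _ : NormedAlgebra ℚ (V →L[ℂ] V) := NormedAlgebra.restrictScalars ℚ ℂ _
  have : FiniteDimensional ℝ (V →L[ℂ] V) := FiniteDimensional.complexToReal _
  -- Scalars together with the real form. On W the map w ↦ exp(w)v lands in S, and its derivative at
  -- 0 is evaluation at v, so the hypothesis is exactly surjectivity onto the tangent cone.
  let W : Submodule ℝ (V →L[ℂ] V) :=
    { carrier := {w | ∃ c : ℂ, ∃ x : L, σ x = x ∧ w = c • 1 + ρ.diff x}
      add_mem' := by
        rintro _ _ ⟨c, x, hx, rfl⟩ ⟨d, y, hy, rfl⟩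
        refine ⟨c + d, x + y, by rw [map_add, hx, hy], ?_⟩
        rw [map_add, add_smul]; abel
      zero_mem' := ⟨0, 0, map_zero _, by rw [map_zero, zero_smul, add_zero]⟩
      smul_mem' := by
        rintro r _ ⟨c, x, hx, rfl⟩
        refine ⟨r * c, (r : ℂ) • x, by rw [LinearMap.map_smulₛₗ, Complex.conj_ofReal, hx], ?_⟩
        rw [map_smul, mul_smul, ← smul_add, Complex.coe_smul] }
  have : CompleteSpace W := FiniteDimensional.complete ℝ W
  let ψ : W → V := fun w => NormedSpace.exp (w : V →L[ℂ] V) v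
  let ev : (V →L[ℂ] V) →L[ℝ] V := (ContinuousLinearMap.apply ℂ V v).restrictScalars ℝ
  have hψS : ∀ w, ψ w ∈ S := by
    rintro ⟨_, c, x, hx, rfl⟩
    have h1 : NormedSpace.exp (c • (1 : V →L[ℂ] V) + ρ.diff x) =
        Complex.exp c • NormedSpace.exp (ρ.diff x) := by
      rw [NormedSpace.exp_add_of_commute ((Commute.one_left _).smul_left c)]
      have h2 : NormedSpace.exp (c • (1 : V →L[ℂ] V)) = Complex.exp c • 1 := by
        rw [← Algebra.algebraMap_eq_smul_one, ← Algebra.algebraMap_eq_smul_one,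
          Complex.exp_eq_exp_ℂ, NormedSpace.algebraMap_exp_comm]
      rw [h2, smul_one_mul]
    refine (hS _).2 ⟨Complex.exp c, Complex.exp_ne_zero c, groupExp L x,
      Subgroup.subset_closure ⟨x, hx, rfl⟩, ?_⟩
    change NormedSpace.exp (c • (1 : V →L[ℂ] V) + ρ.diff x) v = _
    rw [h1, act_groupExp]; rfl
  have hψ0 : ψ 0 = v := by
    change NormedSpace.exp ((0 : W) : V →L[ℂ] V) v = v
    rw [ZeroMemClass.coe_zero, NormedSpace.exp_zero]; rfl
  have hψ : HasStrictFDerivAt ψ (ev.comp W.subtypeL) 0 := by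
    have h1 : HasStrictFDerivAt (NormedSpace.exp : (V →L[ℂ] V) → V →L[ℂ] V)
        (1 : (V →L[ℂ] V) →L[ℝ] (V →L[ℂ] V)) (W.subtypeL 0) := by
      rw [map_zero]
      exact hasStrictFDerivAt_exp_zero
    exact ev.hasStrictFDerivAt.comp (0 : W) (h1.comp (0 : W) W.subtypeL.hasStrictFDerivAt)
  have h1 := hC.range_mem_nhdsWithin hψ (fun w => hSC (hψS w)) (by
    rw [hψ0]
    intro w hw
    obtain ⟨c, x, hx, rfl⟩ := h w hw
    exact ⟨⟨_, c, x, hx, rfl⟩, rfl⟩)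
  rw [hψ0] at h1
  refine mem_of_superset h1 ?_
  rintro _ ⟨w, rfl⟩
  exact hψS w

end IsConeOverOrbit

end HolomorphicRep

end RealOrbit

/-! ### The special cone over the orbit -/

section SpecialCone

variable {m : ℕ} {L : LieSubalgebra ℂ (Matrix (Fin m) (Fin m) ℂ)} [LieAlgebra.IsKilling ℂ L]
variable {V : Type*} [NormedAddCommGroup V] [NormedSpace ℂ V] [FiniteDimensional ℂ V]
variable {ρ : HolomorphicRep L V} {ω : LinearMap.BilinForm ℂ V} {C : Set V}
  {σ : L →ₛₗ[starRingEnd ℂ] L} {τ : V →ₛₗ[starRingEnd ℂ] V} {H : LieSubalgebra ℂ L}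

namespace HolomorphicRep

theorem IsHighestWeightOrbit.realFormData (hC : ρ.IsHighestWeightOrbit C) (hirr : ρ.IsIrred)
    (hω : ρ.IsInvariantSymplectic ω) (hσ : IsConjugation σ) (hτ : IsCompatibleRealStructure ω τ)
    (hτinv : ∀ g ∈ realFormGroup L σ, ∀ x, ρ.act g (τ x) = τ (ρ.act g x)) {v : V} (hv : v ≠ 0)
    (hvC : v ∈ C) (hK : IsCompact (ρ.realStab σ (Projectivization.mk ℂ v hv))) :
    RealFormData ρ.diff σ ω τ v where
  irr := hirr.isIrredRep
  conjugation := hσ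
  real := hτ
  alt := hω.alt
  nondegenerate := hω.nondegenerate
  invariant := hω.diff_apply
  comm := diff_conj_apply hσ hτinv
  ne_zero := hv
  neg _ hx hxv hx0 := killingForm_re_neg hK ⟨hx, (mem_stabAlgebra_mk hv).2 hxv⟩ hx0
  orth _ hx := hC.apply_eq_zero_of_orthogonal hvC hx

omit [FiniteDimensional ℂ V] [LieAlgebra.IsKilling ℂ L] in
theorem orbitTangent_smul {f : L →ₗ⁅ℂ⁆ (V →L[ℂ] V)} {c : ℂ} (hc : c ≠ 0) (v : V) :
    orbitTangent f (c • v) = orbitTangent f v := by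
  ext w
  constructor
  · rintro ⟨x, rfl⟩
    exact ⟨c • x, by rw [map_smul, map_smul]; rfl⟩
  · rintro ⟨x, rfl⟩
    refine ⟨c⁻¹ • x, ?_⟩
    rw [map_smul, map_smul, smul_apply, smul_inv_smul₀ hc]

omit [LieAlgebra.IsKilling ℂ L] in
theorem map_act_orbitTangent (g : connGroup L) (v : V) :
    (orbitTangent ρ.diff v).map (ρ.act g : V →ₗ[ℂ] V) = orbitTangent ρ.diff (ρ.act g v) := by
  ext w
  constructor
  · rintro ⟨x, hx, rfl⟩
    exact act_orbitTangent g hx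
  · intro hw
    have h1 := act_orbitTangent g⁻¹ hw
    rw [act_inv_act] at h1
    exact ⟨_, h1, act_act_inv _ _ _⟩

omit [FiniteDimensional ℂ V] [LieAlgebra.IsKilling ℂ L] in
theorem gammaForm_smul_act (hω : ρ.IsInvariantSymplectic ω)
    (hτ : ∀ g ∈ realFormGroup L σ, ∀ x, ρ.act g (τ x) = τ (ρ.act g x)) {g : connGroup L}
    (hg : g ∈ realFormGroup L σ) (c : ℂ) (v : V) :
    gammaForm ω τ (c • ρ.act g v) (c • ρ.act g v) =
      ((Complex.normSq c : ℝ) : ℂ) * gammaForm ω τ v v := by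
  rw [LinearMap.map_smulₛₗ, LinearMap.map_smul, LinearMap.smul_apply, gammaForm_act hω hτ hg, smul_eq_mul,
    smul_eq_mul, ← mul_assoc, mul_comm (conj c), Complex.mul_conj]

omit [LieAlgebra.IsKilling ℂ L] in
theorem hasSignature_orbitTangent_act (hω : ρ.IsInvariantSymplectic ω)
    (hτ : ∀ g ∈ realFormGroup L σ, ∀ x, ρ.act g (τ x) = τ (ρ.act g x)) {g : connGroup L}
    (hg : g ∈ realFormGroup L σ) {c : ℂ} (hc : c ≠ 0) {v : V} {a b : ℕ}
    (h : HasSignature (gammaForm ω τ) (orbitTangent ρ.diff v) a b) :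
    HasSignature (gammaForm ω τ) (orbitTangent ρ.diff (c • ρ.act g v)) a b := by
  rw [orbitTangent_smul hc, ← map_act_orbitTangent]
  refine h.map _ (fun x _ y _ hxy => ?_) one_pos fun x _ y _ => ?_
  · have h1 := congrArg (ρ.act g⁻¹) hxy
    simpa [act_inv_act] using h1
  · rw [Complex.ofReal_one, one_mul]
    exact gammaForm_act hω hτ hg x y

omit [LieAlgebra.IsKilling ℂ L] in
theorem nondegenerate_orbitTangent_act (hω : ρ.IsInvariantSymplectic ω)
    (hτ : ∀ g ∈ realFormGroup L σ, ∀ x, ρ.act g (τ x) = τ (ρ.act g x)) {g : connGroup L}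
    (hg : g ∈ realFormGroup L σ) {c : ℂ} (hc : c ≠ 0) {v : V}
    (h : ∀ x ∈ orbitTangent ρ.diff v, (∀ y ∈ orbitTangent ρ.diff v, gammaForm ω τ x y = 0) →
      x = 0) :
    ∀ x ∈ orbitTangent ρ.diff (c • ρ.act g v),
      (∀ y ∈ orbitTangent ρ.diff (c • ρ.act g v), gammaForm ω τ x y = 0) → x = 0 := by
  rw [orbitTangent_smul hc, ← map_act_orbitTangent]
  rintro _ ⟨x, hx, rfl⟩ h0
  have h1 := h x hx fun y hy => by
    rw [← gammaForm_act hω hτ hg]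
    exact h0 _ ⟨y, hy, rfl⟩
  rw [h1, map_zero]

end HolomorphicRep

-- Split the acting element along P ⊕ σN: the P-part gives a multiple of v, and y ∈ σN may be
-- replaced by the real element y + σy because σy kills v.
omit [FiniteDimensional ℂ V] in
theorem RealFormData.exists_real_of_mem_orbitTangent {f : L →ₗ⁅ℂ⁆ (V →L[ℂ] V)} {v : V}
    (D : RealFormData f σ ω τ v) {w : V} (hw : w ∈ orbitTangent f v) :
    ∃ c : ℂ, ∃ x : L, σ x = x ∧ w = c • v + f x v := by
  obtain ⟨x, rfl⟩ := hw
  obtain ⟨p, hp, y, hy, rfl⟩ := D.exists_decomp x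
  obtain ⟨c, hc⟩ := RealFormData.exists_char hp
  refine ⟨c, y + σ y, by rw [map_add, D.conjugation.involutive, add_comm], ?_⟩
  rw [map_add, map_add, add_apply, add_apply, hc, D.apply_eq_zero hy, add_zero]

end SpecialCone


/-! ### Assembly: openness, special cone and signatures -/

theorem mainTheorem10 {m : ℕ} (L : LieSubalgebra ℂ (Matrix (Fin m) (Fin m) ℂ))
    [LieAlgebra.IsSemisimple ℂ L]
    {V : Type*} [NormedAddCommGroup V] [NormedSpace ℂ V] [FiniteDimensional ℂ V]
    (ρ : HolomorphicRep L V) (hirr : ρ.IsIrred)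
    (ω : LinearMap.BilinForm ℂ V) (hω : ρ.IsInvariantSymplectic ω)
    -- the Lagrangian highest weight vector orbit
    (C : Set V)
    (hC : ∃ v₀ : V, ρ.IsHighestWeightVector v₀ ∧ C = Set.range fun g => ρ.act g v₀)
    (hLag : IsLagrangian ω C)
    -- the real form and the invariant real structure
    (σ : L →ₛₗ[starRingEnd ℂ] L) (hσ : IsConjugation σ)
    (τ : V →ₛₗ[starRingEnd ℂ] V) (hτ : IsCompatibleRealStructure ω τ)
    (hτinv : ∀ g ∈ realFormGroup L σ, ∀ x, ρ.act g (τ x) = τ (ρ.act g x))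
    -- the base point and its stabilizer
    (p : ℙ ℂ V) (hp : p ∈ projSet C)
    (H : LieSubalgebra ℂ L) (hH : ρ.IsCompactFormOfLevi σ p H) :
    -- the orbit `M` is open in `P(C)`
    (∃ U : Set (ℙ ℂ V), IsOpen[projTopology V] U ∧ ρ.realOrbit σ p = U ∩ projSet C) ∧
    -- the cone over `M` is special
    IsSpecialCone ω τ (coneOver (ρ.realOrbit σ p)) ∧
    -- the signature of `γ` and of the metric in terms of compact and noncompact roots
    (∀ (A₀ : Submodule ℝ L) (A : LieSubalgebra ℂ L), (A₀ : Set L) ⊆ ρ.realStabAlgebra σ p →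
      Submodule.span ℂ (A₀ : Set L) = A.toSubmodule → A.IsCartanSubalgebra →
      ∀ Rpos R₀pos : Set (Module.Dual ℂ A),
      IsPositiveSystem (rootsOf A ⊤) Rpos → IsPositiveSystem (rootsOf A H) R₀pos →
      R₀pos ⊆ Rpos →
      ∀ θ : L ≃ₗ⁅ℂ⁆ L, IsCartanInvolution σ θ → (∀ x ∈ A₀, θ x = x) →
      ∀ k l : ℕ, k = {α ∈ Rpos \ R₀pos | IsCompactRoot θ A α}.ncard →
      l = {α ∈ Rpos \ R₀pos | IsNoncompactRoot θ A α}.ncard →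
      (∀ (v : V) (hv : v ≠ 0), Projectivization.mk ℂ v hv = p →
        (0 < (gammaForm ω τ v v).re ∧ ∀ u ∈ coneOver (ρ.realOrbit σ p),
          HasSignature (gammaForm ω τ) (tangentSpaceAt (coneOver (ρ.realOrbit σ p)) u)
            (k + 1) l) ∨
        ((gammaForm ω τ v v).re < 0 ∧ ∀ u ∈ coneOver (ρ.realOrbit σ p),
          HasSignature (gammaForm ω τ) (tangentSpaceAt (coneOver (ρ.realOrbit σ p)) u)
            l (k + 1))) ∧
      (∀ u ∈ coneOver (ρ.realOrbit σ p),
        HasSignature (projForm (gammaForm ω τ) u)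
          ((tangentSpaceAt (coneOver (ρ.realOrbit σ p)) u).map
            (Submodule.span ℂ {u}).mkQ) k l)) ∧
    -- the signature of the metric in terms of the signature of `γ`
    (∀ a b : ℕ,
      (∀ u ∈ coneOver (ρ.realOrbit σ p),
        HasSignature (gammaForm ω τ) (tangentSpaceAt (coneOver (ρ.realOrbit σ p)) u) a b) →
      ∀ (v : V) (hv : v ≠ 0), Projectivization.mk ℂ v hv = p →
      (0 < (gammaForm ω τ v v).re → 1 ≤ a ∧ ∀ u ∈ coneOver (ρ.realOrbit σ p),
        HasSignature (projForm (gammaForm ω τ) u)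
          ((tangentSpaceAt (coneOver (ρ.realOrbit σ p)) u).map
            (Submodule.span ℂ {u}).mkQ) (a - 1) b) ∧
      ((gammaForm ω τ v v).re < 0 → 1 ≤ b ∧ ∀ u ∈ coneOver (ρ.realOrbit σ p),
        HasSignature (projForm (gammaForm ω τ) u)
          ((tangentSpaceAt (coneOver (ρ.realOrbit σ p)) u).map
            (Submodule.span ℂ {u}).mkQ) (b - 1) a)) := by
  have hK : LieAlgebra.IsKilling ℂ L := inferInstance
  have hC' : ρ.IsHighestWeightOrbit C := hC
  have hdim := finrank_ne_one_of_symplectic hω.alt hω.nondegenerate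
  have hconic := hC'.isConic hirr hdim
  have hact : ∀ g, ∀ u ∈ C, ρ.act g u ∈ C := fun g u hu => hC'.act_mem g hu
  have hherm := gammaForm_isHermForm hω.alt hτ
  have hvC : ∀ (v : V) (hv : v ≠ 0), Projectivization.mk ℂ v hv = p → v ∈ C := by
    intro v hv hvp
    obtain ⟨u, hu, huC, hup⟩ := hp
    obtain ⟨c, hc⟩ := (Projectivization.mk_eq_mk_iff ℂ _ _ hv hu).1 (hvp.trans hup.symm)
    rw [← hc]
    exact hconic c c.ne_zero u huC
  have hcone : ∀ (v : V) (hv : v ≠ 0), Projectivization.mk ℂ v hv = p →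
      ρ.IsConeOverOrbit σ v (coneOver (ρ.realOrbit σ p)) := by
    rintro v hv rfl u
    exact HolomorphicRep.mem_coneOver_realOrbit hv
  have hdata : ∀ (v : V) (hv : v ≠ 0), Projectivization.mk ℂ v hv = p →
      RealFormData ρ.diff σ ω τ v := by
    rintro v hv rfl
    exact hC'.realFormData hirr hω hσ hτ hτinv hv (hvC v hv rfl) hH.compact
  obtain ⟨v₀, hv₀, hv₀p⟩ : ∃ (v : V) (hv : v ≠ 0), Projectivization.mk ℂ v hv = p := by
    obtain ⟨u, hu, -, hup⟩ := hp
    exact ⟨u, hu, hup⟩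
  generalize hS' : coneOver (ρ.realOrbit σ p) = S at hcone ⊢
  have hS := hcone v₀ hv₀ hv₀p
  have hSC : S ⊆ C := hS.subset hconic hact (hvC v₀ hv₀ hv₀p)
  -- Relative openness in C at the base point spreads by homogeneity, and with it charts, tangent
  -- spaces and the Lagrangian property pass from C to the cone.
  have hnhds : ∀ u ∈ S, S ∈ 𝓝[C] u := fun u hu => hS.mem_nhdsWithin hconic hact
    (hS.mem_nhdsWithin_self hLag.submanifold hSC fun w hw => by
      rw [hC'.tangentConeAt_eq hirr hdim (hvC v₀ hv₀ hv₀p)] at hw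
      exact (hdata v₀ hv₀ hv₀p).exists_real_of_mem_orbitTangent hw) hu
  have hTC : ∀ u ∈ S, tangentSpaceAt S u = tangentSpaceAt C u := fun u hu =>
    tangentSpaceAt_eq_of_mem_nhdsWithin hSC (hnhds u hu)
  have hT : ∀ u ∈ S, tangentSpaceAt S u = orbitTangent ρ.diff u := fun u hu =>
    (hTC u hu).trans (hC'.tangentSpaceAt_eq hirr hdim (hSC hu))
  have hself : ∀ u ∈ S, u ∈ tangentSpaceAt S u := fun u hu => by
    rw [hT u hu]
    exact hC'.self_mem_orbitTangent hirr hdim (hSC hu)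
  have hpos : ∀ (v : V) (hv : v ≠ 0), Projectivization.mk ℂ v hv = p →
      0 < (gammaForm ω τ v v).re → ∀ u ∈ S, 0 < (gammaForm ω τ u u).re := by
    intro v hv hvp h u hu
    obtain ⟨c, hc, g, hg, rfl⟩ := (hcone v hv hvp u).1 hu
    rw [HolomorphicRep.gammaForm_smul_act hω hτinv hg, Complex.re_ofReal_mul]
    exact mul_pos (Complex.normSq_pos.2 hc) h
  have hneg : ∀ (v : V) (hv : v ≠ 0), Projectivization.mk ℂ v hv = p →
      (gammaForm ω τ v v).re < 0 → ∀ u ∈ S, (gammaForm ω τ u u).re < 0 := by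
    intro v hv hvp h u hu
    obtain ⟨c, hc, g, hg, rfl⟩ := (hcone v hv hvp u).1 hu
    rw [HolomorphicRep.gammaForm_smul_act hω hτinv hg, Complex.re_ofReal_mul]
    exact mul_neg_of_pos_of_neg (Complex.normSq_pos.2 hc) h
  refine ⟨exists_isOpen_inter_projSet hSC hconic hnhds hS', ?_, ?_, ?_⟩
  · refine ⟨hS.isConic, ⟨hLag.submanifold.of_mem_nhdsWithin hSC hnhds, hS.isConnected, ?_, ?_⟩,
      ?_, ?_⟩
    · intro u hu
      rw [hTC u hu]
      exact hLag.isotropic u (hSC hu)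
    · intro u hu
      rw [hTC u hu]
      exact hLag.half_dim u (hSC hu)
    · intro u hu
      rw [hT u hu]
      have h1 := (hdata v₀ hv₀ hv₀p).gamma_nondegenerate
        (hC'.self_mem_orbitTangent hirr hdim (hvC v₀ hv₀ hv₀p))
        (by
          rw [← hC'.tangentSpaceAt_eq hirr hdim (hvC v₀ hv₀ hv₀p)]
          exact hLag.isotropic v₀ (hvC v₀ hv₀ hv₀p))
        (by
          rw [← hC'.tangentSpaceAt_eq hirr hdim (hvC v₀ hv₀ hv₀p)]
          exact hLag.half_dim v₀ (hvC v₀ hv₀ hv₀p))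
      obtain ⟨c, hc, g, hg, rfl⟩ := (hS u).1 hu
      exact HolomorphicRep.nondegenerate_orbitTangent_act hω hτinv hg hc h1
    · intro u hu
      obtain ⟨c, hc, g, hg, rfl⟩ := (hS u).1 hu
      rw [HolomorphicRep.gammaForm_smul_act hω hτinv hg]
      exact mul_ne_zero (Complex.ofReal_ne_zero.2 (Complex.normSq_pos.2 hc).ne')
        (hdata v₀ hv₀ hv₀p).gamma_self_ne_zero
  · intro A₀ A hA₀ hspan hA Rpos R₀pos hR hR₀ hRR θ hθ hθA k l hk hl
    have hsig : ∀ (v : V) (hv : v ≠ 0), Projectivization.mk ℂ v hv = p →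
        (0 < (gammaForm ω τ v v).re ∧ ∀ u ∈ S,
          HasSignature (gammaForm ω τ) (tangentSpaceAt S u) (k + 1) l) ∨
        ((gammaForm ω τ v v).re < 0 ∧ ∀ u ∈ S,
          HasSignature (gammaForm ω τ) (tangentSpaceAt S u) l (k + 1)) := by
      intro v hv hvp
      have D : CartanData ρ.diff σ ω τ v (A₀ : Set L) A H θ :=
        { hdata v hv hvp with
          fixed := fun a ha => (hA₀ ha).1
          cartan_stab := fun a ha => by
            have h1 := (hA₀ ha).2
            rw [← hvp] at h1
            exact (HolomorphicRep.mem_stabAlgebra_mk hv).1 h1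
          span := hspan
          imaginary := fun a ha x hx lam h =>
            (HolomorphicRep.re_eq_zero_of_mem_realStabAlgebra hH.compact (hA₀ ha) hx
              (z := 0) (by rw [h, add_zero]) (by rw [lie_zero, smul_zero])).1
          levi := by
            rw [← hH.complexification, ← hvp]
            congr 1
            ext x
            exact and_congr_right fun _ => HolomorphicRep.mem_stabAlgebra_mk hv
          involution := hθ
          involution_fixed := hθA }
      have h1 := D.hasSignature (hC'.self_mem_orbitTangent hirr hdim (hvC v hv hvp)) hR hR₀ hRR
      rw [← hk, ← hl] at h1
      have h2 : ∀ a b, HasSignature (gammaForm ω τ) (orbitTangent ρ.diff v) a b →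
          ∀ u ∈ S, HasSignature (gammaForm ω τ) (tangentSpaceAt S u) a b := by
        intro a b h u hu
        rw [hT u hu]
        obtain ⟨c, hc, g, hg, rfl⟩ := (hcone v hv hvp u).1 hu
        exact HolomorphicRep.hasSignature_orbitTangent_act hω hτinv hg hc h
      rcases lt_or_gt_of_ne (hherm.re_ne_zero D.gamma_self_ne_zero) with h | h
      · exact Or.inr ⟨h, h2 _ _ (h1.2 h)⟩
      · exact Or.inl ⟨h, h2 _ _ (h1.1 h)⟩
    refine ⟨hsig, fun u hu => ?_⟩
    rcases hsig v₀ hv₀ hv₀p with ⟨h, h'⟩ | ⟨h, h'⟩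
    · exact ((h' u hu).projForm_of_pos hherm (hself u hu) (hpos v₀ hv₀ hv₀p h u hu)).2
    · exact ((h' u hu).projForm_of_neg hherm (hself u hu) (hneg v₀ hv₀ hv₀p h u hu)).2
  · intro a b hab v hv hvp
    have hvS : v ∈ S := (hcone v hv hvp).self_mem
    refine ⟨fun h => ⟨?_, fun u hu => ?_⟩, fun h => ⟨?_, fun u hu => ?_⟩⟩
    · exact ((hab v hvS).projForm_of_pos hherm (hself v hvS) h).1
    · exact ((hab u hu).projForm_of_pos hherm (hself u hu) (hpos v hv hvp h u hu)).2
    · exact ((hab v hvS).projForm_of_neg hherm (hself v hvS) h).1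
    · exact ((hab u hu).projForm_of_neg hherm (hself u hu) (hneg v hv hvp h u hu)).2
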